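/- All schemes are locally of finite type over $\mathbb{C}$, and a morphism of finite type between them is the same as a quasi-compact morphism. **Motivic theories.** A motivic theory $R$ associates to every scheme $X$ an abelian group $R(X)$, functorial pull-backs $u^\ast:R(Y)\to R(X)$ for all $u:X\to Y$, functorial push-forwards $u_!:R(X)\to R(Y)$ for $u$ of finite type, an associative, symmetric, biadditive exterior product $\boxtimes:R(X)\times R(Y)\to R(X\times Y)$ with unit $1\in R(\operatorname{Spec}\mathbb{C})$, and operations $\sigma^n:R(X)\to R(\operatorname{Sym}^n X)$ ($n\ge 0$, whenever the scheme $\operatorname{Sym}^nX=X^n/\!\!/S_n$ exists), such that: $R(X)$ is the product of the $R(X_i)$ over the connected components $X_i$ of $X$; base change $\tilde u_!\tilde v^\ast=v^\ast u_!$ holds for cartesian squares with $u$ of finite type; $(u\times v)^\ast(a\boxtimes b)=u^\ast a\boxtimes v^\ast b$, $(u\times v)_!(a\boxtimes b)=u_!a\boxtimes v_!b$ and $\operatorname{Sym}^n(u)_!\sigma^n(a)=\sigma^n(u_!a)$; $\sigma^n(a+b)=\sum_{k=0}^n\sigma^k(a)\sigma^{n-k}(b)$ (products taken along $\operatorname{Sym}^kX\times\operatorname{Sym}^{n-k}X\to\operatorname{Sym}^nX$),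 $\sigma^0(a)=1$, $\sigma^1(a)=a$ and $\sigma^n(\mathbb{1}_X)=\mathbb{1}_{\operatorname{Sym}^nX}$, where $\mathbb{1}_X$ is the pull-back of $1$; and for a closed subscheme $i:Z\to X$ with open complement $j:U\to X$ one has $i^\ast i_!=\mathrm{id}$, $j^\ast j_!=\mathrm{id}$, $j^\ast i_!=0$, $i^\ast j_!=0$ and $a=i_!i^\ast a+j_!j^\ast a$ for all $a\in R(X)$. Then $R(\operatorname{Spec}\mathbb{C})$ is a commutative ring and the $R(X)$ are modules over it, via $\boxtimes$. For $c:X\to\operatorname{Spec}\mathbb{C}$ of finite type put $[X]_R=c_!c^\ast 1$, and put $\mathbb{L}_R=[\mathbb{A}^1]_R$. **Vanishing cycles.** A vanishing cycle with values in $R$ is a rule associating to every regular function $f:X\to\mathbb{A}^1$ on a smooth scheme $X$ an element $\phi_f\in R(X)$ such that (1) $\phi_{f\circ u}=u^\ast(\phi_f)$ for smooth $u:Y\to X$; (2) if $i:Y\to X$ is a smooth closed subscheme of a smooth scheme, $\pi:\mathrm{Bl}_YX\to X$ the blow-up and $j:E\to\mathrm{Bl}_YX$ its exceptional divisor, then $\pi_!(\phi_{f\circ\pi}-j_!\phi_{f\circ\pi\circ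 j})=\phi_f-i_!\phi_{f\circ i}$ for all $f:X\to\mathbb{A}^1$; (3) $\phi_{f\boxtimes g}=\phi_f\boxtimes\phi_g$ for $(f\boxtimes g)(x,y)=f(x)+g(y)$, and $\phi_{0:\operatorname{Spec}\mathbb{C}\to\mathbb{A}^1}=1$. **Stacks.** Consider disjoint unions $\mathfrak{X}=\bigsqcup_{i\in I}X_i/G_i$ of quotient stacks, where $X_i$ is a scheme with an action of a special linear algebraic group $G_i$ (special: every principal $G_i$-bundle on a scheme is Zariski locally trivial). Let $\rho_i:X_i\to X_i/G_i$ be the quotient map. $\mathfrak{X}$ is smooth if all $X_i$ are; a regular function $\mathfrak{f}$ on $\mathfrak{X}$ is a family of $G_i$-invariant regular functions $f_i=\mathfrak{f}\circ\rho_i$ on the $X_i$; closed substacks, blow-ups and exceptional divisors are given by equivariant ones of the $X_i$. Put $$R^{st}(\mathfrak{X})=\prod_{i\in I}R(X_i)^{G_i},\qquad R(X)^G=\{a\in R(X)\mid m^\ast a=\mathrm{pr}_X^\ast a\},$$ where $m,\mathrm{pr}_X:G\times X\to X$ are the action and the projection. Push-forwards along families of equivariant morphisms $X_i\to Y_i$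 of finite type and exterior products are induced by those of $R$. For a morphism of stacks $u:\mathfrak{X}\to\mathfrak{Y}=\bigsqcup_jY_j/H_j$ and $b\in R^{st}(\mathfrak{Y})$, the element $u^\ast b$ is the unique $a\in R^{st}(\mathfrak{X})$ such that, for all smooth $S\to\mathfrak{X}$ from a scheme $S$ and all $i,j$, the pull-backs of $a_i\in R(X_i)$ and $b_j\in R(Y_j)$ to $(S\times_{\mathfrak{X}}X_i)\times_S(S\times_{\mathfrak{Y}}Y_j)$ agree. A stacky vanishing cycle with values in $R^{st}$ is a rule associating to every regular function $\mathfrak{f}:\mathfrak{X}\to\mathbb{A}^1$ on a smooth such $\mathfrak{X}$ an element $\phi_{\mathfrak{f}}\in R^{st}(\mathfrak{X})$ such that the analogues of (1) (for all smooth morphisms of stacks), (2) and (3) hold. Its restriction to schemes is its restriction to the stacks $X/\{1\}=X$. **Statement.** Let $R$ be a motivic theory such that $\mathbb{L}_R$ and $\mathbb{L}_R^n-1$, for all $n>0$, are invertible in $R(\operatorname{Spec}\mathbb{C})$. Then restriction to schemes is a bijection from the set of stacky vanishing cycles with values in $R^{st}$ to the set of vanishing cycles with values in $R$. The inverse sends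 $\phi$ to the stacky vanishing cycle $\phi^{st}$ with $$\phi^{st}_{\mathfrak{f}}=\Big(\frac{\rho_{i\,!}(\phi_{f_i})}{[G_i]_R}\Big)_{i\in I}\qquad\text{for }\mathfrak{f}:\bigsqcup_iX_i/G_i\to\mathbb{A}^1\text{ and }f_i=\mathfrak{f}\circ\rho_i,$$ where $[G_i]_R$ is invertible in $R(\operatorname{Spec}\mathbb{C})$ and $\rho_!=m_!\,\mathrm{pr}_X^\ast$ for $\rho:X\to X/G$. -/

import Mathlib

open CategoryTheory AlgebraicGeometry MonoidalCategory CartesianMonoidalCategory Limits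

noncomputable section

namespace MotivicVC

universe w

/-! ### Schemes locally of finite type over `ℂ` -/

/-- The property of a `ℂ`-scheme of being locally of finite type. -/
abbrev lft : ObjectProperty (Over (Spec (CommRingCat.of ℂ))) :=
  fun X => LocallyOfFiniteType X.hom

instance : lft.IsClosedUnderIsomorphisms where
  of_iso {X Y} e h := by
    have h' : LocallyOfFiniteType X.hom := h
    have hY : Y.hom = e.inv.left ≫ X.hom := by simp
    show LocallyOfFiniteType Y.hom
    have : IsIso e.inv.left := ((Over.forget _).mapIso e.symm).isIso_hom
    rw [hY]; exact locallyOfFiniteType_comp _ _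

instance : lft.IsClosedUnderLimitsOfShape (Discrete PEmpty) := .mk' (by
    rintro _ ⟨F, hF⟩
    have e : limit F ≅ 𝟙_ _ := (limit.isLimit F).conePointUniqueUpToIso
      (isLimitChangeEmptyCone _ isTerminalTensorUnit
        ⟨𝟙_ _, ⟨fun j => j.as.elim, fun j => j.as.elim⟩⟩ (Iso.refl _))
    refine lft.prop_of_iso e.symm ?_
    show LocallyOfFiniteType (𝟙 (Spec (CommRingCat.of ℂ)))
    infer_instance)

instance : lft.IsClosedUnderLimitsOfShape (Discrete WalkingPair) := .mk' (by
    rintro _ ⟨F, hF⟩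
    have h1 : LocallyOfFiniteType (F.obj ⟨.left⟩).hom := hF ⟨.left⟩
    have h2 : LocallyOfFiniteType (F.obj ⟨.right⟩).hom := hF ⟨.right⟩
    have e : limit F ≅ F.obj ⟨.left⟩ ⊗ F.obj ⟨.right⟩ :=
      (limit.isLimit F).conePointsIsoOfNatIso
        (tensorProductIsBinaryProduct (F.obj ⟨.left⟩) (F.obj ⟨.right⟩)) (diagramIsoPair F)
    refine lft.prop_of_iso e.symm ?_
    show LocallyOfFiniteType (pullback.fst (F.obj ⟨.left⟩).hom (F.obj ⟨.right⟩).hom ≫ _)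
    infer_instance)

/-- The category of schemes locally of finite type over `ℂ`. Its cartesian monoidal structure is
the fibre product over `Spec ℂ = 𝟙_ SchC`. -/
abbrev SchC := lft.FullSubcategory

instance : BraidedCategory SchC := .ofCartesianMonoidalCategory

/-- The underlying scheme. -/
abbrev SchC.sch (X : SchC) : Scheme.{0} := X.obj.left

/-- The underlying morphism of schemes. -/
abbrev sch {X Y : SchC} (u : X ⟶ Y) : X.sch ⟶ Y.sch := u.hom.left

/-- `X` is smooth over `ℂ`. -/
def SchC.IsSmooth (X : SchC) : Prop := Smooth X.obj.hom

/-- `u` is of finite type. Morphisms of `SchC` are automatically locally of finite type, so this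
only asks for quasi-compactness. -/
def FT {X Y : SchC} (u : X ⟶ Y) : Prop := QuasiCompact (sch u)

/-- The affine line over `ℂ`. -/
def affineLine : SchC where
  obj := Over.mk (Spec.map (CommRingCat.ofHom (Polynomial.C : ℂ →+* Polynomial ℂ)))
  property := by
    show LocallyOfFiniteType (Spec.map _)
    rw [HasRingHomProperty.Spec_iff (P := @LocallyOfFiniteType)]
    show (Polynomial.C : ℂ →+* Polynomial ℂ).FiniteType
    have : (algebraMap ℂ (Polynomial ℂ)).FiniteType := by
      rw [RingHom.finiteType_algebraMap]; infer_instance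
    exact this

lemma FT.of_isAffine (X : SchC) [IsAffine X.sch] : FT (toUnit X) := by
  show QuasiCompact X.obj.hom
  infer_instance

instance : IsAffine affineLine.sch := by
  show IsAffine (Spec _)
  infer_instance

lemma FT.of_isClosedImmersion {X Y : SchC} {u : X ⟶ Y} (h : IsClosedImmersion (sch u)) :
    FT u := by
  show QuasiCompact _
  infer_instance

/-! ### Symmetric powers -/

/-- The `n`-fold power `X^n` over `ℂ`. -/
abbrev pow (X : SchC) (n : ℕ) : SchC := ∏ᶜ fun _ : Fin n => X

/-- The permutation of the factors of `X^n`. -/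
def permMap (X : SchC) {n : ℕ} (s : Equiv.Perm (Fin n)) : pow X n ⟶ pow X n :=
  Pi.lift fun k => Pi.π _ (s k)

/-- `u^n : X^n ⟶ Y^n`. -/
def powMap {X Y : SchC} (u : X ⟶ Y) (n : ℕ) : pow X n ⟶ pow Y n :=
  Pi.lift fun k => Pi.π _ k ≫ u

/-- The concatenation `X^k × X^l ⟶ X^n` for `k + l = n`. -/
def concat (X : SchC) {k l n : ℕ} (h : k + l = n) : pow X k ⊗ pow X l ⟶ pow X n :=
  Pi.lift fun j => Fin.addCases (motive := fun _ => (pow X k ⊗ pow X l ⟶ X))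
    (fun a => fst _ _ ≫ Pi.π _ a) (fun b => snd _ _ ≫ Pi.π _ b) (Fin.cast h.symm j)

/-- A symmetric power `Sym^n X = X^n // S_n`: an affine `S_n`-invariant morphism `q : X^n ⟶ Sym^n X`
such that the functions on an open `U` are the `S_n`-invariant functions on `q⁻¹ U`. -/
structure SymPower (X : SchC) (n : ℕ) where
  pt : SchC
  q : pow X n ⟶ pt
  perm_comp : ∀ s : Equiv.Perm (Fin n), permMap X s ≫ q = q
  affine : IsAffineHom (sch q)
  app_injective : ∀ U : pt.sch.Opens, Function.Injective ((sch q).app U).hom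
  mem_range_iff : ∀ (U : pt.sch.Opens) (a : Γ((pow X n).sch, (sch q) ⁻¹ᵁ U)),
    a ∈ Set.range ((sch q).app U).hom ↔
      ∀ (s : Equiv.Perm (Fin n))
        (h : (sch q) ⁻¹ᵁ U ≤ (sch (permMap X s)) ⁻¹ᵁ ((sch q) ⁻¹ᵁ U)),
        ((sch (permMap X s)).appLE _ _ h).hom a = a

/-! ### Motivic theories -/

/-- A motivic theory. The unit object `𝟙_ SchC` is `Spec ℂ`, `X ⊗ Y` is the product over `ℂ`,
`toUnit X` is the structure morphism of `X`. Symmetric powers need not exist as schemes for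
all `X`; the operations `σ^n` are defined whenever they do. -/
structure MotivicTheory where
  obj : SchC → Type w
  [grp : ∀ X, AddCommGroup (obj X)]
  pull : ∀ {X Y : SchC}, (X ⟶ Y) → obj Y →+ obj X
  push : ∀ {X Y : SchC} (u : X ⟶ Y), FT u → obj X →+ obj Y
  box : ∀ {X Y : SchC}, obj X →+ obj Y →+ obj (X ⊗ Y)
  one : obj (𝟙_ SchC)
  sigma : ∀ {X : SchC} {n : ℕ} (S : SymPower X n), obj X → obj S.pt
  pull_id : ∀ {X : SchC} (a : obj X), pull (𝟙 X) a = a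
  pull_comp : ∀ {X Y Z : SchC} (u : X ⟶ Y) (v : Y ⟶ Z) (a : obj Z),
    pull (u ≫ v) a = pull u (pull v a)
  push_id : ∀ {X : SchC} (h : FT (𝟙 X)) (a : obj X), push (𝟙 X) h a = a
  push_comp : ∀ {X Y Z : SchC} (u : X ⟶ Y) (v : Y ⟶ Z) (hu : FT u) (hv : FT v) (huv : FT (u ≫ v))
    (a : obj X), push (u ≫ v) huv a = push v hv (push u hu a)
  box_assoc : ∀ {X Y Z : SchC} (a : obj X) (b : obj Y) (c : obj Z),
    pull (α_ X Y Z).hom (box a (box b c)) = box (box a b) c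
  box_symm : ∀ {X Y : SchC} (a : obj X) (b : obj Y), pull (β_ X Y).hom (box b a) = box a b
  one_box : ∀ {X : SchC} (a : obj X), pull (λ_ X).hom a = box one a
  /-- `R(X)` is the product of the `R(X_i)` over the connected components `X_i` of `X`. -/
  components : ∀ {X : SchC} {J : Type} (C : J → SchC) (j : ∀ i, C i ⟶ X),
    (∀ i, IsOpenImmersion (sch (j i))) → (∀ i, ConnectedSpace (C i).sch) →
    (∀ x : X.sch, ∃! i, x ∈ Set.range (sch (j i))) →
    Function.Bijective fun (a : obj X) (i : J) => pull (j i) a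
  base_change : ∀ {W X Y Z : SchC} {v' : W ⟶ X} {u' : W ⟶ Y} {u : X ⟶ Z} {v : Y ⟶ Z},
    IsPullback v' u' u v → ∀ (hu : FT u) (hu' : FT u') (a : obj X),
      push u' hu' (pull v' a) = pull v (push u hu a)
  pull_box : ∀ {X X' Y Y' : SchC} (u : X ⟶ X') (v : Y ⟶ Y') (a : obj X') (b : obj Y'),
    pull (u ⊗ₘ v) (box a b) = box (pull u a) (pull v b)
  push_box : ∀ {X X' Y Y' : SchC} (u : X ⟶ X') (v : Y ⟶ Y') (hu : FT u) (hv : FT v)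
    (huv : FT (u ⊗ₘ v)) (a : obj X) (b : obj Y),
    push (u ⊗ₘ v) huv (box a b) = box (push u hu a) (push v hv b)
  push_sigma : ∀ {X Y : SchC} {n : ℕ} (S : SymPower X n) (T : SymPower Y n) (u : X ⟶ Y)
    (v : S.pt ⟶ T.pt) (hu : FT u) (hv : FT v), S.q ≫ v = powMap u n ≫ T.q →
    ∀ a : obj X, push v hv (sigma S a) = sigma T (push u hu a)
  sigma_add : ∀ {X : SchC} {n : ℕ} (T : SymPower X n) (S : ∀ k : Fin (n + 1), SymPower X k)
    (c : ∀ k : Fin (n + 1), (S k).pt ⊗ (S k.rev).pt ⟶ T.pt) (hc : ∀ k, FT (c k)),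
    (∀ k : Fin (n + 1), ((S k).q ⊗ₘ (S k.rev).q) ≫ c k =
      concat X (by rw [Fin.val_rev]; omega) ≫ T.q) →
    ∀ a b : obj X, sigma T (a + b) =
      ∑ k : Fin (n + 1), push (c k) (hc k) (box (sigma (S k) a) (sigma (S k.rev) b))
  sigma_zero : ∀ {X : SchC} (S : SymPower X 0) (a : obj X), sigma S a = pull (toUnit S.pt) one
  sigma_one : ∀ {X : SchC} (S : SymPower X 1) (h : FT (Pi.lift (fun _ => 𝟙 X) ≫ S.q))
    (a : obj X), sigma S a = push (Pi.lift (fun _ => 𝟙 X) ≫ S.q) h a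
  /-- The motivic property, for a closed subscheme `Z` of `X` with open complement `U`. -/
  motivic : ∀ {X Z U : SchC} (i : Z ⟶ X) (j : U ⟶ X) (hi : FT i) (hj : FT j),
    IsClosedImmersion (sch i) → IsOpenImmersion (sch j) →
    Set.range (sch j) = (Set.range (sch i))ᶜ →
    (∀ a, pull i (push i hi a) = a) ∧ (∀ a, pull j (push j hj a) = a) ∧
    (∀ a, pull j (push i hi a) = 0) ∧ (∀ a, pull i (push j hj a) = 0) ∧
    ∀ a, a = push i hi (pull i a) + push j hj (pull j a)
  sigma_unit : ∀ {X : SchC} {n : ℕ} (S : SymPower X n),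
    sigma S (pull (toUnit X) one) = pull (toUnit S.pt) one

attribute [instance] MotivicTheory.grp

namespace MotivicTheory

variable (R : MotivicTheory.{w})

/-- The `R(Spec ℂ)`-module structure of `R(X)` given by the exterior product. -/
def smul {X : SchC} (c : R.obj (𝟙_ SchC)) : R.obj X →+ R.obj X :=
  (R.pull (λ_ X).inv).comp (R.box c)

lemma point_hom_ext {A : SchC} (f g : A ⟶ 𝟙_ SchC ⊗ 𝟙_ SchC) : f = g := by
  exact CartesianMonoidalCategory.hom_ext _ _ (toUnit_unique _ _) (toUnit_unique _ _)

lemma box_eq {X Y X' Y' : SchC} (u : X ⟶ X') (v : Y ⟶ Y') (a : R.obj X') (b : R.obj Y') :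
    R.box (R.pull u a) (R.pull v b) = R.pull (u ⊗ₘ v) (R.box a b) := (R.pull_box ..).symm

/-- The commutative ring structure of `R(Spec ℂ)` given by the exterior product. -/
instance : CommRing (R.obj (𝟙_ SchC)) :=
  { R.grp (𝟙_ SchC) with
    mul := fun a b => R.smul a b
    one := R.one
    left_distrib := fun a b c => map_add (R.smul a) b c
    right_distrib := fun a b c => by
      show R.pull _ (R.box (a + b) c) = R.pull _ (R.box a c) + R.pull _ (R.box b c)
      simp
    zero_mul := fun a => by
      show R.pull _ (R.box 0 a) = 0
      simp
    mul_zero := fun a => map_zero (R.smul a)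
    mul_assoc := fun a b c => by
      show R.pull _ (R.box (R.pull _ (R.box a b)) c) = R.pull _ (R.box a (R.pull _ (R.box b c)))
      conv_lhs => rw [← R.pull_id c]
      conv_rhs => rw [← R.pull_id a]
      rw [box_eq, box_eq, ← R.box_assoc, ← R.pull_comp, ← R.pull_comp, ← R.pull_comp]
      congr 2
      exact CartesianMonoidalCategory.hom_ext _ _ (toUnit_unique _ _) (point_hom_ext _ _)
    one_mul := fun a => by
      show R.pull _ (R.box R.one a) = a
      rw [← R.one_box, ← R.pull_comp, Iso.inv_hom_id, R.pull_id]
    mul_one := fun a => by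
      show R.pull _ (R.box a R.one) = a
      rw [← R.box_symm, ← R.one_box, ← R.pull_comp, ← R.pull_comp]
      conv_rhs => rw [← R.pull_id a]
      congr 2
      exact toUnit_unique _ _
    mul_comm := fun a b => by
      show R.pull _ (R.box a b) = R.pull _ (R.box b a)
      rw [← R.box_symm, ← R.pull_comp]
      congr 2
      exact point_hom_ext _ _ }

/-- The class `[X]_R = c_! c^* 1` in `R(Spec ℂ)`, for `c : X ⟶ Spec ℂ` of finite type. -/
def cls (X : SchC) (h : FT (toUnit X)) : R.obj (𝟙_ SchC) :=
  R.push (toUnit X) h (R.pull (toUnit X) R.one)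

/-- `𝕃_R = [𝔸¹]_R`. -/
def lefschetz : R.obj (𝟙_ SchC) := R.cls affineLine (FT.of_isAffine _)

end MotivicTheory

/-! ### Regular functions, blow-ups and vanishing cycles on schemes -/

/-- Regular functions `X ⟶ 𝔸¹`, as global sections of the structure sheaf. -/
abbrev Fn (X : SchC) := Γ(X.sch, ⊤)

/-- The composition `f ∘ u` of a regular function with a morphism. -/
def Fn.comp {X Y : SchC} (u : Y ⟶ X) : Fn X →+* Fn Y := (sch u).appTop.hom

/-- `f ⊠ g = f(x) + g(y)` on `X × Y`. -/
def Fn.box {X Y : SchC} (f : Fn X) (g : Fn Y) : Fn (X ⊗ Y) :=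
  Fn.comp (fst X Y) f + Fn.comp (snd X Y) g

lemma Fn.comp_comp {X Y Z : SchC} (u : X ⟶ Y) (v : Y ⟶ Z) (f : Fn Z) :
    Fn.comp u (Fn.comp v f) = Fn.comp (u ≫ v) f := by
  show _ = (Scheme.Hom.appTop (sch u ≫ sch v)).hom f
  rw [Scheme.Hom.comp_appTop]; rfl

/-- `j : E ⟶ B` is (the inclusion of) an effective Cartier divisor: a closed subscheme locally
defined by one equation that is a nonzerodivisor. -/
def IsEffectiveCartier {E B : SchC} (j : E ⟶ B) : Prop :=
  IsClosedImmersion (sch j) ∧ ∀ b : B.sch, ∃ U : B.sch.affineOpens, b ∈ U.1 ∧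
    ∃ f ∈ nonZeroDivisors Γ(B.sch, U.1), (sch j).ker.ideal U = Ideal.span {f}

/-- `π : B ⟶ X` is the blow-up of `X` in the closed subscheme `i : Y ⟶ X`, and `j : E ⟶ B` is
the exceptional divisor, mapping to `Y` by `e`. The blow-up is characterized by its universal
property; that it is of finite type is automatic. -/
structure IsBlowUp {Y X B E : SchC} (i : Y ⟶ X) (π : B ⟶ X) (j : E ⟶ B) (e : E ⟶ Y) : Prop where
  closed : IsClosedImmersion (sch i)
  finiteType : FT π
  isPullback : IsPullback j e π i
  cartier : IsEffectiveCartier j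
  universal : ∀ {T D : SchC} (t : T ⟶ X) (k : D ⟶ T) (d : D ⟶ Y), IsPullback k d t i →
    IsEffectiveCartier k → ∃! b : T ⟶ B, b ≫ π = t

lemma isSmooth_unit : (𝟙_ SchC).IsSmooth := by
  show Smooth (𝟙 (Spec (CommRingCat.of ℂ)))
  infer_instance

lemma SchC.IsSmooth.prod {X Y : SchC} (hX : X.IsSmooth) (hY : Y.IsSmooth) :
    (X ⊗ Y).IsSmooth := by
  have h1 : Smooth X.obj.hom := hX
  have h2 : Smooth Y.obj.hom := hY
  show Smooth (pullback.fst X.obj.hom Y.obj.hom ≫ X.obj.hom)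
  infer_instance

/-- A family of elements `φ_f ∈ R(X)`, for the regular functions `f` on smooth schemes `X`. -/
abbrev VCFamily (R : MotivicTheory.{w}) :=
  ∀ X : SchC, X.IsSmooth → Fn X → R.obj X

/-- `φ` is a vanishing cycle with values in `R`. -/
structure IsVanishingCycle (R : MotivicTheory.{w}) (φ : VCFamily R) : Prop where
  smooth_pull : ∀ {X Y : SchC} (hX : X.IsSmooth) (hY : Y.IsSmooth) (u : Y ⟶ X),
    Smooth (sch u) → ∀ f : Fn X, φ Y hY (Fn.comp u f) = R.pull u (φ X hX f)
  blowUp : ∀ {Y X B E : SchC} {i : Y ⟶ X} {π : B ⟶ X} {j : E ⟶ B} {e : E ⟶ Y}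
    (h : IsBlowUp i π j e) (hX : X.IsSmooth) (hY : Y.IsSmooth) (hB : B.IsSmooth)
    (hE : E.IsSmooth) (f : Fn X),
    R.push π h.finiteType (φ B hB (Fn.comp π f) -
        R.push j (.of_isClosedImmersion h.cartier.1) (φ E hE (Fn.comp j (Fn.comp π f)))) =
      φ X hX f - R.push i (.of_isClosedImmersion h.closed) (φ Y hY (Fn.comp i f))
  box : ∀ {X Y : SchC} (hX : X.IsSmooth) (hY : Y.IsSmooth) (f : Fn X) (g : Fn Y),
    φ (X ⊗ Y) (hX.prod hY) (Fn.box f g) = R.box (φ X hX f) (φ Y hY g)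
  unit : φ (𝟙_ SchC) isSmooth_unit 0 = R.one

/-! ### Linear algebraic groups and principal bundles -/

/-- The action `G × X ⟶ X`. -/
abbrev act (G X : SchC) [GrpObj G] [ModObj G X] : G ⊗ X ⟶ X :=
  ModObj.smul (M := G) (X := X)

/-- `G` is a linear algebraic group, that is, a smooth group scheme with a homomorphism to some
`GL_n` that is a closed immersion. This homomorphism is the same as an invertible matrix `M` of
functions on `G` with `M(gh) = M(g) M(h)`; it is a closed immersion if `G` is affine and if the
entries of `M` and of its inverse generate the functions on `G` as a `ℂ`-algebra. -/
structure IsLinearAlgebraic (G : SchC) [GrpObj G] : Prop where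
  affine : IsAffine G.sch
  smooth : G.IsSmooth
  closed_embedding : ∃ (n : ℕ) (M : Matrix.GeneralLinearGroup (Fin n) (Fn G)),
    Matrix.GeneralLinearGroup.map (Fn.comp (MonObj.mul (X := G))) M =
      Matrix.GeneralLinearGroup.map (Fn.comp (fst G G)) M *
        Matrix.GeneralLinearGroup.map (Fn.comp (snd G G)) M ∧
    Subring.closure (Set.range (Fn.comp (toUnit G)) ∪ (Set.range fun k : Fin n × Fin n => M k.1 k.2) ∪
      (Set.range fun k : Fin n × Fin n => M⁻¹ k.1 k.2)) = ⊤

/-- The `G`-scheme `P` with the morphism `τ : P ⟶ S` is a principal `G`-bundle: `τ` is smooth and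
surjective (so it has sections étale locally), and the square formed by the
action and the projection `G × P ⇉ P` over `S` is cartesian. -/
structure IsPrincipalBundle (G : SchC) [GrpObj G] {P S : SchC} [ModObj G P] (τ : P ⟶ S) :
    Prop where
  smooth : Smooth (sch τ)
  surjective : Surjective (sch τ)
  isPullback : IsPullback (act G P) (snd G P) τ τ

/-- `G` is special: every principal `G`-bundle is Zariski locally trivial, that is, has sections
Zariski locally on the base. -/
def IsSpecial (G : SchC) [GrpObj G] : Prop :=
  ∀ (P S : SchC) [ModObj G P] (τ : P ⟶ S), IsPrincipalBundle G τ → ∀ s : S.sch,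
    ∃ (U : SchC) (g : U ⟶ S) (t : U ⟶ P),
      IsOpenImmersion (sch g) ∧ s ∈ Set.range (sch g) ∧ t ≫ τ = g

lemma lift_act {G X Z : SchC} [GrpObj G] [ModObj G X] (a : Z ⟶ G) (b : Z ⟶ X) :
    lift a b ≫ act G X = a • b := by
  rw [Hom.smul_def]

open MonObj in
/-- The automorphism `(g, x) ↦ (g, g x)` of `G × X`. -/
def shear (G X : SchC) [GrpObj G] [ModObj G X] : G ⊗ X ≅ G ⊗ X where
  hom := lift (fst G X) (act G X)
  inv := lift (fst G X) (lift (fst G X ≫ GrpObj.inv) (snd G X) ≫ act G X)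
  hom_inv_id := by
    have h : act G X = fst G X • snd G X := by simp [Hom.smul_def]
    apply CartesianMonoidalCategory.hom_ext
    · simp
    · have h2 : (fst G X ≫ GrpObj.inv) * fst G X = 1 := by
        rw [← Hom.inv_def]; simp
      have h3 := mul_smul (fst G X ≫ GrpObj.inv) (fst G X) (snd G X)
      rw [h2, one_smul] at h3
      simp only [comp_lift, lift_snd, Category.id_comp]
      rw [← Category.assoc, comp_lift, lift_fst_assoc, lift_snd, lift_act, h]
      exact h3.symm
  inv_hom_id := by
    apply CartesianMonoidalCategory.hom_ext
    · simp
    · have h2 : fst G X * (fst G X ≫ GrpObj.inv) = 1 := by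
        rw [← Hom.inv_def]; simp
      have h3 := mul_smul (fst G X) (fst G X ≫ GrpObj.inv) (snd G X)
      rw [h2, one_smul] at h3
      simp only [Category.assoc, lift_snd, Category.id_comp]
      rw [lift_act, lift_act]
      exact h3.symm

lemma shear_snd (G X : SchC) [GrpObj G] [ModObj G X] : (shear G X).hom ≫ snd G X = act G X := by
  simp [shear]

lemma FT.act (G X : SchC) [GrpObj G] [ModObj G X] (h : IsLinearAlgebraic G) : FT (act G X) := by
  have h0 : IsAffine G.sch := h.affine
  have h1 : QuasiCompact G.obj.hom := inferInstance
  have h2 : QuasiCompact (sch (snd G X)) := by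
    show QuasiCompact (pullback.snd G.obj.hom X.obj.hom)
    infer_instance
  have h3 : sch (MotivicVC.act G X) = sch (shear G X).hom ≫ sch (snd G X) := by
    rw [← shear_snd]; rfl
  have h4 : IsIso (sch (shear G X).hom) :=
    ((lft.ι ⋙ Over.forget _).mapIso (shear G X)).isIso_hom
  show QuasiCompact _
  rw [h3]; infer_instance

/-! ### Disjoint unions of quotient stacks -/

/-- A family of groups `G_i`. -/
structure GroupFamily where
  I : Type
  G : I → SchC
  [grp : ∀ i, GrpObj (G i)]

attribute [instance] GroupFamily.grp

/-- All `G_i` are special linear algebraic groups. -/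
structure GroupFamily.Admissible (Γ : GroupFamily) : Prop where
  linear : ∀ i, IsLinearAlgebraic (Γ.G i)
  special : ∀ i, IsSpecial (Γ.G i)

/-- A family of schemes `X_i` with actions of `G_i`. It presents `⊔_i X_i / G_i`. -/
structure GSpace (Γ : GroupFamily) where
  X : Γ.I → SchC
  [mod : ∀ i, ModObj (Γ.G i) (X i)]

attribute [instance] GSpace.mod

variable {Γ Δ : GroupFamily}

/-- `⊔_i X_i / G_i` is smooth. -/
def GSpace.IsSmooth (X : GSpace Γ) : Prop := ∀ i, (X.X i).IsSmooth

/-- An object of the stack `⊔_i X_i / G_i` over a scheme `S`. It consists of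
principal `G_i`-bundles `P_i ⟶ S_i`, where the `S_i` (the images of the `P_i`) are disjoint
open subschemes covering `S`, and of `G_i`-equivariant morphisms `m_i : P_i ⟶ X_i`. -/
structure Chart (X : GSpace Γ) where
  S : SchC
  P : Γ.I → SchC
  [mod : ∀ i, ModObj (Γ.G i) (P i)]
  τ : ∀ i, P i ⟶ S
  m : ∀ i, P i ⟶ X.X i
  equivariant : ∀ i, IsModHom (Γ.G i) (m i)
  smooth : ∀ i, Smooth (sch (τ i))
  isPullback : ∀ i, IsPullback (act (Γ.G i) (P i)) (snd (Γ.G i) (P i)) (τ i) (τ i)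
  cover : ∀ s : S.sch, ∃! i, s ∈ Set.range (sch (τ i))

attribute [instance] Chart.mod

/-- Morphisms in the stack `⊔_i X_i / G_i` over `f : S ⟶ S'`: equivariant morphisms of bundles
compatible with the maps to `X_i`, which identify `P_i` with the pull-back of `P_i'`. -/
@[ext]
structure Chart.Hom {X : GSpace Γ} (x y : Chart X) where
  f : x.S ⟶ y.S
  h : ∀ i, x.P i ⟶ y.P i
  equivariant : ∀ i, IsModHom (Γ.G i) (h i)
  comp_m : ∀ i, h i ≫ y.m i = x.m i
  isPullback : ∀ i, IsPullback (h i) (x.τ i) (y.τ i) f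

instance (X : GSpace Γ) : Category (Chart X) where
  Hom := Chart.Hom
  id x := ⟨𝟙 _, fun _ => 𝟙 _, fun _ => inferInstance, fun _ => by simp,
    fun _ => IsPullback.of_id_fst⟩
  comp {x y z} a b := ⟨a.f ≫ b.f, fun i => a.h i ≫ b.h i,
    fun i => by
      have := a.equivariant i
      have := b.equivariant i
      infer_instance,
    fun i => by simp [a.comp_m, b.comp_m],
    fun i => (a.isPullback i).paste_horiz (b.isPullback i)⟩
  id_comp _ := Chart.Hom.ext (Category.id_comp _) (funext fun _ => Category.id_comp _)
  comp_id _ := Chart.Hom.ext (Category.comp_id _) (funext fun _ => Category.comp_id _)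
  assoc _ _ _ := Chart.Hom.ext (Category.assoc _ _ _) (funext fun _ => Category.assoc _ _ _)

/-- The stack `⊔_i X_i / G_i`, as a category fibred in groupoids over `SchC`. The 1-morphisms of
such stacks are the based functors `X.stack ⥤ᵇ Y.stack`. -/
def GSpace.stack (X : GSpace Γ) : BasedCategory SchC :=
  .ofFunctor (𝒳 := Chart X) { obj := fun x => x.S, map := fun a => Chart.Hom.f a }

/-- The object `x` over `S`, seen as a morphism `S ⟶ ⊔_i X_i / G_i`, is smooth. -/
def Chart.IsSmooth {X : GSpace Γ} (x : Chart X) : Prop := ∀ i, Smooth (sch (x.m i))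

/-- The object `u ∘ x` of the stack `Y`. -/
def mapChart {X : GSpace Γ} {Y : GSpace Δ} (u : BasedFunctor X.stack Y.stack) (x : Chart X) :
    Chart Y := u.obj x

lemma mapChart_S {X : GSpace Γ} {Y : GSpace Δ} (u : BasedFunctor X.stack Y.stack) (x : Chart X) :
    (mapChart u x).S = x.S := u.w_obj x

/-- A morphism of stacks is smooth if it maps smooth `S ⟶ X` to smooth `S ⟶ Y`. -/
def IsSmoothMor {X : GSpace Γ} {Y : GSpace Δ} (u : BasedFunctor X.stack Y.stack) : Prop :=
  ∀ x : Chart X, x.IsSmooth → (mapChart u x).IsSmooth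

/-! ### Pull-backs of schemes -/

lemma isPullback_sch {W X Y Z : SchC} {a : W ⟶ X} {b : W ⟶ Y} {c : X ⟶ Z} {d : Y ⟶ Z}
    (h : IsPullback a b c d) : IsPullback (sch a) (sch b) (sch c) (sch d) := by
  have hw : sch a ≫ sch c = sch b ≫ sch d := congrArg sch h.w
  have ha : LocallyOfFiniteType X.obj.hom := X.property
  have hd : LocallyOfFiniteType (sch d) := by
    have h1 : LocallyOfFiniteType (sch d ≫ Z.obj.hom) := by
      rw [show sch d ≫ Z.obj.hom = Y.obj.hom from Over.w d.hom]; exact Y.property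
    exact locallyOfFiniteType_of_comp (sch d) Z.obj.hom
  let T : SchC := ⟨Over.mk (pullback.fst (sch c) (sch d) ≫ X.obj.hom),
    by show LocallyOfFiniteType (pullback.fst (sch c) (sch d) ≫ X.obj.hom); infer_instance⟩
  let t1 : T ⟶ X := ⟨Over.homMk (pullback.fst (sch c) (sch d)) rfl⟩
  let t2 : T ⟶ Y := ⟨Over.homMk (pullback.snd (sch c) (sch d)) (by
    show _ ≫ Y.obj.hom = pullback.fst (sch c) (sch d) ≫ X.obj.hom
    rw [← Over.w d.hom, ← Over.w c.hom]
    show pullback.snd (sch c) (sch d) ≫ sch d ≫ _ = pullback.fst (sch c) (sch d) ≫ sch c ≫ _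
    rw [← Category.assoc, ← Category.assoc, pullback.condition])⟩
  have ht : t1 ≫ c = t2 ≫ d :=
    ObjectProperty.hom_ext _ (Over.OverMorphism.ext pullback.condition)
  let t : T ⟶ W := h.lift t1 t2 ht
  let w : W ⟶ T := ⟨Over.homMk (pullback.lift (sch a) (sch b) hw) (by
    show _ ≫ pullback.fst (sch c) (sch d) ≫ X.obj.hom = _
    rw [← Category.assoc, pullback.lift_fst]; exact Over.w a.hom)⟩
  have w1 : w ≫ t1 = a :=
    ObjectProperty.hom_ext _ (Over.OverMorphism.ext (pullback.lift_fst _ _ _))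
  have w2 : w ≫ t2 = b :=
    ObjectProperty.hom_ext _ (Over.OverMorphism.ext (pullback.lift_snd _ _ _))
  have hwt : w ≫ t = 𝟙 W := by
    apply h.hom_ext
    · rw [Category.assoc, h.lift_fst, w1, Category.id_comp]
    · rw [Category.assoc, h.lift_snd, w2, Category.id_comp]
  have hta : sch t ≫ sch a = pullback.fst (sch c) (sch d) :=
    congrArg sch (h.lift_fst t1 t2 ht)
  have htb : sch t ≫ sch b = pullback.snd (sch c) (sch d) :=
    congrArg sch (h.lift_snd t1 t2 ht)
  refine ⟨⟨hw⟩, ⟨PullbackCone.IsLimit.mk hw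
    (fun s => pullback.lift s.fst s.snd s.condition ≫ sch t) (fun s => ?_) (fun s => ?_)
    (fun s m h1 h2 => ?_)⟩⟩
  · rw [Category.assoc, hta, pullback.lift_fst]
  · rw [Category.assoc, htb, pullback.lift_snd]
  · have h3 : sch w ≫ sch t = 𝟙 W.sch := congrArg sch hwt
    rw [← Category.comp_id m, ← h3, ← Category.assoc]
    congr 1
    apply pullback.hom_ext
    · rw [pullback.lift_fst, ← h1, Category.assoc]
      congr 1
      exact congrArg sch w1
    · rw [pullback.lift_snd, ← h2, Category.assoc]
      congr 1
      exact congrArg sch w2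

lemma FT.base_change {W X Y Z : SchC} {a : W ⟶ X} {b : W ⟶ Y} {c : X ⟶ Z} {d : Y ⟶ Z}
    (h : IsPullback a b c d) (hc : FT c) : FT b :=
  MorphismProperty.of_isPullback (P := @QuasiCompact) (isPullback_sch h) hc

lemma isPullback_snd (G : SchC) {X Y : SchC} (f : X ⟶ Y) :
    IsPullback (snd G X) (G ◁ f) f (snd G Y) := by
  refine ⟨⟨by simp⟩, ⟨PullbackCone.IsLimit.mk (by simp)
    (fun s => lift (s.snd ≫ fst G Y) s.fst) (fun s => ?_) (fun s => ?_) (fun s m h1 h2 => ?_)⟩⟩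
  · simp
  · apply CartesianMonoidalCategory.hom_ext
    · simp
    · simpa using s.condition
  · apply CartesianMonoidalCategory.hom_ext
    · simp [← h2]
    · simpa using h1

lemma isPullback_act (G : SchC) [GrpObj G] {X Y : SchC} [ModObj G X] [ModObj G Y] (f : X ⟶ Y)
    [IsModHom G f] : IsPullback (act G X) (G ◁ f) f (act G Y) := by
  have hf : act G X ≫ f = (G ◁ f) ≫ act G Y := by
    have h := IsModHom.map_smul (M := G) f (fst G X) (snd G X)
    rw [Hom.smul_def, Hom.smul_def, lift_fst_snd, Category.id_comp] at h
    rw [show G ◁ f = lift (fst G X) (snd G X ≫ f) by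
      apply CartesianMonoidalCategory.hom_ext <;> simp]
    exact h
  have h1 : IsPullback (shear G X).hom (G ◁ f) (G ◁ f) (shear G Y).hom := by
    refine IsPullback.of_horiz_isIso ⟨?_⟩
    apply CartesianMonoidalCategory.hom_ext
    · simp [shear]
    · simp [shear, hf]
  have h2 := h1.paste_horiz (isPullback_snd G f)
  rwa [shear_snd, shear_snd] at h2

/-! ### The group `R^st` of a disjoint union of quotient stacks -/

variable (R : MotivicTheory.{w})

/-- The group `R(X)^G` of invariant elements. -/
def MotivicTheory.invariants (G X : SchC) [GrpObj G] [ModObj G X] : AddSubgroup (R.obj X) :=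
  AddMonoidHom.eqLocus (R.pull (act G X)) (R.pull (snd G X))

/-- `R^st(⊔_i X_i / G_i) = ∏_i R(X_i)^{G_i}`. -/
abbrev RSt (X : GSpace Γ) := ∀ i, R.invariants (Γ.G i) (X.X i)

/-- Regular functions on `⊔_i X_i / G_i`: families of invariant functions on the `X_i`. -/
@[ext]
structure InvFn (X : GSpace Γ) where
  f : ∀ i, Fn (X.X i)
  invariant : ∀ i, Fn.comp (act (Γ.G i) (X.X i)) (f i) = Fn.comp (snd (Γ.G i) (X.X i)) (f i)

/-- `a = u^*(b)` for `a ∈ R^st(⊔_i X_i / G_i)`, `b ∈ R^st(⊔_j Y_j / H_j)`, where `u` is a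
1-morphism `⊔_i X_i / G_i ⟶ ⊔_j Y_j / H_j`. A smooth morphism `S ⟶ ⊔_i X_i / G_i` is given by
bundles `P_i` and maps `m_i : P_i ⟶ X_i`, and its composition with `u` by `P_j'` and
`m_j' : P_j' ⟶ Y_j`. The element `u^*(b)` is the unique `a` such that `m_i^*(a_i)` and
`m_j'^*(b_j)` agree on all `P_i ×_S P_j'`. -/
def IsPullbackSt {X : GSpace Γ} {Y : GSpace Δ} (u : BasedFunctor X.stack Y.stack)
    (a : RSt R X) (b : RSt R Y) : Prop :=
  ∀ x : Chart X, x.IsSmooth → ∀ (i : Γ.I) (j : Δ.I) (W : SchC) (p : W ⟶ x.P i)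
    (q : W ⟶ (mapChart u x).P j),
    IsPullback p q (x.τ i) ((mapChart u x).τ j ≫ eqToHom (mapChart_S u x)) →
    R.pull (p ≫ x.m i) (a i : R.obj (X.X i)) =
      R.pull (q ≫ (mapChart u x).m j) (b j : R.obj (Y.X j))

/-- `g = f ∘ u` for regular functions `g` on `⊔_i X_i / G_i` and `f` on `⊔_j Y_j / H_j`. -/
def IsCompSt {X : GSpace Γ} {Y : GSpace Δ} (u : BasedFunctor X.stack Y.stack)
    (g : InvFn X) (f : InvFn Y) : Prop :=
  ∀ x : Chart X, x.IsSmooth → ∀ (i : Γ.I) (j : Δ.I) (W : SchC) (p : W ⟶ x.P i)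
    (q : W ⟶ (mapChart u x).P j),
    IsPullback p q (x.τ i) ((mapChart u x).τ j ≫ eqToHom (mapChart_S u x)) →
    Fn.comp (p ≫ x.m i) (g.f i) = Fn.comp (q ≫ (mapChart u x).m j) (f.f j)

/-- A family of equivariant morphisms `X_i ⟶ Y_i`. It induces a representable morphism
`⊔_i X_i / G_i ⟶ ⊔_i Y_i / G_i`. -/
structure GSpace.Hom (X Y : GSpace Γ) where
  f : ∀ i, X.X i ⟶ Y.X i
  equivariant : ∀ i, IsModHom (Γ.G i) (f i)

/-- The composition of a function on `⊔_i Y_i / G_i` with `⊔_i X_i / G_i ⟶ ⊔_i Y_i / G_i`. -/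
def InvFn.comp {X Y : GSpace Γ} (u : X.Hom Y) (f : InvFn Y) : InvFn X where
  f i := Fn.comp (u.f i) (f.f i)
  invariant i := by
    have h1 := (isPullback_snd (Γ.G i) (u.f i)).w
    have := u.equivariant i
    have h2 := (isPullback_act (Γ.G i) (u.f i)).w
    rw [Fn.comp_comp, Fn.comp_comp, h1, h2, ← Fn.comp_comp, ← Fn.comp_comp, f.invariant]

/-- The push-forward `R^st(⊔_i X_i / G_i) ⟶ R^st(⊔_i Y_i / G_i)`. -/
def RSt.push {X Y : GSpace Γ} (u : X.Hom Y) (hu : ∀ i, FT (u.f i)) (a : RSt R X) : RSt R Y :=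
  fun i => ⟨R.push (u.f i) (hu i) (a i), by
    have := u.equivariant i
    have h1 := isPullback_snd (Γ.G i) (u.f i)
    have h2 := isPullback_act (Γ.G i) (u.f i)
    have h3 : R.pull (act (Γ.G i) (X.X i)) (a i : R.obj (X.X i)) = R.pull (snd _ _) (a i) :=
      (a i).2
    show R.pull _ _ = R.pull _ _
    rw [← R.base_change h1 (hu i) (.base_change h1 (hu i)),
      ← R.base_change h2 (hu i) (.base_change h2 (hu i)), h3]⟩

/-- The product of two families of groups. -/
def GroupFamily.prod (Γ Δ : GroupFamily) : GroupFamily where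
  I := Γ.I × Δ.I
  G k := Γ.G k.1 ⊗ Δ.G k.2
  grp _ := inferInstance

open MonObj in
/-- An action given by a morphism that satisfies the laws on generalized points. -/
@[reducible]
def modObjOfPoints {G X : SchC} [GrpObj G] (a : G ⊗ X ⟶ X)
    (h1 : lift (1 : X ⟶ G) (𝟙 X) ≫ a = 𝟙 X)
    (h2 : ∀ (Z : SchC) (g h : Z ⟶ G) (x : Z ⟶ X),
      lift (g * h) x ≫ a = lift g (lift h x ≫ a) ≫ a) : ModObj G X where
  smul := a
  one_smul := by
    show MonObj.one (X := G) ▷ X ≫ a = (λ_ X).hom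
    have h3 : MonObj.one (X := G) ▷ X = (λ_ X).hom ≫ lift (1 : X ⟶ G) (𝟙 X) := by
      apply CartesianMonoidalCategory.hom_ext
      · rw [Hom.one_def]
        simp only [whiskerRight_fst, Category.assoc, lift_fst]
        rw [← Category.assoc]
        congr 1
        exact toUnit_unique _ _
      · simp [leftUnitor_hom]
    rw [h3, Category.assoc, h1, Category.comp_id]
  mul_smul := by
    show MonObj.mul (X := G) ▷ X ≫ a = (α_ G G X).hom ≫ G ◁ a ≫ a
    have h3 : MonObj.mul (X := G) ▷ X = lift ((fst (G ⊗ G) X ≫ fst G G) *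
        (fst (G ⊗ G) X ≫ snd G G)) (snd (G ⊗ G) X) := by
      apply CartesianMonoidalCategory.hom_ext
      · rw [Hom.mul_def]
        rw [whiskerRight_fst, lift_fst, ← comp_lift_assoc, lift_fst_snd, Category.id_comp]
      · simp
    rw [h3, h2, ← Category.assoc]
    congr 1
    apply CartesianMonoidalCategory.hom_ext
    · simp
    · simp only [lift_snd, Category.assoc, whiskerLeft_snd]
      rw [← Category.assoc]
      congr 1
      apply CartesianMonoidalCategory.hom_ext <;> simp

open MonObj in
/-- The action of `G × H` on `X × Y`. -/
@[reducible]
def actProd (G H X Y : SchC) [GrpObj G] [GrpObj H] [ModObj G X] [ModObj H Y] :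
    ModObj (G ⊗ H) (X ⊗ Y) :=
  modObjOfPoints (lift (lift (fst _ _ ≫ fst G H) (snd _ _ ≫ fst X Y) ≫ act G X)
      (lift (fst _ _ ≫ snd G H) (snd _ _ ≫ snd X Y) ≫ act H Y))
    (by
      have h1 : (1 : X ⊗ Y ⟶ G ⊗ H) ≫ fst G H = 1 := by
        simp [Hom.one_def, MonObj.tensorObj.one_def]
      have h2 : (1 : X ⊗ Y ⟶ G ⊗ H) ≫ snd G H = 1 := by
        simp [Hom.one_def, MonObj.tensorObj.one_def]
      apply CartesianMonoidalCategory.hom_ext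
      · simp only [Category.assoc, lift_fst, comp_lift_assoc, lift_fst_assoc, lift_snd_assoc,
          Category.id_comp]
        rw [lift_act, h1, one_smul]
      · simp only [Category.assoc, lift_snd, comp_lift_assoc, lift_fst_assoc, lift_snd_assoc,
          Category.id_comp]
        rw [lift_act, h2, one_smul])
    (fun Z g h x => by
      have h1 : (g * h) ≫ fst G H = (g ≫ fst G H) * (h ≫ fst G H) := MonObj.mul_comp _ _ _
      have h2 : (g * h) ≫ snd G H = (g ≫ snd G H) * (h ≫ snd G H) := MonObj.mul_comp _ _ _
      apply CartesianMonoidalCategory.hom_ext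
      · simp only [Category.assoc, lift_fst, comp_lift_assoc, lift_fst_assoc, lift_snd_assoc]
        simp only [h1, lift_act, mul_smul]
      · simp only [Category.assoc, lift_snd, comp_lift_assoc, lift_fst_assoc, lift_snd_assoc]
        simp only [h2, lift_act, mul_smul])

/-- The product `(⊔_i X_i / G_i) × (⊔_j Y_j / H_j) = ⊔_{i,j} (X_i × Y_j) / (G_i × H_j)`. -/
def GSpace.prod (X : GSpace Γ) (Y : GSpace Δ) : GSpace (Γ.prod Δ) where
  X k := X.X k.1 ⊗ Y.X k.2
  mod k := actProd (Γ.G k.1) (Δ.G k.2) (X.X k.1) (Y.X k.2)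

lemma GSpace.IsSmooth.prod {X : GSpace Γ} {Y : GSpace Δ} (hX : X.IsSmooth) (hY : Y.IsSmooth) :
    (X.prod Y).IsSmooth := fun k => (hX k.1).prod (hY k.2)

section ActProd

variable (G H X Y : SchC)

/-- The projection `(G × H) × (X × Y) ⟶ (G × X) × (H × Y)`. -/
abbrev mid : (G ⊗ H) ⊗ (X ⊗ Y) ⟶ (G ⊗ X) ⊗ (H ⊗ Y) :=
  lift (lift (fst _ _ ≫ fst G H) (snd _ _ ≫ fst X Y))
    (lift (fst _ _ ≫ snd G H) (snd _ _ ≫ snd X Y))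

attribute [local instance] actProd

lemma act_prod [GrpObj G] [GrpObj H] [ModObj G X] [ModObj H Y] :
    act (G ⊗ H) (X ⊗ Y) = mid G H X Y ≫ (act G X ⊗ₘ act H Y) := by
  show lift _ _ = _
  apply CartesianMonoidalCategory.hom_ext <;> simp

lemma snd_prod : snd (G ⊗ H) (X ⊗ Y) = mid G H X Y ≫ (snd G X ⊗ₘ snd H Y) := by
  apply CartesianMonoidalCategory.hom_ext <;> simp

end ActProd

/-- The exterior product of `R^st`. -/
def RSt.box {X : GSpace Γ} {Y : GSpace Δ} (a : RSt R X) (b : RSt R Y) : RSt R (X.prod Y) :=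
  fun k => ⟨R.box (a k.1 : R.obj (X.X k.1)) (b k.2 : R.obj (Y.X k.2)), by
    let := actProd (Γ.G k.1) (Δ.G k.2) (X.X k.1) (Y.X k.2)
    have ha : R.pull (act (Γ.G k.1) (X.X k.1)) (a k.1 : R.obj (X.X k.1)) =
      R.pull (snd _ _) (a k.1) := (a k.1).2
    have hb : R.pull (act (Δ.G k.2) (Y.X k.2)) (b k.2 : R.obj (Y.X k.2)) =
      R.pull (snd _ _) (b k.2) := (b k.2).2
    show R.pull (act (Γ.G k.1 ⊗ Δ.G k.2) (X.X k.1 ⊗ Y.X k.2)) _ = R.pull (snd _ _) _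
    rw [act_prod, snd_prod, R.pull_comp, R.pull_comp, R.pull_box, R.pull_box, ha, hb]⟩

/-- `f ⊠ g = f(x) + g(y)` on the product of two stacks. -/
def InvFn.box {X : GSpace Γ} {Y : GSpace Δ} (f : InvFn X) (g : InvFn Y) : InvFn (X.prod Y) where
  f k := Fn.box (f.f k.1) (g.f k.2)
  invariant k := by
    let := actProd (Γ.G k.1) (Δ.G k.2) (X.X k.1) (Y.X k.2)
    have hf := f.invariant k.1
    have hg := g.invariant k.2
    show Fn.comp (act (Γ.G k.1 ⊗ Δ.G k.2) (X.X k.1 ⊗ Y.X k.2)) (Fn.box _ _) =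
      Fn.comp (snd (Γ.G k.1 ⊗ Δ.G k.2) (X.X k.1 ⊗ Y.X k.2)) (Fn.box _ _)
    rw [act_prod, snd_prod]
    simp only [Fn.box, map_add, Fn.comp_comp, Category.assoc, tensorHom_fst, tensorHom_snd,
      lift_fst_assoc, lift_snd_assoc]
    rw [← Fn.comp_comp, ← Fn.comp_comp, hf, hg, Fn.comp_comp, Fn.comp_comp]

/-! ### Schemes as stacks -/

/-- The family that consists of one trivial group. -/
def trivialFamily : GroupFamily where
  I := PUnit
  G _ := 𝟙_ SchC

lemma trivial_isLinearAlgebraic : IsLinearAlgebraic (𝟙_ SchC) where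
  affine := by
    show IsAffine (Spec _)
    infer_instance
  smooth := isSmooth_unit
  closed_embedding := by
    refine ⟨0, 1, ?_, ?_⟩
    · simp
    · rw [eq_top_iff]
      intro a _
      refine Subring.subset_closure (Or.inl (Or.inl ⟨a, ?_⟩))
      rw [show toUnit (𝟙_ SchC) = 𝟙 _ from toUnit_unique _ _]
      show (Scheme.Hom.appTop (𝟙 _)).hom a = a
      simp

lemma act_trivial (X : SchC) : act (𝟙_ SchC) X = snd (𝟙_ SchC) X := leftUnitor_hom X

lemma trivial_isSpecial : IsSpecial (𝟙_ SchC) := by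
  intro P S m τ h s
  have hm : act (𝟙_ SchC) P = snd (𝟙_ SchC) P := by
    have h1 : MonObj.one (X := 𝟙_ SchC) ▷ P ≫ act (𝟙_ SchC) P = (λ_ P).hom :=
      ModObj.one_smul (M := 𝟙_ SchC) P
    have h2 : MonObj.one (X := 𝟙_ SchC) = 𝟙 _ := toUnit_unique _ _
    rw [h2, id_whiskerRight, Category.id_comp] at h1
    rw [h1, leftUnitor_hom]
  have hp := isPullback_sch h.isPullback
  rw [hm] at hp
  have hmono : Mono (sch τ) := ⟨fun a b hab => by
    rw [← hp.lift_fst a b hab, hp.lift_snd a b hab]⟩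
  have hs := h.smooth
  have ho : IsOpenImmersion (sch τ) := IsOpenImmersion.of_flat_of_mono _
  exact ⟨P, τ, 𝟙 P, ho, h.surjective.surj s, Category.id_comp _⟩

lemma trivialFamily_admissible : trivialFamily.Admissible where
  linear _ := trivial_isLinearAlgebraic
  special _ := trivial_isSpecial

/-- The scheme `X`, as the quotient stack `X / 1`. -/
def GSpace.ofScheme (X : SchC) : GSpace trivialFamily where
  X _ := X
  mod _ := inferInstanceAs (ModObj (𝟙_ SchC) X)

/-- A regular function on a scheme `X`, as a function on the stack `X / 1`. -/
def InvFn.ofScheme {X : SchC} (f : Fn X) : InvFn (GSpace.ofScheme X) where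
  f _ := f
  invariant _ := by
    show Fn.comp (act (𝟙_ SchC) X) f = Fn.comp (snd (𝟙_ SchC) X) f
    rw [act_trivial]

/-! ### Stacky vanishing cycles -/

/-- A family of elements `φ_f ∈ R^st(⊔_i X_i / G_i)`, for the regular functions `f` on smooth
disjoint unions `⊔_i X_i / G_i` of quotient stacks with special linear algebraic groups. -/
abbrev SVCFamily :=
  ∀ (Γ : GroupFamily), Γ.Admissible → ∀ X : GSpace Γ, X.IsSmooth → InvFn X → RSt R X

/-- The restriction of a family `φ` to functions on smooth schemes. -/
def restrictToSchemes (φ : SVCFamily R) : VCFamily R := fun X hX f =>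
  (φ trivialFamily trivialFamily_admissible (GSpace.ofScheme X) (fun _ => hX)
    (InvFn.ofScheme f) PUnit.unit).1

/-- `φ` is a stacky vanishing cycle with values in `R^st`. In the blow-up formula, the closed
substack `⊔_i Y_i / G_i` of `⊔_i X_i / G_i`, the blow-up `⊔_i B_i / G_i` and the exceptional
divisor `⊔_i E_i / G_i` are given by equivariant closed subschemes `Y_i` of the `X_i`, their
blow-ups `B_i` and exceptional divisors `E_i`. -/
structure IsStackyVanishingCycle (φ : SVCFamily R) : Prop where
  smooth_pull : ∀ {Γ Δ : GroupFamily} (hΓ : Γ.Admissible) (hΔ : Δ.Admissible)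
    {X : GSpace Γ} {Y : GSpace Δ} (hX : X.IsSmooth) (hY : Y.IsSmooth)
    (u : BasedFunctor Y.stack X.stack), IsSmoothMor u → ∀ (f : InvFn X) (g : InvFn Y),
    IsCompSt u g f → IsPullbackSt R u (φ Δ hΔ Y hY g) (φ Γ hΓ X hX f)
  blowUp : ∀ {Γ : GroupFamily} (hΓ : Γ.Admissible) {Y X B E : GSpace Γ} (i : Y.Hom X)
    (π : B.Hom X) (j : E.Hom B) (e : E.Hom Y)
    (h : ∀ k, IsBlowUp (i.f k) (π.f k) (j.f k) (e.f k)) (hX : X.IsSmooth) (hY : Y.IsSmooth)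
    (hB : B.IsSmooth) (hE : E.IsSmooth) (f : InvFn X),
    RSt.push R π (fun k => (h k).finiteType) (φ Γ hΓ B hB (InvFn.comp π f) -
        RSt.push R j (fun k => .of_isClosedImmersion (h k).cartier.1)
          (φ Γ hΓ E hE (InvFn.comp j (InvFn.comp π f)))) =
      φ Γ hΓ X hX f - RSt.push R i (fun k => .of_isClosedImmersion (h k).closed)
        (φ Γ hΓ Y hY (InvFn.comp i f))
  box : ∀ {Γ Δ : GroupFamily} (hΓ : Γ.Admissible) (hΔ : Δ.Admissible)
    (hΓΔ : (Γ.prod Δ).Admissible) {X : GSpace Γ} {Y : GSpace Δ} (hX : X.IsSmooth)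
    (hY : Y.IsSmooth) (f : InvFn X) (g : InvFn Y),
    φ (Γ.prod Δ) hΓΔ (X.prod Y) (hX.prod hY) (InvFn.box f g) =
      RSt.box R (φ Γ hΓ X hX f) (φ Δ hΔ Y hY g)
  unit : restrictToSchemes R φ (𝟙_ SchC) isSmooth_unit 0 = R.one

/-- The class `[G]_R` of a linear algebraic group. -/
def MotivicTheory.groupClass {G : SchC} [GrpObj G] (hG : IsLinearAlgebraic G) :
    R.obj (𝟙_ SchC) :=
  have := hG.affine
  R.cls G (FT.of_isAffine G)

/-- The push-forward `ρ_!` along `ρ : X ⟶ X / G`, as a map `R(X) ⟶ R(X)`: the composition of the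
pull-back and the push-forward along the two maps `X ⟵ G × X = X ×_{X/G} X ⟶ X`. -/
def MotivicTheory.pushQuotient {G X : SchC} [GrpObj G] [ModObj G X] (hG : IsLinearAlgebraic G)
    (a : R.obj X) : R.obj X :=
  R.push (act G X) (FT.act G X hG) (R.pull (snd G X) a)

end MotivicVC

end

open CategoryTheory AlgebraicGeometry MonoidalCategory CartesianMonoidalCategory Limits
open scoped MonObj

noncomputable section

/-! The bijection is formal. The quotient map `X_i ⟶ X_i / G_i` is a smooth morphism of stacks, and
`X_i ×_{X_i/G_i} X_i = G_i × X_i` has the section `x ↦ (1, x)`. Pulling the smooth pull-back axiom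
back along this section shows that the `i`-th component of a stacky vanishing cycle at `𝔣` equals
its restriction to schemes at `f_i` (`IsStackyVanishingCycle.apply_eq`). So restriction is
injective. Conversely, given a vanishing cycle `ψ`, the element `ψ_{f_i}` is invariant, since action
and projection `G_i × X_i ⟶ X_i` are smooth and `f_i` has the same pull-back along both. The family
`(ψ_{f_i})_i` is a stacky vanishing cycle because the axioms can be checked on smooth atlases
(`IsVanishingCycle.isStackyVanishingCycle`).

The formula follows from two facts. For an invariant element `b` the projection formula gives `ρ_! b
= [G] b`, because the action is the projection up to the automorphism `shear`
(`pushQuotient_of_mem_invariants`). And `[G]` is a unit for special `G` (`isUnit_groupClass`), which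
is the substantial part.

To invert `[G]`, embed `G` in `GL_n`. Some finite dimensional space of functions on `GL_n`, stable
under left translation by `G`, generates the ideal of `G`; this gives a representation `G ⟶ GL_d`
and an equivariant map `c` from `GL_n` to matrices with `d` rows that has a right inverse
(`exists_linearization`). Then `G` acts freely on `GL_n × GL_d`, and `(h, t) ↦ t⁻¹ c(h)` is a map to
an affine space whose fibres are the orbits. Thus `GL_n × GL_d` is a torsor, possibly with empty
fibres, over an affine base, and the homogeneous space `GL_n / G` is never formed.

For special `G`, the class of such a torsor over an affine base is a multiple of `[G]`
(`torsorDvd`). This is a noetherian induction: over an integral base the torsor is empty or trivial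
over some nonempty open subset, by descent of smoothness to the generic fibre. Hence `[G]` divides
`[GL_n] [GL_d]`. Finally `[GL_n]` is computed by Gaussian elimination as a product of powers of `𝕃`
and factors `𝕃^k - 1` (`gl_succ`), so it is a unit, and so is its divisor `[G]`. -/

namespace MotivicVC

universe w

/-! ### Group actions and torsors on generalized points. -/

section Points

variable {G X Y : SchC} [GrpObj G] [ModObj G X] [ModObj G Y]

lemma act_eq_smul : act G X = fst G X • snd G X := by simp [Hom.smul_def]

lemma isModHom_of_points (f : X ⟶ Y)
    (h : ∀ (Z : SchC) (g : Z ⟶ G) (x : Z ⟶ X), (g • x) ≫ f = g • (x ≫ f)) : IsModHom G f where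
  smul_hom := by
    have h1 := h _ (fst G X) (snd G X)
    rw [← act_eq_smul, Hom.smul_def] at h1
    refine h1.trans ?_
    congr 1

/-- Transitivity on the fibres of `τ` provides the lift and freeness its uniqueness. Nothing is
required about surjectivity of `τ`, so fibres may be empty. -/
lemma isPullback_of_points {P S : SchC} [ModObj G P] (τ : P ⟶ S)
    (hinv : act G P ≫ τ = snd G P ≫ τ)
    (h : ∀ (Z : SchC) (a b : Z ⟶ P), a ≫ τ = b ≫ τ → ∃ g : Z ⟶ G, g • b = a)
    (hu : ∀ (Z : SchC) (g g' : Z ⟶ G) (b : Z ⟶ P), g • b = g' • b → g = g') :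
    IsPullback (act G P) (snd G P) τ τ := by
  choose l hl using h
  refine ⟨⟨hinv⟩, ⟨PullbackCone.IsLimit.mk hinv (fun s => lift (l _ _ _ s.condition) s.snd)
    (fun s => ?_) (fun s => ?_) (fun s m h1 h2 => ?_)⟩⟩
  · rw [lift_act, hl]
  · simp
  · apply CartesianMonoidalCategory.hom_ext
    · rw [lift_fst]
      apply hu _ _ _ s.snd
      rw [hl, ← h1, ← h2, act_eq_smul, ModObj.comp_smul]
    · simpa using h2

lemma exists_smul_of_isPullback {P S : SchC} [ModObj G P] {τ : P ⟶ S}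
    (h : IsPullback (act G P) (snd G P) τ τ) {Z : SchC} (a b : Z ⟶ P) (hab : a ≫ τ = b ≫ τ) :
    ∃ g : Z ⟶ G, g • b = a := by
  refine ⟨h.lift a b hab ≫ fst G P, ?_⟩
  have h1 := h.lift_fst a b hab
  have h2 := h.lift_snd a b hab
  have h3 : h.lift a b hab ≫ act G P =
      (h.lift a b hab ≫ fst G P) • (h.lift a b hab ≫ snd G P) := by
    rw [← ModObj.comp_smul, ← act_eq_smul]
  exact (congrArg _ h2.symm).trans (h3.symm.trans h1)

lemma smul_injective_of_isPullback {P S : SchC} [ModObj G P] {τ : P ⟶ S}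
    (h : IsPullback (act G P) (snd G P) τ τ) {Z : SchC} (g g' : Z ⟶ G) (b : Z ⟶ P)
    (hg : g • b = g' • b) : g = g' := by
  have : lift g b = lift g' b := by
    apply h.hom_ext
    · rw [lift_act, lift_act, hg]
    · simp
  simpa using congrArg (· ≫ fst G P) this

lemma smul_comp_of_invariant {P S : SchC} [ModObj G P] {τ : P ⟶ S}
    (h : act G P ≫ τ = snd G P ≫ τ) {Z : SchC} (g : Z ⟶ G) (b : Z ⟶ P) :
    (g • b) ≫ τ = b ≫ τ := by
  rw [Hom.smul_def, Category.assoc, h, lift_snd_assoc]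

/-- The action of `G` on `G × Q` by left multiplication on the first factor. -/
@[reducible]
def leftMulAction (G Q : SchC) [GrpObj G] : ModObj G (G ⊗ Q) :=
  modObjOfPoints (lift (fst G (G ⊗ Q) * (snd G (G ⊗ Q) ≫ fst G Q)) (snd G (G ⊗ Q) ≫ snd G Q))
    (by
      apply CartesianMonoidalCategory.hom_ext
      · rw [Category.assoc, lift_fst, MonObj.comp_mul, lift_fst, lift_snd_assoc, one_mul]
      · simp)
    (fun Z g h x => by
      apply CartesianMonoidalCategory.hom_ext
      · simp only [Category.assoc, lift_fst, MonObj.comp_mul, lift_snd_assoc, mul_assoc]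
      · simp)

section

attribute [local instance] leftMulAction

lemma leftMulAction_smul (G Q : SchC) [GrpObj G] {Z : SchC} (g : Z ⟶ G) (x : Z ⟶ G ⊗ Q) :
    g • x = lift (g * (x ≫ fst G Q)) (x ≫ snd G Q) := by
  rw [Hom.smul_def]
  show lift g x ≫ lift _ _ = _
  apply CartesianMonoidalCategory.hom_ext
  · rw [Category.assoc, lift_fst, MonObj.comp_mul, lift_fst, lift_snd_assoc, lift_fst]
  · simp

lemma leftMulAction_isPullback (G Q : SchC) [GrpObj G] :
    IsPullback (act G (G ⊗ Q)) (snd G (G ⊗ Q)) (snd G Q) (snd G Q) := by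
  apply isPullback_of_points
  · rw [act_eq_smul, leftMulAction_smul]; simp
  · intro Z a b hab
    refine ⟨(a ≫ fst G Q) * (b ≫ fst G Q)⁻¹, ?_⟩
    rw [leftMulAction_smul]
    apply CartesianMonoidalCategory.hom_ext
    · simp
    · simp [hab]
  · intro Z g g' b h
    rw [leftMulAction_smul, leftMulAction_smul] at h
    simpa using congrArg (· ≫ fst G Q) h

/-- The map is `(g, q) ↦ g · n(q)`, the extension of `n` to the trivial bundle on `Q`. It describes
the composition of `n` with the quotient map `X ⟶ X / G`. -/
lemma leftMulAction_isModHom {Q : SchC} (n : Q ⟶ X) : IsModHom G (G ◁ n ≫ act G X) := by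
  apply isModHom_of_points
  intro Z g x
  rw [leftMulAction_smul]
  have h (u : Z ⟶ G) (q : Z ⟶ Q) : lift u q ≫ G ◁ n ≫ act G X = u • (q ≫ n) := by
    rw [Hom.smul_def, ← Category.assoc]; congr 1
    apply CartesianMonoidalCategory.hom_ext <;> simp
  have hx : x = lift (x ≫ fst G Q) (x ≫ snd G Q) := by
    apply CartesianMonoidalCategory.hom_ext <;> simp
  conv_rhs => rw [hx]
  rw [h, h, mul_smul]

lemma leftMulAction_whiskerLeft {Q Q' : SchC} (q : Q ⟶ Q') : IsModHom G (G ◁ q) := by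
  apply isModHom_of_points
  intro Z g x
  rw [leftMulAction_smul, leftMulAction_smul]
  apply CartesianMonoidalCategory.hom_ext <;> simp

end

end Points

/-! ### Smoothness of actions and projections. -/

section Smoothness

lemma SchC.IsSmooth.of_hom {X Y : SchC} (hX : X.IsSmooth) (u : Y ⟶ X)
    (hu : Smooth (MotivicVC.sch u)) : Y.IsSmooth := by
  have h : Smooth X.obj.hom := hX
  show Smooth Y.obj.hom
  rw [← Over.w u.hom]
  infer_instance

lemma smooth_snd (G X : SchC) (hG : G.IsSmooth) : Smooth (sch (snd G X)) := by
  have : Smooth G.obj.hom := hG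
  show Smooth (pullback.snd G.obj.hom X.obj.hom)
  infer_instance

lemma sch_comp {X Y Z : SchC} (u : X ⟶ Y) (v : Y ⟶ Z) : sch (u ≫ v) = sch u ≫ sch v := rfl

instance {X Y : SchC} (u : X ⟶ Y) [IsIso u] : IsIso (sch u) :=
  ((lft.ι ⋙ Over.forget _).mapIso (asIso u)).isIso_hom

lemma smooth_act (G X : SchC) [GrpObj G] [ModObj G X] (hG : G.IsSmooth) :
    Smooth (sch (act G X)) := by
  have h := smooth_snd G X hG
  rw [← shear_snd, sch_comp]
  infer_instance

lemma smooth_comp {X Y Z : SchC} {u : X ⟶ Y} {v : Y ⟶ Z} (hu : Smooth (sch u))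
    (hv : Smooth (sch v)) : Smooth (sch (u ≫ v)) := by
  rw [sch_comp]; infer_instance

end Smoothness

/-! ### From vanishing cycles on schemes to stacky ones. -/

section Converse

variable {R : MotivicTheory.{w}}

/-- The stacky vanishing cycle given by a vanishing cycle. -/
def IsVanishingCycle.stacky {ψ : VCFamily R} (hψ : IsVanishingCycle R ψ) : SVCFamily R :=
  fun Γ hΓ X hX f i => ⟨ψ (X.X i) (hX i) (f.f i), by
    have hG := (hΓ.linear i).smooth
    -- Both pull-backs are values of `ψ` on `G × X`, and the two functions there agree because `f`
    -- is invariant.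
    show R.pull (act (Γ.G i) (X.X i)) _ = R.pull (snd (Γ.G i) (X.X i)) _
    rw [← hψ.smooth_pull (hX i) (hG.prod (hX i)) _ (smooth_act _ _ hG),
      ← hψ.smooth_pull (hX i) (hG.prod (hX i)) _ (smooth_snd _ _ hG), f.invariant]⟩

/-- Only the pull-back axiom is not componentwise. There the fibre product `W` of the two bundles is
smooth over both atlases, so both pull-backs to `W` are values of `ψ` at one and the same function
on `W`. -/
lemma IsVanishingCycle.isStackyVanishingCycle {ψ : VCFamily R} (hψ : IsVanishingCycle R ψ) :
    IsStackyVanishingCycle R hψ.stacky where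
  smooth_pull {Γ Δ} hΓ hΔ X Y hX hY u hu f g hfg := by
    intro x hx i j W p q hW
    have h1 : Smooth (sch (x.τ i)) := x.smooth i
    have h2 : Smooth (sch ((mapChart u x).τ j)) := (mapChart u x).smooth j
    have h3 := isPullback_sch hW
    rw [sch_comp] at h3
    have hp : Smooth (sch p) :=
      MorphismProperty.of_isPullback (P := @Smooth) h3.flip inferInstance
    have hq : Smooth (sch q) := MorphismProperty.of_isPullback (P := @Smooth) h3 h1
    have hpm := smooth_comp hp (hx i)
    have hqm := smooth_comp hq (hu x hx j)
    have hW' : W.IsSmooth := (hY i).of_hom _ hpm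
    show R.pull _ (ψ _ _ _) = R.pull _ (ψ _ _ _)
    rw [← hψ.smooth_pull (hY i) hW' _ hpm, ← hψ.smooth_pull (hX j) hW' _ hqm,
      hfg x hx i j W p q hW]
  blowUp {Γ} hΓ Y X B E i π j e h hX hY hB hE f := by
    funext k
    apply Subtype.ext
    exact hψ.blowUp (h k) (hX k) (hY k) (hB k) (hE k) (f.f k)
  box hΓ hΔ hΓΔ X Y hX hY f g := by
    funext k
    apply Subtype.ext
    exact hψ.box (hX k.1) (hY k.2) (f.f k.1) (g.f k.2)
  unit := hψ.unit

end Converse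


/-! ### The quotient map as a morphism of stacks. -/

section StackMorphisms

variable {Γ : GroupFamily}

/-- The index of the trivial family. -/
def trivialFamily.pt : trivialFamily.I := PUnit.unit

/-- The morphism to a scheme `Y` that underlies a chart of `Y`. -/
def Chart.toScheme {Y : SchC} (x : Chart (GSpace.ofScheme Y)) : x.P trivialFamily.pt ⟶ Y :=
  x.m trivialFamily.pt

/-- The functor on charts given by a family of equivariant morphisms. -/
def GSpace.Hom.chartFunctor {X Y : GSpace Γ} (u : X.Hom Y) : Chart X ⥤ Chart Y where
  obj x :=
    { S := x.S
      P := x.P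
      mod := x.mod
      τ := x.τ
      m := fun i => x.m i ≫ u.f i
      equivariant := fun i => by
        have := x.equivariant i
        have := u.equivariant i
        infer_instance
      smooth := x.smooth
      isPullback := x.isPullback
      cover := x.cover }
  map {x y} a :=
    { f := a.f
      h := a.h
      equivariant := a.equivariant
      comp_m := fun i => by rw [← Category.assoc, a.comp_m]
      isPullback := a.isPullback }

/-- The morphism of quotient stacks given by a family of equivariant morphisms. -/
def GSpace.Hom.stackMor {X Y : GSpace Γ} (u : X.Hom Y) : BasedFunctor X.stack Y.stack where
  toFunctor := u.chartFunctor
  w := rfl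

/-- The open subscheme of `X` on an open subset. -/
def openSub (X : SchC) (U : X.sch.Opens) : SchC where
  obj := Over.mk (U.ι ≫ X.obj.hom)
  property := by
    have : LocallyOfFiniteType X.obj.hom := X.property
    show LocallyOfFiniteType (U.ι ≫ X.obj.hom)
    infer_instance

/-- The inclusion of an open subscheme. -/
def openSub.ι (X : SchC) (U : X.sch.Opens) : openSub X U ⟶ X := ⟨Over.homMk U.ι rfl⟩

instance openSub.isOpenImmersion (X : SchC) (U : X.sch.Opens) : IsOpenImmersion (sch (openSub.ι X U)) :=
  inferInstanceAs (IsOpenImmersion U.ι)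

lemma sch_faithful {X Y : SchC} {u v : X ⟶ Y} (h : sch u = sch v) : u = v :=
  ObjectProperty.hom_ext _ (Over.OverMorphism.ext h)

instance openSub.mono (X : SchC) (U : X.sch.Opens) : Mono (openSub.ι X U) where
  right_cancellation _ _ h := sch_faithful ((cancel_mono U.ι).1 (congrArg sch h))

/-- The subscheme of `X` that is all of `X` if `p` holds and empty otherwise. -/
def restrictIf (p : Prop) (X : SchC) : SchC := openSub X ⟨{_x | p}, isOpen_const⟩

/-- The inclusion of `restrictIf p X`. -/
def restrictIf.ι (p : Prop) (X : SchC) : restrictIf p X ⟶ X := openSub.ι X _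

instance (p : Prop) (X : SchC) : Mono (restrictIf.ι p X) := openSub.mono X _

instance restrictIf.isOpenImmersion (p : Prop) (X : SchC) : IsOpenImmersion (sch (restrictIf.ι p X)) :=
  openSub.isOpenImmersion X _

lemma range_restrictIf (p : Prop) (X : SchC) :
    Set.range (sch (restrictIf.ι p X)) = {_x | p} := by
  show Set.range (Scheme.Opens.ι _) = _
  rw [Scheme.Opens.range_ι]; rfl

lemma isEmpty_restrictIf {p : Prop} (hp : ¬ p) (X : SchC) : IsEmpty (restrictIf p X).sch where
  false x := by
    have : sch (restrictIf.ι p X) x ∈ {_x | p} := range_restrictIf p X ▸ ⟨x, rfl⟩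
    exact hp this

/-- Morphisms from an empty scheme. -/
def fromEmpty {X : SchC} (Y : SchC) (h : IsEmpty X.sch) : X ⟶ Y :=
  ⟨Over.homMk (isInitialOfIsEmpty.to _) (isInitialOfIsEmpty.hom_ext _ _)⟩

lemma fromEmpty_ext {X Y : SchC} (h : IsEmpty X.sch) (u v : X ⟶ Y) : u = v :=
  sch_faithful (isInitialOfIsEmpty.hom_ext _ _)

/-- The restriction of a morphism. -/
def restrictIf.map (p : Prop) {X Y : SchC} (u : X ⟶ Y) : restrictIf p X ⟶ restrictIf p Y :=
  ⟨Over.homMk (IsOpenImmersion.lift (sch (restrictIf.ι p Y)) (sch (restrictIf.ι p X ≫ u)) (by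
      rw [range_restrictIf]
      rintro _ ⟨x, rfl⟩
      have : sch (restrictIf.ι p X) x ∈ {_x | p} := range_restrictIf p X ▸ ⟨x, rfl⟩
      exact this)) (by
      show _ ≫ sch (restrictIf.ι p Y) ≫ Y.obj.hom = _
      rw [IsOpenImmersion.lift_fac_assoc]
      exact Over.w (restrictIf.ι p X ≫ u).hom)⟩

lemma restrictIf.map_ι (p : Prop) {X Y : SchC} (u : X ⟶ Y) :
    restrictIf.map p u ≫ restrictIf.ι p Y = restrictIf.ι p X ≫ u :=
  sch_faithful (IsOpenImmersion.lift_fac _ _ _)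

lemma restrictIf.map_id (p : Prop) (X : SchC) : restrictIf.map p (𝟙 X) = 𝟙 _ := by
  rw [← cancel_mono (restrictIf.ι _ _), restrictIf.map_ι]; simp

lemma restrictIf.map_comp (p : Prop) {X Y Z : SchC} (u : X ⟶ Y) (v : Y ⟶ Z) :
    restrictIf.map p (u ≫ v) = restrictIf.map p u ≫ restrictIf.map p v := by
  rw [← cancel_mono (restrictIf.ι _ _), restrictIf.map_ι, Category.assoc, restrictIf.map_ι]
  simp only [← Category.assoc, restrictIf.map_ι]

lemma restrictIf.isPullback (p : Prop) {X Y : SchC} (u : X ⟶ Y) :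
    IsPullback (restrictIf.map p u) (restrictIf.ι p X) (restrictIf.ι p Y) u := by
  have key (s : PullbackCone (restrictIf.ι p Y) u) :
      Set.range (sch s.snd) ⊆ Set.range (sch (restrictIf.ι p X)) := by
    rw [range_restrictIf]
    rintro _ ⟨x, rfl⟩
    have : sch (restrictIf.ι p Y) (sch s.fst x) ∈ {_x | p} := range_restrictIf p Y ▸ ⟨_, rfl⟩
    exact this
  refine ⟨⟨restrictIf.map_ι p u⟩, ⟨PullbackCone.IsLimit.mk (restrictIf.map_ι p u)
    (fun s => ⟨Over.homMk (IsOpenImmersion.lift (sch (restrictIf.ι p X)) (sch s.snd) (key s)) (by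
      show _ ≫ sch (restrictIf.ι p X) ≫ X.obj.hom = _
      rw [IsOpenImmersion.lift_fac_assoc]
      exact Over.w s.snd.hom)⟩) (fun s => ?_) (fun s => ?_) (fun s m h1 h2 => ?_)⟩⟩
  · rw [← cancel_mono (restrictIf.ι p Y), Category.assoc, restrictIf.map_ι, s.condition,
      ← Category.assoc]
    congr 1
    exact sch_faithful (IsOpenImmersion.lift_fac _ _ _)
  · exact sch_faithful (IsOpenImmersion.lift_fac _ _ _)
  · rw [← cancel_mono (restrictIf.ι p X), h2]
    exact sch_faithful (IsOpenImmersion.lift_fac _ _ _).symm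

/-- A morphism to `X i`, as a family of morphisms to all `X j`, defined where `i = j`. -/
def extendFamily {I : Type} (X : I → SchC) {i : I} {P : SchC} (m : P ⟶ X i) (j : I) :
    restrictIf (i = j) P ⟶ X j :=
  open scoped Classical in
  if h : i = j then restrictIf.ι _ P ≫ m ≫ eqToHom (congrArg X h)
  else fromEmpty _ (isEmpty_restrictIf h P)

lemma extendFamily_self {I : Type} (X : I → SchC) {i : I} {P : SchC} (m : P ⟶ X i) :
    extendFamily X m i = restrictIf.ι _ P ≫ m := by
  simp [extendFamily]

lemma map_extendFamily {I : Type} (X : I → SchC) {i : I} {P P' : SchC} (m : P ⟶ X i)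
    (u : P' ⟶ P) (j : I) :
    restrictIf.map (i = j) u ≫ extendFamily X m j = extendFamily X (u ≫ m) j := by
  by_cases h : i = j
  · subst h
    rw [extendFamily_self, extendFamily_self, ← Category.assoc, restrictIf.map_ι, Category.assoc]
  · exact fromEmpty_ext (isEmpty_restrictIf h _) _ _

/-- Two points with the same image differ by an element of the trivial group. -/
lemma mono_of_trivial {P S : SchC} (τ : P ⟶ S) [ModObj (𝟙_ SchC) P]
    (h : IsPullback (act (𝟙_ SchC) P) (snd (𝟙_ SchC) P) τ τ) : Mono τ where
  right_cancellation a b hab := by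
    obtain ⟨g, hg⟩ := exists_smul_of_isPullback h a b hab
    rw [← hg, toUnit_unique g 1, one_smul]

lemma snd_surjective (G X : SchC) [GrpObj G] : Surjective (sch (snd G X)) where
  surj x := by
    have h : lift (1 : X ⟶ G) (𝟙 X) ≫ snd G X = 𝟙 X := by simp
    refine ⟨sch (lift (1 : X ⟶ G) (𝟙 X)) x, ?_⟩
    have h2 := congrArg (fun u => sch u x) h
    exact h2

lemma smooth_of_isOpenImmersion {X Y : SchC} (u : X ⟶ Y) (h : IsOpenImmersion (sch u)) :
    Smooth (sch u) := inferInstance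

variable (X : GSpace Γ) (i : Γ.I)

-- The bundle is the trivial torsor over a subscheme of `x.P`, and that subscheme maps to the base
-- by a monomorphism, so the fibres of the composition are still single orbits.
attribute [local instance] leftMulAction in
lemma quotientChart_isPullback (x : Chart (GSpace.ofScheme (X.X i)))
    (j : Γ.I) :
    IsPullback (act (Γ.G j) (Γ.G j ⊗ restrictIf (i = j) (x.P trivialFamily.pt)))
      (snd (Γ.G j) (Γ.G j ⊗ restrictIf (i = j) (x.P trivialFamily.pt)))
      (snd (Γ.G j) _ ≫ restrictIf.ι (i = j) _ ≫ x.τ trivialFamily.pt)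
      (snd (Γ.G j) _ ≫ restrictIf.ι (i = j) _ ≫ x.τ trivialFamily.pt) := by
  have h := leftMulAction_isPullback (Γ.G j) (restrictIf (i = j) (x.P trivialFamily.pt))
  have hm : Mono (x.τ trivialFamily.pt) := @mono_of_trivial _ _ _ (x.mod _) (x.isPullback trivialFamily.pt)
  apply isPullback_of_points
  · rw [← Category.assoc, h.w, Category.assoc]
  · intro Z a b hab
    refine exists_smul_of_isPullback h a b ?_
    rw [← cancel_mono (restrictIf.ι (i = j) _ ≫ x.τ trivialFamily.pt)]
    simpa using hab
  · intro Z g g' b hg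
    exact smul_injective_of_isPullback h g g' b hg

attribute [local instance] leftMulAction in
/-- The chart of `⊔_j X_j / G_j` given by a morphism to `X_i`. -/
def quotientChart (hΓ : Γ.Admissible) (x : Chart (GSpace.ofScheme (X.X i))) : Chart X where
  S := x.S
  -- An object of the disjoint union carries a bundle for every index: here it is the trivial bundle
  -- for `j = i` and empty for the other `j`.
  P j := Γ.G j ⊗ restrictIf (i = j) (x.P trivialFamily.pt)
  mod j := leftMulAction (Γ.G j) _
  τ j := snd (Γ.G j) _ ≫ restrictIf.ι (i = j) _ ≫ x.τ trivialFamily.pt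
  m j := Γ.G j ◁ extendFamily X.X x.toScheme j ≫ act (Γ.G j) (X.X j)
  equivariant j := leftMulAction_isModHom _
  smooth j := smooth_comp (smooth_snd _ _ (hΓ.linear j).smooth)
    (smooth_comp (smooth_of_isOpenImmersion _ inferInstance) (x.smooth trivialFamily.pt))
  isPullback j := quotientChart_isPullback X i x j
  cover s := by
    obtain ⟨⟨⟩, ⟨p, hp⟩, -⟩ := x.cover s
    refine ⟨i, ?_, ?_⟩
    · obtain ⟨q, hq⟩ : p ∈ Set.range (sch (restrictIf.ι (i = i) (x.P trivialFamily.pt))) := by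
        rw [range_restrictIf]; exact rfl
      obtain ⟨r, hr⟩ := (snd_surjective (Γ.G i) (restrictIf (i = i) (x.P trivialFamily.pt))).surj q
      refine ⟨r, ?_⟩
      rw [sch_comp, sch_comp, Scheme.Hom.comp_apply, Scheme.Hom.comp_apply, hr, hq]
      exact hp
    · rintro j ⟨r, -⟩
      by_contra hij
      exact (isEmpty_restrictIf (fun h => hij h.symm) _).false (sch (snd (Γ.G j) _) r)

attribute [local instance] leftMulAction in
/-- The functor on charts given by the quotient map `X_i ⟶ X_i / G_i`. -/
def quotientFunctor (hΓ : Γ.Admissible) : Chart (GSpace.ofScheme (X.X i)) ⥤ Chart X where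
  obj := quotientChart X i hΓ
  map {x y} a :=
    { f := a.f
      h := fun j => Γ.G j ◁ restrictIf.map (i = j) (a.h trivialFamily.pt)
      equivariant := fun j => leftMulAction_whiskerLeft _
      comp_m := fun j => by
        have h : restrictIf.map (i = j) (a.h trivialFamily.pt) ≫ extendFamily X.X y.toScheme j =
            extendFamily X.X x.toScheme j :=
          (map_extendFamily X.X y.toScheme _ j).trans
            (congrArg (extendFamily X.X · j) (a.comp_m trivialFamily.pt))
        exact (whiskerLeft_comp_assoc ..).symm.trans (congrArg (Γ.G j ◁ · ≫ act _ _) h)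
      isPullback := fun j =>
        (isPullback_snd (Γ.G j) _).flip.paste_vert
          ((restrictIf.isPullback (i = j) _).paste_vert (a.isPullback trivialFamily.pt)) }
  map_id x := Chart.Hom.ext rfl (funext fun j =>
    (congrArg (Γ.G j ◁ ·) (restrictIf.map_id _ _)).trans (MonoidalCategory.whiskerLeft_id _ _))
  map_comp {x y z} a b := Chart.Hom.ext rfl (funext fun j =>
    (congrArg (Γ.G j ◁ ·) (restrictIf.map_comp _ _ _)).trans
      (MonoidalCategory.whiskerLeft_comp _ _ _))

/-- The quotient map `X_i ⟶ X_i / G_i ⊂ ⊔_j X_j / G_j`. -/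
def quotientMor (hΓ : Γ.Admissible) :
    BasedFunctor (GSpace.ofScheme (X.X i)).stack X.stack where
  toFunctor := quotientFunctor X i hΓ
  w := rfl

end StackMorphisms

/-! ### Smoothness of the quotient map, and the tautological chart. -/

section Restriction

lemma isIso_of_sch {X Y : SchC} (u : X ⟶ Y) [h : IsIso (sch u)] : IsIso u := by
  have : IsIso ((lft.ι ⋙ Over.forget _).map u) := h
  exact isIso_of_reflects_iso u (lft.ι ⋙ Over.forget _)

variable {Γ : GroupFamily} (X : GSpace Γ) (i : Γ.I)

/-- For a smooth `x : P ⟶ X_i` the new chart map `(g, p) ↦ g · x(p)` is a base change of `x`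
followed by the smooth action. For the other indices the source is empty. -/
lemma isSmoothMor_quotientMor (hΓ : Γ.Admissible) : IsSmoothMor (quotientMor X i hΓ) := by
  intro x hx j
  have h1 : Smooth (sch x.toScheme) := hx trivialFamily.pt
  have h2 : Smooth (sch (Γ.G j ◁ extendFamily X.X x.toScheme j)) := by
    have h3 : Smooth (sch (extendFamily X.X x.toScheme j)) := by
      by_cases h : i = j
      · subst h
        rw [extendFamily_self]
        exact smooth_comp (smooth_of_isOpenImmersion _ inferInstance) h1
      · have := isEmpty_restrictIf h (x.P trivialFamily.pt)
        exact smooth_of_isOpenImmersion _ inferInstance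
    exact MorphismProperty.of_isPullback (P := @Smooth)
      (isPullback_sch (isPullback_snd (Γ.G j) (extendFamily X.X x.toScheme j))) h3
  exact smooth_comp h2 (smooth_act _ _ (hΓ.linear j).smooth)

/-- The tautological chart of a scheme. -/
def selfChart (Y : SchC) : Chart (GSpace.ofScheme Y) where
  S := Y
  P _ := Y
  mod _ := inferInstanceAs (ModObj (𝟙_ SchC) Y)
  τ _ := 𝟙 Y
  m _ := 𝟙 Y
  equivariant _ := inferInstanceAs (IsModHom (𝟙_ SchC) (𝟙 Y))
  smooth _ := inferInstanceAs (Smooth (𝟙 Y.sch))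
  isPullback _ := by
    show IsPullback (act (𝟙_ SchC) Y) (snd (𝟙_ SchC) Y) (𝟙 Y) (𝟙 Y)
    apply isPullback_of_points
    · rw [act_trivial]
    · intro Z a b hab
      refine ⟨1, ?_⟩
      rw [one_smul]
      simpa using hab.symm
    · intro Z g g' b _
      exact toUnit_unique _ _
  cover y := ⟨PUnit.unit, ⟨y, rfl⟩, fun _ _ => rfl⟩

lemma selfChart_isSmooth (Y : SchC) : (selfChart Y).IsSmooth :=
  fun _ => inferInstanceAs (Smooth (𝟙 Y.sch))

/-- The point `(1, y)` of `G × Y`, in the pull-back of the tautological chart to a chart of the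
quotient stack. -/
lemma exists_point_quotientChart (hΓ : Γ.Admissible) :
    ∃ (W : SchC) (p : W ⟶ (selfChart (X.X i)).P trivialFamily.pt)
      (q : W ⟶ (quotientChart X i hΓ (selfChart (X.X i))).P i)
      (s : X.X i ⟶ W), IsPullback p q ((selfChart (X.X i)).τ trivialFamily.pt)
        ((quotientChart X i hΓ (selfChart (X.X i))).τ i) ∧
      s ≫ p = 𝟙 (X.X i) ∧ s ≫ q ≫ (quotientChart X i hΓ (selfChart (X.X i))).m i = 𝟙 (X.X i) := by
  let Q := restrictIf (i = i) (X.X i)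
  let k : Q ⟶ X.X i := restrictIf.ι (i = i) (X.X i)
  have hk : IsIso k := by
    have h1 : IsIso (sch k) := by
      have : Surjective (sch k) := ⟨fun x => by
        have : x ∈ Set.range (sch k) := by rw [range_restrictIf]; exact rfl
        exact this⟩
      have : IsOpenImmersion (sch k) := restrictIf.isOpenImmersion _ _
      exact (isIso_iff_isOpenImmersion_and_surjective _).2 ⟨this, ‹_›⟩
    exact isIso_of_sch k
  -- The bundle map of the tautological chart is an identity, so the fibre product is the bundle `G
  -- × Q` itself.
  refine ⟨Γ.G i ⊗ Q, snd _ _ ≫ k, 𝟙 _, lift 1 (inv k), ?_, ?_, ?_⟩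
  · refine @IsPullback.of_vert_isIso _ _ _ _ _ _ _ _ _ _ (IsIso.id _) (IsIso.id _) ⟨?_⟩
    show (snd _ _ ≫ k) ≫ 𝟙 _ = 𝟙 _ ≫ snd _ _ ≫ k ≫ 𝟙 _
    simp
  · show lift 1 (inv k) ≫ snd _ _ ≫ k = _
    simp
  · show lift 1 (inv k) ≫ 𝟙 _ ≫ Γ.G i ◁ extendFamily X.X (𝟙 (X.X i)) i ≫ act _ _ = _
    rw [extendFamily_self, Category.id_comp, ← Category.assoc, lift_whiskerLeft, Category.comp_id,
      lift_act, one_smul]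
    exact IsIso.inv_hom_id k

end Restriction

/-! ### Restriction to schemes is a bijection. -/

section Comparison

variable {R : MotivicTheory.{w}}

lemma subsingleton_fn_of_isEmpty {W : SchC} (h : IsEmpty W.sch) : Subsingleton (Fn W) :=
  inferInstanceAs (Subsingleton Γ(W.sch, ⊤))

lemma Chart.mono_τ {Y : SchC} (x : Chart (GSpace.ofScheme Y)) : Mono (x.τ trivialFamily.pt) :=
  @mono_of_trivial _ _ _ (x.mod _) (x.isPullback trivialFamily.pt)

/-- For `j = i` this is `f(g x) = f(x)`. For `j ≠ i` the fibre product is empty and carries only one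
function. -/
lemma isCompSt_quotientMor {Γ : GroupFamily} (X : GSpace Γ) (i : Γ.I) (hΓ : Γ.Admissible)
    (f : InvFn X) : IsCompSt (quotientMor X i hΓ) (InvFn.ofScheme (f.f i)) f := by
  intro x _ k j W p q hW
  let q' : W ⟶ Γ.G j ⊗ restrictIf (i = j) (x.P trivialFamily.pt) := q
  let p' : W ⟶ x.P trivialFamily.pt := p
  have hw : p' ≫ x.τ trivialFamily.pt =
      q' ≫ (snd (Γ.G j) _ ≫ restrictIf.ι (i = j) _ ≫ x.τ trivialFamily.pt) ≫ 𝟙 x.S := hW.w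
  show Fn.comp (p' ≫ x.toScheme) (f.f i) =
    Fn.comp (q' ≫ Γ.G j ◁ extendFamily X.X x.toScheme j ≫ act (Γ.G j) (X.X j)) (f.f j)
  by_cases h : i = j
  · subst h
    have hm := x.mono_τ
    have hp : p' = q' ≫ snd (Γ.G i) _ ≫ restrictIf.ι (i = i) _ := by
      rw [← cancel_mono (x.τ trivialFamily.pt), hw]
      simp
    have h1 : Fn.comp ((q' ≫ Γ.G i ◁ extendFamily X.X x.toScheme i) ≫ act (Γ.G i) (X.X i)) (f.f i) =
        Fn.comp ((q' ≫ Γ.G i ◁ extendFamily X.X x.toScheme i) ≫ snd (Γ.G i) (X.X i)) (f.f i) := by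
      rw [← Fn.comp_comp, f.invariant, Fn.comp_comp]
    rw [← Category.assoc q', h1, extendFamily_self, hp]
    simp only [Category.assoc, whiskerLeft_snd]
  · have h1 := isEmpty_restrictIf h (x.P trivialFamily.pt)
    have h2 : IsEmpty W.sch :=
      ⟨fun w => h1.false (sch (q' ≫ snd (Γ.G j) (restrictIf (i = j) (x.P trivialFamily.pt))) w)⟩
    exact (subsingleton_fn_of_isEmpty h2).elim _ _

/-- A stacky vanishing cycle is determined by its restriction to schemes. -/
lemma IsStackyVanishingCycle.apply_eq {φ : SVCFamily R} (hφ : IsStackyVanishingCycle R φ)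
    {Γ : GroupFamily} (hΓ : Γ.Admissible) {X : GSpace Γ} (hX : X.IsSmooth) (f : InvFn X)
    (i : Γ.I) :
    (φ Γ hΓ X hX f i : R.obj (X.X i)) = restrictToSchemes R φ (X.X i) (hX i) (f.f i) := by
  have h := hφ.smooth_pull hΓ trivialFamily_admissible (Y := GSpace.ofScheme (X.X i)) hX
    (fun _ => hX i) (quotientMor X i hΓ) (isSmoothMor_quotientMor X i hΓ) f
    (InvFn.ofScheme (f.f i)) (isCompSt_quotientMor X i hΓ f)
  obtain ⟨W, p, q, s, hW, hp, hq⟩ := exists_point_quotientChart X i hΓ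
  have h1 := h (selfChart (X.X i)) (selfChart_isSmooth _) trivialFamily.pt i W p q (by
    refine (congrArg (IsPullback p q _) ?_).mp hW
    exact (Category.comp_id _).symm)
  have h2 : R.pull p (restrictToSchemes R φ (X.X i) (hX i) (f.f i)) =
      R.pull (q ≫ (quotientChart X i hΓ (selfChart (X.X i))).m i) (φ Γ hΓ X hX f i).1 := by
    refine Eq.trans (congrArg (fun u => R.pull u _) ?_) h1
    exact (Category.comp_id p).symm
  -- Along the section `x ↦ (1, x)` both the projection and the action become the identity of `X_i`,
  -- which turns the comparison on `W` into an equality in `R(X_i)`.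
  have h3 := (R.pull_comp s _ _).trans ((congrArg (R.pull s) h2).trans (R.pull_comp s _ _).symm)
  have h4 := (congrArg (fun u => R.pull u _) hp).symm.trans
    (h3.trans (congrArg (fun u => R.pull u _) hq))
  exact (R.pull_id _).symm.trans (h4.symm.trans (R.pull_id _))

/-- A morphism of schemes, as a morphism of stacks. -/
def GSpace.Hom.ofScheme {X Y : SchC} (u : X ⟶ Y) :
    (GSpace.ofScheme X).Hom (GSpace.ofScheme Y) where
  f _ := u
  equivariant _ := by
    show IsModHom (𝟙_ SchC) u
    apply isModHom_of_points
    intro Z g x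
    rw [toUnit_unique g 1, one_smul, one_smul]

lemma restrict_smooth_pull {φ : SVCFamily R} (hφ : IsStackyVanishingCycle R φ) {X Y : SchC}
    (hX : X.IsSmooth) (hY : Y.IsSmooth) (u : Y ⟶ X) (hu : Smooth (sch u)) (f : Fn X) :
    restrictToSchemes R φ Y hY (Fn.comp u f) = R.pull u (restrictToSchemes R φ X hX f) := by
  let v := GSpace.Hom.ofScheme u
  have h := hφ.smooth_pull trivialFamily_admissible trivialFamily_admissible
    (X := GSpace.ofScheme X) (Y := GSpace.ofScheme Y) (fun _ => hX)
    (fun _ => hY) v.stackMor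
    (fun x hx k => smooth_comp (hx k) hu)
    (InvFn.ofScheme f) (InvFn.ofScheme (Fn.comp u f)) (by
      intro x _ k l W p q hW
      let q' : W ⟶ x.P trivialFamily.pt := q
      let p' : W ⟶ x.P trivialFamily.pt := p
      have hw : p' ≫ x.τ trivialFamily.pt = q' ≫ x.τ trivialFamily.pt ≫ 𝟙 x.S := hW.w
      have hm := x.mono_τ
      have hp : p' = q' := by
        rw [← cancel_mono (x.τ trivialFamily.pt), hw, Category.comp_id]
      show Fn.comp (p' ≫ x.toScheme) (Fn.comp u f) = Fn.comp (q' ≫ x.toScheme ≫ u) f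
      rw [Fn.comp_comp, hp, Category.assoc])
  have h1 := h (selfChart Y) (selfChart_isSmooth _) trivialFamily.pt trivialFamily.pt Y (𝟙 Y)
    (𝟙 Y) (by
      show IsPullback (𝟙 Y) (𝟙 Y) (𝟙 Y) (𝟙 Y ≫ 𝟙 Y)
      rw [Category.comp_id]
      exact IsPullback.of_id_fst)
  have h2 : R.pull (𝟙 Y ≫ 𝟙 Y) (restrictToSchemes R φ Y hY (Fn.comp u f)) =
    R.pull (𝟙 Y ≫ 𝟙 Y ≫ u) (restrictToSchemes R φ X hX f) := h1
  rwa [Category.comp_id, Category.id_comp, Category.id_comp, R.pull_id] at h2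

instance : IsIso (toUnit (𝟙_ SchC ⊗ 𝟙_ SchC)) := by
  rw [toUnit_unique (toUnit _) (λ_ (𝟙_ SchC)).hom]; infer_instance

/-- Used for `trivialFamily.prod trivialFamily`, whose group `𝟙_ ⊗ 𝟙_` is only isomorphic to the
unit object. -/
lemma isLinearAlgebraic_of_isIso (G : SchC) [GrpObj G] [IsIso (toUnit G)] :
    IsLinearAlgebraic G where
  affine := by
    have : IsAffine (𝟙_ SchC).sch := trivial_isLinearAlgebraic.affine
    exact IsAffine.of_isIso (sch (toUnit G))
  smooth := isSmooth_unit.of_hom (toUnit G) inferInstance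
  closed_embedding := by
    refine ⟨0, 1, by simp, ?_⟩
    rw [eq_top_iff]
    intro a _
    refine Subring.subset_closure (Or.inl (Or.inl ⟨Fn.comp (inv (toUnit G)) a, ?_⟩))
    rw [Fn.comp_comp, IsIso.hom_inv_id]
    show (Scheme.Hom.appTop (𝟙 _)).hom a = a
    simp

/-- A bundle for a trivial group is a smooth monomorphism, hence an open immersion, so `P` itself
serves as an open neighbourhood with a section. -/
lemma isSpecial_of_isIso (G : SchC) [GrpObj G] [IsIso (toUnit G)] : IsSpecial G := by
  intro P S m τ h s
  have hmono : Mono τ := ⟨fun a b hab => by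
    obtain ⟨g, hg⟩ := exists_smul_of_isPullback h.isPullback a b hab
    have hg1 : g = 1 := by rw [← cancel_mono (toUnit G)]; exact toUnit_unique _ _
    rw [← hg, hg1, one_smul]⟩
  have hmono' : Mono (sch τ) := by
    have h1 := isPullback_sch (IsKernelPair.id_of_mono τ)
    exact ⟨fun a b hab => by rw [← h1.lift_fst a b hab, h1.lift_snd a b hab]⟩
  have hs := h.smooth
  have ho : IsOpenImmersion (sch τ) := IsOpenImmersion.of_flat_of_mono _
  exact ⟨P, τ, 𝟙 P, ho, h.surjective.surj s, Category.id_comp _⟩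

lemma trivialFamily_prod_admissible : (trivialFamily.prod trivialFamily).Admissible where
  linear _ := isLinearAlgebraic_of_isIso (𝟙_ SchC ⊗ 𝟙_ SchC)
  special _ := isSpecial_of_isIso (𝟙_ SchC ⊗ 𝟙_ SchC)

lemma IsStackyVanishingCycle.restrict {φ : SVCFamily R} (hφ : IsStackyVanishingCycle R φ) :
    IsVanishingCycle R (restrictToSchemes R φ) where
  smooth_pull hX hY u hu f := restrict_smooth_pull hφ hX hY u hu f
  blowUp {Y X B E i π j e} h hX hY hB hE f := by
    have h1 := hφ.blowUp trivialFamily_admissible (GSpace.Hom.ofScheme i)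
      (GSpace.Hom.ofScheme π) (GSpace.Hom.ofScheme j) (GSpace.Hom.ofScheme e) (fun _ => h)
      (fun _ => hX) (fun _ => hY) (fun _ => hB) (fun _ => hE) (InvFn.ofScheme f)
    exact congrArg Subtype.val (congrFun h1 trivialFamily.pt)
  box {X Y} hX hY f g := by
    have h1 := hφ.box trivialFamily_admissible trivialFamily_admissible
      trivialFamily_prod_admissible (X := GSpace.ofScheme X) (Y := GSpace.ofScheme Y)
      (fun _ => hX) (fun _ => hY) (InvFn.ofScheme f) (InvFn.ofScheme g)
    have h2 := congrArg Subtype.val (congrFun h1 (trivialFamily.pt, trivialFamily.pt))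
    -- The product of the stacks `X / 1` and `Y / 1` is a quotient by `1 × 1`, not the stack
    -- attached to `X ⊗ Y`; `apply_eq` identifies the values of `φ` on both.
    exact (hφ.apply_eq trivialFamily_prod_admissible (X := (GSpace.ofScheme X).prod
      (GSpace.ofScheme Y)) (fun _ => hX.prod hY) _ (trivialFamily.pt, trivialFamily.pt)).symm.trans
      h2
  unit := hφ.unit

theorem bijOn_restrictToSchemes :
    Set.BijOn (restrictToSchemes R) {φ | IsStackyVanishingCycle R φ}
      {ψ | IsVanishingCycle R ψ} := by
  refine ⟨fun φ hφ => IsStackyVanishingCycle.restrict hφ, fun φ hφ φ' hφ' h => ?_, fun ψ hψ => ?_⟩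
  · funext Γ hΓ X hX f i
    apply Subtype.ext
    rw [IsStackyVanishingCycle.apply_eq hφ, IsStackyVanishingCycle.apply_eq hφ', h]
  · exact ⟨IsVanishingCycle.stacky hψ, IsVanishingCycle.isStackyVanishingCycle hψ, rfl⟩

end Comparison

/-! ### Projection formula and additivity of classes. -/

section Motivic

namespace MotivicTheory

variable (R : MotivicTheory.{w})

lemma push_pull_of_isIso {X Y : SchC} (u : X ⟶ Y) [IsIso u] (hu : FT u) (a : R.obj Y) :
    R.push u hu (R.pull u a) = a := by
  have h : FT (𝟙 Y) := by
    show QuasiCompact (𝟙 Y.sch)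
    infer_instance
  have h1 : IsPullback u u (𝟙 Y) (𝟙 Y) := IsPullback.of_vert_isIso ⟨rfl⟩
  rw [R.base_change h1 h hu, R.push_id, R.pull_id]

lemma _root_.MotivicVC.FT.comp {X Y Z : SchC} {u : X ⟶ Y} {v : Y ⟶ Z} (hu : FT u) (hv : FT v) :
    FT (u ≫ v) := by
  have h1 : QuasiCompact (sch u) := hu
  have h2 : QuasiCompact (sch v) := hv
  show QuasiCompact (sch u ≫ sch v)
  infer_instance

lemma _root_.MotivicVC.FT.of_isIso {X Y : SchC} (u : X ⟶ Y) [IsIso u] : FT u := by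
  show QuasiCompact (sch u)
  infer_instance

lemma push_congr {X Y : SchC} {u v : X ⟶ Y} (h : u = v) (hu : FT u) (hv : FT v) (a : R.obj X) :
    R.push u hu a = R.push v hv a := by
  subst h; rfl

lemma pull_snd {X Y : SchC} (b : R.obj Y) :
    R.pull (snd X Y) b = R.box (R.pull (toUnit X) R.one) b := by
  have h : snd X Y = (toUnit X ⊗ₘ 𝟙 Y) ≫ (λ_ Y).hom := by simp [leftUnitor_hom]
  rw [h, R.pull_comp, R.one_box, R.pull_box, R.pull_id]

lemma FT_snd {X : SchC} (Y : SchC) (h : FT (toUnit X)) : FT (snd X Y) := by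
  have h1 : QuasiCompact X.obj.hom := h
  show QuasiCompact (pullback.snd X.obj.hom Y.obj.hom)
  infer_instance

lemma push_smul {X Y : SchC} (u : X ⟶ Y) (hu : FT u) (c : R.obj (𝟙_ SchC)) (b : R.obj X) :
    R.push u hu (R.smul c b) = R.smul c (R.push u hu b) := by
  have h : FT (𝟙 (𝟙_ SchC)) := FT.of_isIso _
  have h1 : IsPullback (λ_ X).inv u (𝟙 (𝟙_ SchC) ⊗ₘ u) (λ_ Y).inv :=
    (IsPullback.of_horiz_isIso ⟨by
      apply CartesianMonoidalCategory.hom_ext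
      · exact toUnit_unique _ _
      · simp⟩)
  have h2 : FT (𝟙 (𝟙_ SchC) ⊗ₘ u) := by
    have h3 : (𝟙 (𝟙_ SchC) ⊗ₘ u) = (λ_ X).hom ≫ u ≫ (λ_ Y).inv := by
      simp
    rw [h3]
    exact (FT.of_isIso _).comp (hu.comp (FT.of_isIso _))
  show R.push u hu (R.pull _ (R.box c b)) = R.pull _ (R.box c _)
  rw [R.base_change h1 h2 hu, R.push_box _ _ h hu, R.push_id]

/-- The projection formula for the projection from a product. -/
lemma push_snd_pull_snd {X Y : SchC} (h : FT (toUnit X)) (hs : FT (snd X Y)) (b : R.obj Y) :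
    R.push (snd X Y) hs (R.pull (snd X Y) b) = R.smul (R.cls X h) b := by
  have h1 : snd X Y = (toUnit X ⊗ₘ 𝟙 Y) ≫ (λ_ Y).hom := by simp [leftUnitor_hom]
  have h2 : FT (toUnit X ⊗ₘ 𝟙 Y) := by
    rw [← show snd X Y ≫ (λ_ Y).inv = toUnit X ⊗ₘ 𝟙 Y by rw [h1]; simp]
    exact (FT_snd Y h).comp (FT.of_isIso _)
  have h3 : FT (𝟙 Y) := FT.of_isIso _
  rw [R.pull_snd, R.push_congr h1 hs (h2.comp (FT.of_isIso _)), R.push_comp _ _ h2 (FT.of_isIso _),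
    R.push_box _ _ h h3, R.push_id]
  have h4 : R.box (R.cls X h) b = R.pull (λ_ Y).hom (R.smul (R.cls X h) b) := by
    show _ = R.pull _ (R.pull _ _)
    rw [← R.pull_comp, Iso.hom_inv_id, R.pull_id]
  exact (congrArg _ h4).trans (R.push_pull_of_isIso _ _ _)

lemma cls_prod {X Y : SchC} (hX : FT (toUnit X)) (hY : FT (toUnit Y)) (h : FT (toUnit (X ⊗ Y))) :
    R.cls (X ⊗ Y) h = R.cls X hX * R.cls Y hY := by
  have h1 : toUnit (X ⊗ Y) = snd X Y ≫ toUnit Y := toUnit_unique _ _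
  have h2 := FT_snd Y hX
  rw [cls, R.push_congr h1 h (h2.comp hY), R.push_comp _ _ h2 hY, h1, R.pull_comp,
    R.push_snd_pull_snd hX, R.push_smul]
  rfl

lemma cls_congr {X Y : SchC} (u : X ⟶ Y) [IsIso u] (hX : FT (toUnit X)) (hY : FT (toUnit Y)) :
    R.cls X hX = R.cls Y hY := by
  have h1 : toUnit X = u ≫ toUnit Y := toUnit_unique _ _
  rw [cls, R.push_congr h1 hX ((FT.of_isIso u).comp hY), R.push_comp _ _ (FT.of_isIso u) hY, h1,
    R.pull_comp, R.push_pull_of_isIso]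
  rfl

lemma one_smul' {X : SchC} (b : R.obj X) : R.smul 1 b = b := by
  show R.pull _ (R.box R.one b) = b
  rw [← R.one_box, ← R.pull_comp, Iso.inv_hom_id, R.pull_id]

lemma mul_smul' {X : SchC} (c d : R.obj (𝟙_ SchC)) (b : R.obj X) :
    R.smul (c * d) b = R.smul c (R.smul d b) := by
  show R.pull _ (R.box (R.pull _ (R.box c d)) b) = R.pull _ (R.box c (R.pull _ (R.box d b)))
  conv_lhs => rw [← R.pull_id b]
  conv_rhs => rw [← R.pull_id c]
  rw [box_eq, box_eq, ← R.box_assoc, ← R.pull_comp, ← R.pull_comp, ← R.pull_comp]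
  congr 2
  apply CartesianMonoidalCategory.hom_ext
  · exact toUnit_unique _ _
  · apply CartesianMonoidalCategory.hom_ext
    · exact toUnit_unique _ _
    · simp

lemma cls_add {X Z U : SchC} (i : Z ⟶ X) (j : U ⟶ X) (hi : IsClosedImmersion (sch i))
    (hj : IsOpenImmersion (sch j)) (hij : Set.range (sch j) = (Set.range (sch i))ᶜ)
    (hX : FT (toUnit X)) (hZ : FT (toUnit Z)) (hU : FT (toUnit U)) :
    R.cls X hX = R.cls Z hZ + R.cls U hU := by
  have hi' : FT i := FT.of_isClosedImmersion hi
  -- `X` is of finite type over `ℂ`, hence noetherian, and every open immersion into it is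
  -- quasi-compact.
  have hj' : FT j := by
    have h1 : QuasiCompact (sch i) := hi'
    have h2 : QuasiCompact U.obj.hom := hU
    have h4 : LocallyOfFiniteType X.obj.hom := X.property
    have h5 : QuasiCompact X.obj.hom := hX
    have : IsLocallyNoetherian X.sch := LocallyOfFiniteType.isLocallyNoetherian X.obj.hom
    have : CompactSpace X.sch := QuasiCompact.compactSpace_of_compactSpace X.obj.hom
    have : IsNoetherian X.sch := {}
    show QuasiCompact (sch j)
    infer_instance
  have h1 : toUnit Z = i ≫ toUnit X := toUnit_unique _ _
  have h2 : toUnit U = j ≫ toUnit X := toUnit_unique _ _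
  rw [cls, (R.motivic i j hi' hj' hi hj hij).2.2.2.2 (R.pull (toUnit X) R.one), map_add,
    ← R.push_comp _ _ _ _ (hi'.comp hX), ← R.push_comp _ _ _ _ (hj'.comp hX),
    ← R.pull_comp, ← R.pull_comp]
  simp only [cls, h1, h2]

/-- The identity of an empty scheme is both a closed immersion and the complementary open one, so
`[X] = [X] + [X]`. -/
lemma cls_of_isEmpty {X : SchC} (h : IsEmpty X.sch) (hX : FT (toUnit X)) : R.cls X hX = 0 := by
  have h1 : R.cls X hX = R.cls X hX + R.cls X hX :=
    R.cls_add (𝟙 X) (𝟙 X) (inferInstanceAs (IsClosedImmersion (𝟙 X.sch)))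
      (inferInstanceAs (IsOpenImmersion (𝟙 X.sch)))
      (by ext x; exact h.elim x) hX hX hX
  simpa using h1

lemma smul_inverse_smul {X : SchC} {c : R.obj (𝟙_ SchC)} (hc : IsUnit c) (b : R.obj X) :
    R.smul (Ring.inverse c) (R.smul c b) = b := by
  rw [← R.mul_smul', Ring.inverse_mul_cancel c hc, R.one_smul']

/-- By invariance `m_! pr^* b = m_! m^* b`. Since the action `m` is the projection composed with the
automorphism `shear`, the projection formula for a product applies to it. -/
lemma pushQuotient_of_mem_invariants {G X : SchC} [GrpObj G] [ModObj G X]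
    (hG : IsLinearAlgebraic G) (b : R.obj X) (hb : b ∈ R.invariants G X) :
    R.pushQuotient hG b = R.smul (R.groupClass hG) b := by
  have h1 : R.pull (act G X) b = R.pull (snd G X) b := hb
  have hG' := hG.affine
  have h2 : FT (toUnit G) := FT.of_isAffine G
  have h3 := FT_snd X h2
  have h4 : act G X = (shear G X).hom ≫ snd G X := (shear_snd G X).symm
  rw [pushQuotient, ← h1, R.push_congr h4 _ ((FT.of_isIso _).comp h3),
    R.push_comp _ _ (FT.of_isIso _) h3, h4, R.pull_comp, R.push_pull_of_isIso,
    R.push_snd_pull_snd h2]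
  rfl

end MotivicTheory

end Motivic

/-! ### Morphisms to affine schemes and algebras of functions. -/

section Affine

/-- The constant functions. -/
def Fn.const (X : SchC) : ℂ →+* Fn X :=
  (Fn.comp (toUnit X)).comp (Scheme.ΓSpecIso (CommRingCat.of ℂ)).inv.hom

instance (X : SchC) : Algebra ℂ (Fn X) := (Fn.const X).toAlgebra

lemma Fn.comp_const {X Y : SchC} (u : X ⟶ Y) (c : ℂ) :
    Fn.comp u (algebraMap ℂ (Fn Y) c) = algebraMap ℂ (Fn X) c := by
  show Fn.comp u (Fn.comp _ _) = Fn.comp _ _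
  rw [Fn.comp_comp, toUnit_unique (u ≫ toUnit Y) (toUnit X)]

/-- The composition of functions with `u`, as a homomorphism of algebras. -/
def Fn.compₐ {X Y : SchC} (u : X ⟶ Y) : Fn Y →ₐ[ℂ] Fn X where
  __ := Fn.comp u
  commutes' c := Fn.comp_const u c

@[simp] lemma Fn.compₐ_apply {X Y : SchC} (u : X ⟶ Y) (f : Fn Y) : Fn.compₐ u f = Fn.comp u f :=
  rfl

lemma Fn.compₐ_id (X : SchC) : Fn.compₐ (𝟙 X) = AlgHom.id ℂ (Fn X) :=
  AlgHom.ext fun f => by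
    show (Scheme.Hom.appTop (𝟙 _)).hom f = f
    simp

lemma Fn.comp_id {X : SchC} (f : Fn X) : Fn.comp (𝟙 X) f = f := congrArg (· f) (Fn.compₐ_id X)

lemma hom_ext_of_isAffine {X Y : SchC} [IsAffine Y.sch] {u v : X ⟶ Y}
    (h : ∀ f, Fn.comp u f = Fn.comp v f) : u = v :=
  sch_faithful (ext_of_isAffine (CommRingCat.hom_ext (RingHom.ext h)))

lemma appTop_toSpecΓ_comp {X Y : Scheme.{0}} [IsAffine Y] (φ : Γ(Y, ⊤) ⟶ Γ(X, ⊤)) :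
    (X.toSpecΓ ≫ Spec.map φ ≫ Y.isoSpec.inv).appTop = φ := by
  have h : Y.isoSpec.inv.appTop ≫ (Scheme.ΓSpecIso Γ(Y, ⊤)).hom = 𝟙 _ := by
    rw [← Scheme.toSpecΓ_appTop, ← Scheme.Hom.comp_appTop, Scheme.toSpecΓ_isoSpec_inv]
    exact Scheme.Hom.id_appTop
  rw [Scheme.Hom.comp_appTop, Scheme.Hom.comp_appTop, Scheme.toSpecΓ_appTop, Category.assoc,
    Scheme.ΓSpecIso_naturality, ← Category.assoc, h, Category.id_comp]

/-- The morphism to an affine scheme given by a homomorphism of algebras. -/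
lemma exists_hom_of_algHom {X Y : SchC} [IsAffine Y.sch] (φ : Fn Y →ₐ[ℂ] Fn X) :
    ∃ u : X ⟶ Y, Fn.compₐ u = φ := by
  let φ' : Γ(Y.sch, ⊤) ⟶ Γ(X.sch, ⊤) := CommRingCat.ofHom φ.toRingHom
  have hφ := appTop_toSpecΓ_comp φ'
  have h : (X.sch.toSpecΓ ≫ Spec.map φ' ≫ Y.sch.isoSpec.inv) ≫ Y.obj.hom = X.obj.hom := by
    apply ext_of_isAffine
    rw [Scheme.Hom.comp_appTop, hφ, ← cancel_epi (Scheme.ΓSpecIso (CommRingCat.of ℂ)).inv]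
    exact CommRingCat.hom_ext (RingHom.ext fun c => φ.commutes c)
  refine ⟨⟨Over.homMk (X.sch.toSpecΓ ≫ Spec.map φ' ≫ Y.sch.isoSpec.inv) h⟩, ?_⟩
  exact AlgHom.ext fun f => congrArg (fun ψ => ψ.hom f) hφ

/-- The spectrum of an algebra of finite type. -/
def spc (A : Type) [CommRing A] [Algebra ℂ A] [Algebra.FiniteType ℂ A] : SchC where
  obj := Over.mk (Spec.map (CommRingCat.ofHom (algebraMap ℂ A)))
  property := by
    show LocallyOfFiniteType (Spec.map _)
    rw [HasRingHomProperty.Spec_iff (P := @LocallyOfFiniteType)]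
    simpa [RingHom.finiteType_algebraMap]

section

variable (A : Type) [CommRing A] [Algebra ℂ A] [Algebra.FiniteType ℂ A]

instance : IsAffine (spc A).sch := inferInstanceAs (IsAffine (Spec _))

/-- The functions on the spectrum of an algebra. -/
def fnSpc : Fn (spc A) ≃ₐ[ℂ] A where
  __ := (Scheme.ΓSpecIso (CommRingCat.of A)).commRingCatIsoToRingEquiv
  commutes' c := by
    show (Scheme.ΓSpecIso (CommRingCat.of A)).hom.hom
      ((Scheme.Hom.appTop (Spec.map (CommRingCat.ofHom (algebraMap ℂ A)))).hom
        ((Scheme.ΓSpecIso (CommRingCat.of ℂ)).inv.hom c)) = _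
    have h : (Scheme.ΓSpecIso (CommRingCat.of ℂ)).inv ≫
        (Spec.map (CommRingCat.ofHom (algebraMap ℂ A))).appTop ≫
        (Scheme.ΓSpecIso (CommRingCat.of A)).hom = CommRingCat.ofHom (algebraMap ℂ A) := by
      rw [Scheme.ΓSpecIso_naturality, Iso.inv_hom_id_assoc]
    exact congrArg (fun u => u.hom c) h

end

instance {X : SchC} [IsAffine X.sch] : Algebra.FiniteType ℂ (Fn X) := by
  have h : LocallyOfFiniteType X.obj.hom := X.property
  have h1 : X.obj.hom.appTop.hom.FiniteType :=
    HasRingHomProperty.appTop (P := @LocallyOfFiniteType) X.obj.hom h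
  rw [← RingHom.finiteType_algebraMap]
  exact h1.comp (RingHom.FiniteType.of_surjective _
    (Scheme.ΓSpecIso (CommRingCat.of ℂ)).symm.commRingCatIsoToRingEquiv.surjective)

instance {X Y : SchC} [IsAffine X.sch] [IsAffine Y.sch] : IsAffine (X ⊗ Y).sch := by
  show IsAffine (pullback X.obj.hom Y.obj.hom)
  infer_instance

end Affine

/-! ### Functions on products of affine schemes. -/

section Product

open scoped TensorProduct

/-- The functions on a product of affine schemes. -/
def Fn.prodHom (X Y : SchC) : (Fn X ⊗[ℂ] Fn Y) →ₐ[ℂ] Fn (X ⊗ Y) :=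
  Algebra.TensorProduct.lift (Fn.compₐ (fst X Y)) (Fn.compₐ (snd X Y)) fun _ _ => Commute.all _ _

lemma Fn.prodHom_tmul {X Y : SchC} (a : Fn X) (b : Fn Y) :
    Fn.prodHom X Y (a ⊗ₜ b) = Fn.comp (fst X Y) a * Fn.comp (snd X Y) b := by
  simp [Fn.prodHom]

/-- The universal property of the product gives a morphism `(p, q)` from the spectrum of the tensor
product to `X ⊗ Y`, and `prodHom` gives a morphism `w` back. Pull-back along `(p, q)` is inverse to
`prodHom`, up to `e`. -/
lemma Fn.prodHom_bijective (X Y : SchC) [IsAffine X.sch] [IsAffine Y.sch] :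
    Function.Bijective (Fn.prodHom X Y) := by
  have : Algebra.FiniteType ℂ (Fn X ⊗[ℂ] Fn Y) := .trans (S := Fn X) inferInstance inferInstance
  let e := fnSpc (Fn X ⊗[ℂ] Fn Y)
  obtain ⟨p, hp⟩ := exists_hom_of_algHom (X := spc (Fn X ⊗[ℂ] Fn Y)) (Y := X)
    (e.symm.toAlgHom.comp Algebra.TensorProduct.includeLeft)
  obtain ⟨q, hq⟩ := exists_hom_of_algHom (X := spc (Fn X ⊗[ℂ] Fn Y)) (Y := Y)
    (e.symm.toAlgHom.comp Algebra.TensorProduct.includeRight)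
  obtain ⟨w, hw⟩ := exists_hom_of_algHom (X := X ⊗ Y) (Y := spc (Fn X ⊗[ℂ] Fn Y))
    ((Fn.prodHom X Y).comp e.toAlgHom)
  have hp' (a : Fn X) : e (Fn.comp p a) = a ⊗ₜ 1 := by
    rw [← Fn.compₐ_apply, hp]; simp
  have hq' (a : Fn Y) : e (Fn.comp q a) = 1 ⊗ₜ a := by
    rw [← Fn.compₐ_apply, hq]; simp
  have hw' (a : Fn (spc (Fn X ⊗[ℂ] Fn Y))) : Fn.comp w a = Fn.prodHom X Y (e a) := by
    rw [← Fn.compₐ_apply, hw]; simp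
  have h1 : w ≫ lift p q = 𝟙 (X ⊗ Y) := by
    apply CartesianMonoidalCategory.hom_ext
    · apply hom_ext_of_isAffine
      intro f
      rw [Category.assoc, lift_fst, ← Fn.comp_comp, hw', hp', Fn.prodHom_tmul]
      simp
    · apply hom_ext_of_isAffine
      intro f
      rw [Category.assoc, lift_snd, ← Fn.comp_comp, hw', hq', Fn.prodHom_tmul]
      simp
  have h2 : ((e.toAlgHom.comp (Fn.compₐ (lift p q))).comp (Fn.prodHom X Y)) = AlgHom.id ℂ _ := by
    apply Algebra.TensorProduct.ext'
    intro a b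
    show e (Fn.comp (lift p q) (Fn.prodHom X Y (a ⊗ₜ b))) = a ⊗ₜ b
    rw [Fn.prodHom_tmul, map_mul, Fn.comp_comp, Fn.comp_comp, lift_fst, lift_snd, map_mul, hp', hq']
    simp
  refine ⟨Function.LeftInverse.injective (g := fun f => e (Fn.comp (lift p q) f))
    fun a => congrArg (· a) h2, fun f => ⟨e (Fn.comp (lift p q) f), ?_⟩⟩
  rw [← hw', Fn.comp_comp, h1, Fn.comp_id]

end Product

/-! ### Closed and open subschemes cut out by functions. -/

section Subschemes

lemma isUnit_of_basicOpen_eq_top {X : Scheme.{0}} (f : Γ(X, ⊤)) (h : X.basicOpen f = ⊤) :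
    IsUnit f := by
  apply X.toRingedSpace.isUnit_of_isUnit_germ
  intro x hx
  exact (X.mem_basicOpen_top f x).1 (by rw [h]; trivial)

variable {X : SchC}

/-- The closed subscheme of an affine scheme given by an ideal. -/
lemma exists_closedSub [IsAffine X.sch] (I : Ideal (Fn X)) :
    ∃ (Z : SchC) (i : Z ⟶ X), IsAffine Z.sch ∧ Function.Surjective (Fn.comp i) ∧
      ∀ f, Fn.comp i f = 0 ↔ f ∈ I := by
  let e := fnSpc (Fn X ⧸ I)
  obtain ⟨i, hi⟩ := exists_hom_of_algHom (X := spc (Fn X ⧸ I)) (Y := X)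
    (e.symm.toAlgHom.comp (Ideal.Quotient.mkₐ ℂ I))
  have hi' (f : Fn X) : Fn.comp i f = e.symm (Ideal.Quotient.mk I f) := congrArg (· f) hi
  refine ⟨_, i, inferInstance, fun f => ?_, fun f => ?_⟩
  · obtain ⟨g, hg⟩ := Ideal.Quotient.mk_surjective (e f)
    exact ⟨g, by rw [hi', hg, AlgEquiv.symm_apply_apply]⟩
  · rw [hi', map_eq_zero_iff _ (AlgEquiv.injective _), Ideal.Quotient.eq_zero_iff_mem]

lemma isClosedImmersion_of_surjective {Z : SchC} [IsAffine X.sch] [IsAffine Z.sch] (i : Z ⟶ X)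
    (h : Function.Surjective (Fn.comp i)) : IsClosedImmersion (sch i) :=
  IsClosedImmersion.of_surjective_of_isAffine _ h

lemma exists_lift_of_surjective {Z T : SchC} [IsAffine Z.sch] {i : Z ⟶ X}
    (hi : Function.Surjective (Fn.comp i)) (u : T ⟶ X)
    (h : ∀ f, Fn.comp i f = 0 → Fn.comp u f = 0) [IsAffine X.sch] :
    ∃ v : T ⟶ Z, v ≫ i = u := by
  let ψ := Ideal.Quotient.liftₐ (RingHom.ker (Fn.compₐ i)) (Fn.compₐ u) (fun a ha => h a ha)
  let φ : Fn Z →ₐ[ℂ] Fn T := ψ.comp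
    (Ideal.quotientKerAlgEquivOfSurjective (f := Fn.compₐ i) hi).symm.toAlgHom
  obtain ⟨v, hv⟩ := exists_hom_of_algHom φ
  refine ⟨v, hom_ext_of_isAffine fun f => ?_⟩
  rw [← Fn.comp_comp, ← Fn.compₐ_apply v, hv]
  have h1 : (Ideal.quotientKerAlgEquivOfSurjective (f := Fn.compₐ i) hi).symm (Fn.comp i f) =
      Ideal.Quotient.mk _ f := by
    rw [AlgEquiv.symm_apply_eq]; rfl
  show ψ ((Ideal.quotientKerAlgEquivOfSurjective (f := Fn.compₐ i) hi).symm (Fn.comp i f)) = _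
  rw [h1]; rfl

lemma mono_of_surjective {Z : SchC} [IsAffine Z.sch] {i : Z ⟶ X}
    (hi : Function.Surjective (Fn.comp i)) : Mono i where
  right_cancellation a b hab := by
    apply hom_ext_of_isAffine
    intro f
    obtain ⟨g, rfl⟩ := hi f
    rw [Fn.comp_comp, Fn.comp_comp, hab]

lemma range_of_surjective {Z : SchC} [IsAffine X.sch] [IsAffine Z.sch] (i : Z ⟶ X)
    (h : Function.Surjective (Fn.comp i)) :
    Set.range (sch i) = {x | ∀ f, Fn.comp i f = 0 → x ∉ X.sch.basicOpen f} := by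
  have h1 := Scheme.isoSpec_hom_naturality (sch i)
  have h2 : Set.range (Spec.map (sch i).appTop) =
      PrimeSpectrum.zeroLocus (RingHom.ker (Fn.comp i)) :=
    range_comap_of_surjective _ (Fn.comp i) h
  have h3 : Set.range (X.sch.isoSpec.hom ∘ sch i) =
      PrimeSpectrum.zeroLocus (RingHom.ker (Fn.comp i)) := by
    rw [← h2]
    have h4 : ⇑X.sch.isoSpec.hom ∘ ⇑(sch i) = Spec.map (sch i).appTop ∘ Z.sch.isoSpec.hom := by
      funext x
      exact congrArg (fun u => u x) h1.symm
    rw [h4, Set.range_comp, Set.range_eq_univ.2 (Scheme.Hom.surjective _), Set.image_univ]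
  ext x
  have hinj : Function.Injective X.sch.isoSpec.hom := (Scheme.homeoOfIso X.sch.isoSpec).injective
  have h5 : x ∈ Set.range (sch i) ↔ X.sch.isoSpec.hom x ∈ Set.range (X.sch.isoSpec.hom ∘ sch i) := by
    constructor
    · rintro ⟨y, rfl⟩; exact ⟨y, rfl⟩
    · rintro ⟨y, hy⟩; exact ⟨y, hinj hy⟩
  rw [h5, h3]
  show (∀ f, f ∈ RingHom.ker (Fn.comp i) → f ∈ (X.sch.toSpecΓ x).asIdeal) ↔ _
  refine forall_congr' fun f => ?_
  have h6 : x ∈ X.sch.basicOpen f ↔ f ∉ (X.sch.toSpecΓ x).asIdeal := by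
    rw [← Scheme.toSpecΓ_preimage_basicOpen]; rfl
  rw [h6, not_not]
  rfl

/-- The open subscheme where a function is invertible. -/
def basicSub (X : SchC) (f : Fn X) : SchC := openSub X (X.sch.basicOpen f)

/-- The inclusion of the open subscheme where a function is invertible. -/
def basicSub.ι (X : SchC) (f : Fn X) : basicSub X f ⟶ X := openSub.ι X _

instance (f : Fn X) : Mono (basicSub.ι X f) := openSub.mono _ _

instance (f : Fn X) : IsOpenImmersion (sch (basicSub.ι X f)) := openSub.isOpenImmersion _ _

lemma basicSub.range_ι (f : Fn X) : Set.range (sch (basicSub.ι X f)) = X.sch.basicOpen f := by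
  show Set.range (Scheme.Opens.ι _) = _
  rw [Scheme.Opens.range_ι]

instance [IsAffine X.sch] (f : Fn X) : IsAffine (basicSub X f).sch :=
  (isAffineOpen_top X.sch).basicOpen f

lemma basicSub.isUnit (f : Fn X) : IsUnit (Fn.comp (basicSub.ι X f) f) := by
  apply isUnit_of_basicOpen_eq_top
  refine (Scheme.preimage_basicOpen_top (sch (basicSub.ι X f)) f).symm.trans ?_
  ext x
  have : sch (basicSub.ι X f) x ∈ (X.sch.basicOpen f : Set X.sch) :=
    basicSub.range_ι f ▸ ⟨x, rfl⟩
  exact iff_of_true this trivial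

lemma exists_lift_of_range_subset {U T : SchC} (j : U ⟶ X) [IsOpenImmersion (sch j)] (u : T ⟶ X)
    (h : Set.range (sch u) ⊆ Set.range (sch j)) : ∃ v : T ⟶ U, v ≫ j = u :=
  ⟨⟨Over.homMk (IsOpenImmersion.lift (sch j) (sch u) h) (by
    rw [← Over.w j.hom, ← Over.w u.hom]
    exact IsOpenImmersion.lift_fac_assoc _ _ _ _)⟩, sch_faithful (IsOpenImmersion.lift_fac _ _ _)⟩

lemma basicSub.exists_lift (f : Fn X) {T : SchC} (u : T ⟶ X) (h : IsUnit (Fn.comp u f)) :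
    ∃ v : T ⟶ basicSub X f, v ≫ basicSub.ι X f = u := by
  apply exists_lift_of_range_subset
  rw [basicSub.range_ι]
  rintro _ ⟨t, rfl⟩
  have h1 : (sch u) ⁻¹ᵁ (X.sch.basicOpen f) = ⊤ := by
    rw [Scheme.preimage_basicOpen_top]
    exact Scheme.basicOpen_of_isUnit _ h
  show t ∈ (sch u) ⁻¹ᵁ (X.sch.basicOpen f)
  rw [h1]; trivial

/-- The class of an affine scheme. -/
abbrev MotivicTheory.clsA (R : MotivicTheory.{w}) (X : SchC) [IsAffine X.sch] : R.obj (𝟙_ SchC) :=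
  R.cls X (FT.of_isAffine X)

lemma range_eq_compl_range {Z U : SchC} [IsAffine X.sch] [IsAffine Z.sch] (i : Z ⟶ X) (j : U ⟶ X)
    (hi : Function.Surjective (Fn.comp i)) (f : Fn X) (hf : ∀ g, Fn.comp i g = 0 ↔ f ∣ g)
    (hj' : Set.range (sch j) = X.sch.basicOpen f) :
    Set.range (sch j) = (Set.range (sch i))ᶜ := by
  rw [hj', range_of_surjective i hi]
  ext x
  simp only [Set.mem_compl_iff, Set.mem_ofPred_eq, not_forall, not_not, SetLike.mem_coe]
  constructor
  · exact fun hx => ⟨f, (hf f).2 dvd_rfl, hx⟩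
  · rintro ⟨g, hg, hx⟩
    obtain ⟨h, rfl⟩ := (hf g).1 hg
    rw [Scheme.basicOpen_mul] at hx
    exact hx.1

/-- Cutting along a single function keeps both pieces affine; repeated cuts of this kind compute the
class of `GL_n`, and their pulled-back form cuts torsors. -/
lemma MotivicTheory.clsA_eq_add (R : MotivicTheory.{w}) {Z U : SchC} [IsAffine X.sch]
    [IsAffine Z.sch] [IsAffine U.sch] (i : Z ⟶ X) (j : U ⟶ X)
    (hi : Function.Surjective (Fn.comp i)) (hj : IsOpenImmersion (sch j)) (f : Fn X)
    (hf : ∀ g, Fn.comp i g = 0 ↔ f ∣ g) (hj' : Set.range (sch j) = X.sch.basicOpen f) :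
    R.clsA X = R.clsA Z + R.clsA U :=
  R.cls_add i j (isClosedImmersion_of_surjective i hi) hj (range_eq_compl_range i j hi f hf hj')
    _ _ _

end Subschemes

/-! ### Smoothness at the generic point and over a dense open subset. -/

section GenericSmoothness

open scoped TensorProduct


variable {A B : Type} [CommRing A] [CommRing B] [Algebra B A]

/-- Put `K = Frac B` and `T = K ⊗ A`. Base change of `A ⟶ A ⊗_B A` along `A ⟶ T` shows that `T ⟶ T
⊗_K T` is smooth. As `T` is a nonzero algebra over a field, `K ⟶ T` is faithfully flat, and
smoothness descends along it. -/
lemma _root_.Algebra.Smooth.fractionRing_tensorProduct [IsDomain B] [Algebra.Smooth A (A ⊗[B] A)]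
    [Nontrivial (FractionRing B ⊗[B] A)] :
    Algebra.Smooth (FractionRing B) (FractionRing B ⊗[B] A) := by
  let K := FractionRing B
  let T := K ⊗[B] A
  let _ : Algebra A T := Algebra.TensorProduct.rightAlgebra
  have : IsScalarTower B A T := Algebra.TensorProduct.right_isScalarTower
  have h1 : Algebra.Smooth T (T ⊗[A] (A ⊗[B] A)) := inferInstance
  have h2 : Algebra.Smooth T (T ⊗[B] A) :=
    Algebra.Smooth.of_equiv (A := T ⊗[A] (A ⊗[B] A)) (Algebra.TensorProduct.cancelBaseChange B A T T A)
  have h3 : Algebra.Smooth T (T ⊗[K] (K ⊗[B] A)) :=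
    Algebra.Smooth.of_equiv (A := T ⊗[B] A) (Algebra.TensorProduct.cancelBaseChange B K T T A).symm
  exact .of_smooth_tensorProduct_of_faithfullyFlat T

/-- The generic fibre is the localization of `A` at the image `M` of `B ∖ {0}`, and it is formally
smooth over `B` as well. So every prime of `A` disjoint from `M` lies in the smooth locus, which is
open. The ideal of its complement must then meet `M`, and an element `b` in the intersection defines
the open subset sought. -/
lemma _root_.Algebra.exists_smooth_localizationAway_of_fractionRing [IsDomain B] [Algebra.FinitePresentation B A]
    [Algebra.Smooth (FractionRing B) (FractionRing B ⊗[B] A)] :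
    ∃ b : B, b ≠ 0 ∧ Algebra.Smooth B (Localization.Away (algebraMap B A b)) := by
  let K := FractionRing B
  let T := K ⊗[B] A
  let _ : Algebra A T := Algebra.TensorProduct.rightAlgebra
  have : IsScalarTower B A T := Algebra.TensorProduct.right_isScalarTower
  let M := Algebra.algebraMapSubmonoid A (nonZeroDivisors B)
  have hloc : IsLocalization M T := IsLocalization.tensorRight (S := A) K _
  have hK : Algebra.FormallySmooth B K := .of_isLocalization (nonZeroDivisors B)
  have hT : Algebra.FormallySmooth B T := .comp B K T
  have hp (p : PrimeSpectrum A) (hp : Disjoint (M : Set A) p.asIdeal) : p ∈ Algebra.smoothLocus B A := by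
    let P := p.asIdeal.map (algebraMap A T)
    have hP : P.IsPrime := IsLocalization.isPrime_of_isPrime_disjoint M T _ p.2 hp
    have hc : P.comap (algebraMap A T) = p.asIdeal :=
      IsLocalization.under_map_of_isPrime_disjoint M T p.2 hp
    have h1 : IsLocalization.AtPrime (Localization.AtPrime P) (P.comap (algebraMap A T)) :=
      IsLocalization.isLocalization_isLocalization_atPrime_isLocalization M _ P
    have h2 : p.asIdeal.primeCompl = (P.comap (algebraMap A T)).primeCompl := by
      simp only [hc]
    have h3 : IsLocalization p.asIdeal.primeCompl (Localization.AtPrime P) := h2 ▸ h1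
    have h4 : Algebra.FormallySmooth B (Localization.AtPrime P) := inferInstance
    exact Algebra.FormallySmooth.of_equiv (A := Localization.AtPrime P)
      ((IsLocalization.algEquiv p.asIdeal.primeCompl (Localization.AtPrime P)
        (Localization.AtPrime p.asIdeal)).restrictScalars B)
  obtain ⟨s, hs⟩ := (PrimeSpectrum.isClosed_iff_zeroLocus _).1
    (Algebra.isOpen_smoothLocus (R := B) (A := A)).isClosed_compl
  -- Otherwise some prime contains `s` and avoids `M`: it would lie both outside and inside the
  -- smooth locus.
  have h1 : ¬ Disjoint (Ideal.span s : Set A) M := fun hd => by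
    obtain ⟨p, hp1, hp2, hp3⟩ := Ideal.exists_le_prime_disjoint _ M hd
    have h2 : (⟨p, hp1⟩ : PrimeSpectrum A) ∈ PrimeSpectrum.zeroLocus s :=
      fun x hx => hp2 (Ideal.subset_span hx)
    rw [← hs] at h2
    exact h2 (hp ⟨p, hp1⟩ hp3.symm)
  obtain ⟨_, hx, b, hb, rfl⟩ := Set.not_disjoint_iff.1 h1
  refine ⟨b, nonZeroDivisors.ne_zero hb, ?_⟩
  rw [← Algebra.basicOpen_subset_smoothLocus_iff_smooth, ← compl_compl (Algebra.smoothLocus B A), hs,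
    Set.subset_compl_comm, PrimeSpectrum.basicOpen_eq_zeroLocus_compl, compl_compl,
    ← PrimeSpectrum.zeroLocus_span s]
  exact PrimeSpectrum.zeroLocus_anti_mono (Set.singleton_subset_iff.2 hx)


end GenericSmoothness

/-! ### Fibre products and pulled-back additivity. -/

section Pullbacks

/-- Fibre products exist. -/
lemma exists_isPullback {X Y Z : SchC} (c : X ⟶ Z) (d : Y ⟶ Z) :
    ∃ (W : SchC) (a : W ⟶ X) (b : W ⟶ Y), IsPullback a b c d := by
  have ha : LocallyOfFiniteType X.obj.hom := X.property
  have hd : LocallyOfFiniteType (sch d) := by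
    have h1 : LocallyOfFiniteType (sch d ≫ Z.obj.hom) := by
      rw [show sch d ≫ Z.obj.hom = Y.obj.hom from Over.w d.hom]; exact Y.property
    exact locallyOfFiniteType_of_comp (sch d) Z.obj.hom
  let T : SchC := ⟨Over.mk (pullback.fst (sch c) (sch d) ≫ X.obj.hom),
    by show LocallyOfFiniteType (pullback.fst (sch c) (sch d) ≫ X.obj.hom); infer_instance⟩
  let t1 : T ⟶ X := ⟨Over.homMk (pullback.fst (sch c) (sch d)) rfl⟩
  let t2 : T ⟶ Y := ⟨Over.homMk (pullback.snd (sch c) (sch d)) (by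
    show _ ≫ Y.obj.hom = pullback.fst (sch c) (sch d) ≫ X.obj.hom
    rw [← Over.w d.hom, ← Over.w c.hom]
    show pullback.snd (sch c) (sch d) ≫ sch d ≫ _ = pullback.fst (sch c) (sch d) ≫ sch c ≫ _
    rw [← Category.assoc, ← Category.assoc, pullback.condition])⟩
  have hw (s : PullbackCone c d) : sch s.fst ≫ sch c = sch s.snd ≫ sch d :=
    congrArg sch s.condition
  refine ⟨T, t1, t2, ⟨sch_faithful pullback.condition⟩, ⟨PullbackCone.IsLimit.mk _
    (fun s => ⟨Over.homMk (pullback.lift (sch s.fst) (sch s.snd) (hw s)) ?_⟩)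
    (fun s => sch_faithful (pullback.lift_fst _ _ _))
    (fun s => sch_faithful (pullback.lift_snd _ _ _))
    (fun s m h1 h2 => sch_faithful ?_)⟩⟩
  · show _ ≫ pullback.fst (sch c) (sch d) ≫ X.obj.hom = _
    rw [← Category.assoc, pullback.lift_fst]
    exact Over.w s.fst.hom
  · apply pullback.hom_ext
    · exact (congrArg sch h1).trans (pullback.lift_fst _ _ _).symm
    · exact (congrArg sch h2).trans (pullback.lift_snd _ _ _).symm

variable {W X Y Z : SchC} {a : W ⟶ X} {b : W ⟶ Y} {c : X ⟶ Z} {d : Y ⟶ Z}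

lemma isAffine_of_isPullback [IsAffine X.sch] [IsAffine Y.sch] [IsAffine Z.sch]
    (h : IsPullback a b c d) : IsAffine W.sch :=
  .of_isIso (isPullback_sch h).isoPullback.hom

lemma range_of_isPullback (h : IsPullback a b c d) :
    Set.range (sch a) = sch c ⁻¹' Set.range (sch d) := by
  rw [← Scheme.Pullback.range_fst, ← (isPullback_sch h).isoPullback_hom_fst]
  show Set.range (pullback.fst (sch c) (sch d) ∘ (isPullback_sch h).isoPullback.hom) = _
  rw [Set.range_comp, Set.range_eq_univ.2 (Scheme.Hom.surjective _), Set.image_univ]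

lemma isOpenImmersion_of_isPullback (h : IsPullback a b c d) (hd : IsOpenImmersion (sch d)) :
    IsOpenImmersion (sch a) :=
  MorphismProperty.of_isPullback (P := @IsOpenImmersion) (isPullback_sch h).flip hd

lemma isClosedImmersion_of_isPullback (h : IsPullback a b c d)
    (hd : IsClosedImmersion (sch d)) : IsClosedImmersion (sch a) :=
  MorphismProperty.of_isPullback (P := @IsClosedImmersion) (isPullback_sch h).flip hd

lemma isEmpty_of_subsingleton [Subsingleton (Fn X)] : IsEmpty X.sch where
  false x := by
    have h : X.sch.basicOpen (1 : Fn X) = ⊤ := by simp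
    have h0 : X.sch.basicOpen (0 : Fn X) = ⊥ := by simp
    rw [Subsingleton.elim (1 : Fn X) 0, h0] at h
    have hx : x ∈ (⊤ : X.sch.Opens) := trivial
    rw [← h] at hx
    exact hx

/-- The additivity of classes, pulled back along a morphism. -/
lemma MotivicTheory.clsA_eq_add_of_isPullback (R : MotivicTheory.{w}) {S Z U X XZ XU : SchC}
    [IsAffine S.sch] [IsAffine Z.sch] [IsAffine X.sch] [IsAffine XZ.sch] [IsAffine XU.sch]
    {τ : X ⟶ S} {i : Z ⟶ S} {j : U ⟶ S} (hi : Function.Surjective (Fn.comp i))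
    (hj : IsOpenImmersion (sch j)) (f : Fn S) (hf : ∀ g, Fn.comp i g = 0 ↔ f ∣ g)
    (hj' : Set.range (sch j) = S.sch.basicOpen f) {aZ : XZ ⟶ X} {bZ : XZ ⟶ Z} {aU : XU ⟶ X}
    {bU : XU ⟶ U} (hZ : IsPullback aZ bZ τ i) (hU : IsPullback aU bU τ j) :
    R.clsA X = R.clsA XZ + R.clsA XU := by
  refine R.cls_add aZ aU (isClosedImmersion_of_isPullback hZ (isClosedImmersion_of_surjective i hi))
    (isOpenImmersion_of_isPullback hU hj) ?_ _ _ _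
  rw [range_of_isPullback hZ, range_of_isPullback hU, ← Set.preimage_compl]
  congr 1
  exact range_eq_compl_range i j hi f hf hj'

end Pullbacks

/-! ### Base change and triviality of torsors. -/

section Torsors

variable {G : SchC} [GrpObj G]

/-- The base change of a torsor. -/
lemma exists_modObj_of_isPullback {X S X' S' : SchC} [ModObj G X] {τ : X ⟶ S}
    (h : IsPullback (act G X) (snd G X) τ τ) {a : X' ⟶ X} {b : X' ⟶ S'} {g : S' ⟶ S}
    (hp : IsPullback a b τ g) :
    ∃ _ : ModObj G X', IsPullback (act G X') (snd G X') b b := by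
  have hc {Z : SchC} (u : Z ⟶ G) (x : Z ⟶ X') : (u • (x ≫ a)) ≫ τ = (x ≫ b) ≫ g := by
    rw [smul_comp_of_invariant h.w, Category.assoc, Category.assoc, hp.w]
  let m : G ⊗ X' ⟶ X' := hp.lift (fst G X' • (snd G X' ≫ a)) (snd G X' ≫ b) (hc _ _)
  have hma {Z : SchC} (u : Z ⟶ G) (x : Z ⟶ X') : (lift u x ≫ m) ≫ a = u • (x ≫ a) := by
    rw [Category.assoc, hp.lift_fst, ModObj.comp_smul, lift_fst, lift_snd_assoc]
  have hmb {Z : SchC} (u : Z ⟶ G) (x : Z ⟶ X') : (lift u x ≫ m) ≫ b = x ≫ b := by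
    rw [Category.assoc, hp.lift_snd, lift_snd_assoc]
  let M : ModObj G X' := modObjOfPoints m
    (by
      apply hp.hom_ext
      · rw [hma, one_smul]
      · rw [hmb])
    (fun Z u v x => by
      apply hp.hom_ext
      · rw [hma, hma, hma, mul_smul]
      · rw [hmb, hmb, hmb])
  have hsa {Z : SchC} (u : Z ⟶ G) (x : Z ⟶ X') : (u • x) ≫ a = u • (x ≫ a) := by
    rw [← hma, Hom.smul_def]; rfl
  have hsb {Z : SchC} (u : Z ⟶ G) (x : Z ⟶ X') : (u • x) ≫ b = x ≫ b := by
    rw [← hmb u x, Hom.smul_def]; rfl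
  refine ⟨M, isPullback_of_points b ?_ ?_ ?_⟩
  · rw [act_eq_smul, hsb]
  · intro Z x y hxy
    obtain ⟨u, hu⟩ := exists_smul_of_isPullback h (x ≫ a) (y ≫ a) (by
      rw [Category.assoc, Category.assoc, hp.w, reassoc_of% hxy])
    refine ⟨u, hp.hom_ext ?_ ?_⟩
    · rw [hsa, hu]
    · rw [hsb, hxy]
  · intro Z u v x hx
    apply smul_injective_of_isPullback h u v (x ≫ a)
    rw [← hsa, hx, hsa]

/-- A torsor with a section is trivial. -/
lemma exists_isIso_of_section {X S : SchC} [ModObj G X] {τ : X ⟶ S}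
    (h : IsPullback (act G X) (snd G X) τ τ) (t : S ⟶ X) (ht : t ≫ τ = 𝟙 S) :
    ∃ u : G ⊗ S ⟶ X, IsIso u := by
  -- `g : X ⟶ G` measures the distance to the section: `x = g(x) · t(τ x)`. The inverse of `(g, s) ↦
  -- g · t(s)` is `(g, τ)`.
  obtain ⟨g, hg⟩ := exists_smul_of_isPullback h (𝟙 X) (τ ≫ t) (by simp [ht])
  have hu {Z : SchC} (v : Z ⟶ G) (s : Z ⟶ S) :
      lift v s ≫ (fst G S • (snd G S ≫ t)) = v • (s ≫ t) := by
    rw [ModObj.comp_smul, lift_fst, lift_snd_assoc]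
  refine ⟨fst G S • (snd G S ≫ t), lift g τ, ?_, ?_⟩
  · have h1 : (fst G S • (snd G S ≫ t)) ≫ τ = snd G S := by
      rw [smul_comp_of_invariant h.w, Category.assoc, ht, Category.comp_id]
    rw [comp_lift, h1]
    apply CartesianMonoidalCategory.hom_ext
    · rw [lift_fst, Category.id_comp]
      apply smul_injective_of_isPullback h _ _ (snd G S ≫ t)
      have h2 := congrArg ((fst G S • (snd G S ≫ t)) ≫ ·) hg
      simp only [ModObj.comp_smul, Category.comp_id] at h2
      rw [reassoc_of% h1] at h2
      exact h2
    · simp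
  · rw [hu, hg]

lemma MotivicTheory.groupClass_dvd_of_section (R : MotivicTheory.{w}) (hG : IsLinearAlgebraic G)
    {X S : SchC} [IsAffine X.sch] [IsAffine S.sch] [ModObj G X] {τ : X ⟶ S}
    (h : IsPullback (act G X) (snd G X) τ τ) (t : S ⟶ X) (ht : t ≫ τ = 𝟙 S) :
    R.groupClass hG ∣ R.clsA X := by
  obtain ⟨u, hu⟩ := exists_isIso_of_section h t ht
  have := hG.affine
  have h1 : R.clsA (G ⊗ S) = R.clsA X := R.cls_congr u _ _
  have h2 : R.clsA (G ⊗ S) = R.clsA G * R.clsA S := R.cls_prod _ _ _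
  exact ⟨R.clsA S, h1.symm.trans h2⟩

end Torsors

/-! ### Classes of torsors for special groups. -/

section TorsorClass

open scoped TensorProduct

variable {G : SchC} [GrpObj G]

/-- This is the algebraic form of smoothness of `X ×_S X ⟶ X`, as needed for
`Algebra.Smooth.fractionRing_tensorProduct`. For a torsor the map is the action `G × X ⟶ X`. -/
lemma smooth_tensorProduct_of_isPullback {X S : Scheme.{0}} [IsAffine X] [IsAffine S] {P : Scheme.{0}}
    {a b : P ⟶ X} {τ : X ⟶ S} (h : IsPullback a b τ τ) (ha : Smooth a) :
    letI := τ.appTop.hom.toAlgebra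
    Algebra.Smooth Γ(X, ⊤) (Γ(X, ⊤) ⊗[Γ(S, ⊤)] Γ(X, ⊤)) := by
  let := τ.appTop.hom.toAlgebra
  have h1 : IsPullback (a ≫ X.isoSpec.hom) (b ≫ X.isoSpec.hom) (Spec.map τ.appTop)
      (Spec.map τ.appTop) :=
    IsPullback.of_iso h (Iso.refl _) X.isoSpec X.isoSpec S.isoSpec (by simp) (by simp)
      (by simp [Scheme.isoSpec_hom_naturality]) (by simp [Scheme.isoSpec_hom_naturality])
  have h2 := isPullback_SpecMap_of_isPushout _ _ _ _
    (CommRingCat.isPushout_tensorProduct Γ(S, ⊤) Γ(X, ⊤) Γ(X, ⊤))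
  have h3 : Smooth (a ≫ X.isoSpec.hom) := inferInstance
  have h4 : (h2.isoIsPullback _ _ h1).hom ≫ (a ≫ X.isoSpec.hom) = _ :=
    h2.isoIsPullback_hom_fst _ _ h1
  have h5 : Smooth (Spec.map (CommRingCat.ofHom
      (Algebra.TensorProduct.includeLeftRingHom : Γ(X, ⊤) →+* Γ(X, ⊤) ⊗[Γ(S, ⊤)] Γ(X, ⊤)))) := by
    rw [← h4]; infer_instance
  rw [HasRingHomProperty.Spec_iff (P := @Smooth)] at h5
  exact RingHom.smooth_algebraMap.1 h5

/-- An open subscheme is determined by its range, so `U` can be replaced by the spectrum of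
`Localization.Away f`. -/
lemma smooth_of_smooth_localizationAway {U X S : Scheme.{0}} [IsAffine X] [IsAffine S]
    {a : U ⟶ X} [IsOpenImmersion a] {τ : X ⟶ S} (f : Γ(X, ⊤))
    (ha : Set.range a = X.basicOpen f)
    (h : letI := τ.appTop.hom.toAlgebra
      Algebra.Smooth Γ(S, ⊤) (Localization.Away f)) : Smooth (a ≫ τ) := by
  let := τ.appTop.hom.toAlgebra
  let q : Spec (CommRingCat.of (Localization.Away f)) ⟶ X :=
    Spec.map (CommRingCat.ofHom (algebraMap Γ(X, ⊤) (Localization.Away f))) ≫ X.isoSpec.inv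
  have h1 := PrimeSpectrum.localization_away_comap_range (Localization.Away f) f
  have hr : Set.range q = X.isoSpec.inv '' (PrimeSpectrum.basicOpen f : Set (PrimeSpectrum _)) :=
    (Set.range_comp X.isoSpec.inv
      (PrimeSpectrum.comap (algebraMap Γ(X, ⊤) (Localization.Away f)))).trans (congrArg _ h1)
  have h2 : Set.range q = X.basicOpen f := by
    rw [hr]
    ext x
    constructor
    · rintro ⟨y, hy, rfl⟩
      show X.isoSpec.inv y ∈ X.basicOpen f
      rw [← Scheme.toSpecΓ_preimage_basicOpen]
      show X.isoSpec.hom (X.isoSpec.inv y) ∈ PrimeSpectrum.basicOpen f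
      rwa [Scheme.inv_hom_apply]
    · intro hx
      refine ⟨X.isoSpec.hom x, ?_, by rw [Scheme.hom_inv_apply]⟩
      have hx' : x ∈ X.basicOpen f := hx
      rwa [← Scheme.toSpecΓ_preimage_basicOpen] at hx'
  have h3 : Smooth (q ≫ τ) := by
    have h4 : q ≫ τ = Spec.map (CommRingCat.ofHom (algebraMap Γ(S, ⊤) (Localization.Away f))) ≫
        S.isoSpec.inv := by
      rw [Category.assoc, ← Scheme.isoSpec_inv_naturality, ← Spec.map_comp_assoc]
      rfl
    have h5 : Smooth (Spec.map (CommRingCat.ofHom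
        (algebraMap Γ(S, ⊤) (Localization.Away f)))) := by
      rw [HasRingHomProperty.Spec_iff (P := @Smooth)]
      exact RingHom.smooth_algebraMap.2 h
    rw [h4]; infer_instance
  have h4 : a ≫ τ = (IsOpenImmersion.isoOfRangeEq a q (ha.trans h2.symm)).hom ≫ q ≫ τ := by
    rw [IsOpenImmersion.isoOfRangeEq_hom_fac_assoc]
  rw [h4]; infer_instance


lemma isPullback_id_of_comp_eq {U V S : SchC} (j : U ⟶ V) (k : U ⟶ S) (i : V ⟶ S) [Mono i]
    (hj : j ≫ i = k) : IsPullback (𝟙 U) j k i := by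
  refine ⟨⟨by rw [hj, Category.id_comp]⟩, ⟨PullbackCone.IsLimit.mk _ (fun s => s.fst)
    (fun s => Category.comp_id _) (fun s => ?_) (fun s m h1 h2 => ?_)⟩⟩
  · rw [← cancel_mono i, Category.assoc, hj, s.condition]
  · rwa [Category.comp_id] at h1

lemma exists_basicOpen_subset {S : Scheme.{0}} [IsAffine S] {V : Set S} (hV : IsOpen V) {s : S}
    (hs : s ∈ V) : ∃ f : Γ(S, ⊤), s ∈ S.basicOpen f ∧ (S.basicOpen f : Set S) ⊆ V := by
  obtain ⟨_, ⟨_, ⟨f, rfl⟩, rfl⟩, h1, h2⟩ :=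
    (isBasis_basicOpen S).exists_subset_of_mem_open hs hV
  exact ⟨f, h1, h2⟩

lemma ne_zero_of_mem_basicOpen {S : Scheme.{0}} {f : Γ(S, ⊤)} {s : S} (hs : s ∈ S.basicOpen f) :
    f ≠ 0 := by
  rintro rfl
  rw [Scheme.basicOpen_zero] at hs
  exact hs

/-- Over a nonempty open subset of an integral base, a torsor for a special group is empty or
trivial. -/
lemma exists_section_or_comp_eq_zero (hG : IsLinearAlgebraic G) (hs : IsSpecial G) {X S : SchC}
    [IsAffine X.sch] [IsAffine S.sch] [IsDomain (Fn S)] [ModObj G X] {τ : X ⟶ S}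
    (h : IsPullback (act G X) (snd G X) τ τ) :
    ∃ f : Fn S, f ≠ 0 ∧
      (Fn.comp τ f = 0 ∨ ∃ t : basicSub S f ⟶ X, t ≫ τ = basicSub.ι S f) := by
  let alg : Algebra (Fn S) (Fn X) := (Fn.comp τ).toAlgebra
  -- If such a `b` exists, `X` is empty over the locus where `b` is invertible. Otherwise functions
  -- on `S` inject into functions on `X` and the generic fibre is not empty.
  by_cases hK : ∃ b : Fn S, b ≠ 0 ∧ Fn.comp τ b = 0
  · obtain ⟨b, hb, hb'⟩ := hK
    exact ⟨b, hb, .inl hb'⟩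
  push Not at hK
  have hsm : Algebra.Smooth (Fn X) (Fn X ⊗[Fn S] Fn X) :=
    smooth_tensorProduct_of_isPullback (isPullback_sch h) (smooth_act G X hG.smooth)
  have hft : Algebra.FiniteType (Fn S) (Fn X) := by
    have : IsScalarTower ℂ (Fn S) (Fn X) :=
      IsScalarTower.of_algebraMap_eq fun c => (Fn.comp_const τ c).symm
    exact .of_restrictScalars_finiteType ℂ (Fn S) (Fn X)
  have hno : IsNoetherianRing (Fn S) := Algebra.FiniteType.isNoetherianRing ℂ (Fn S)
  have hfp : Algebra.FinitePresentation (Fn S) (Fn X) :=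
    Algebra.FinitePresentation.of_finiteType.1 hft
  have hinj : Function.Injective (algebraMap (Fn S) (Fn X)) :=
    (injective_iff_map_eq_zero _).2 fun b hb => by_contra fun hb' => hK b hb' hb
  by_cases hX : Subsingleton (Fn X)
  · exact (hK 1 one_ne_zero (Subsingleton.elim _ _)).elim
  have hX' : Nontrivial (Fn X) := not_subsingleton_iff_nontrivial.1 hX
  have hnt : Nontrivial (FractionRing (Fn S) ⊗[Fn S] Fn X) := by
    let : Algebra (Fn X) (FractionRing (Fn S) ⊗[Fn S] Fn X) := Algebra.TensorProduct.rightAlgebra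
    have hl : IsLocalization (Algebra.algebraMapSubmonoid (Fn X) (nonZeroDivisors (Fn S)))
        (FractionRing (Fn S) ⊗[Fn S] Fn X) := IsLocalization.tensorRight (S := Fn X) _ _
    rw [← not_subsingleton_iff_nontrivial, IsLocalization.subsingleton_iff (M :=
      Algebra.algebraMapSubmonoid (Fn X) (nonZeroDivisors (Fn S)))]
    rintro ⟨b, hb, hb'⟩
    exact hK b (nonZeroDivisors.ne_zero hb) hb'
  have hsm' := Algebra.Smooth.fractionRing_tensorProduct (A := Fn X) (B := Fn S)
  obtain ⟨b, hb, hsb⟩ :=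
    Algebra.exists_smooth_localizationAway_of_fractionRing (A := Fn X) (B := Fn S)
  -- The part of `X` over `D(b)` is smooth over `S`, so its image is open; it is nonempty because no
  -- power of `b` vanishes on `X`.
  let a := basicSub.ι X (Fn.comp τ b)
  have ha : Smooth (sch a ≫ sch τ) :=
    smooth_of_smooth_localizationAway (Fn.comp τ b) (basicSub.range_ι _) hsb
  have hV : IsOpen (Set.range (sch a ≫ sch τ)) := (sch a ≫ sch τ).isOpenMap.isOpen_range
  have hne : (Set.range (sch a ≫ sch τ)).Nonempty := by
    have h1 : X.sch.basicOpen (Fn.comp τ b) ≠ ⊥ := fun h1 => by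
      obtain ⟨n, hn⟩ := (Scheme.isNilpotent_iff_basicOpen_eq_bot _).2 h1
      rw [← map_pow] at hn
      exact hK _ (pow_ne_zero n hb) hn
    obtain ⟨x, hx⟩ := (TopologicalSpace.Opens.ne_bot_iff_nonempty _).1 h1
    rw [← basicSub.range_ι] at hx
    obtain ⟨y, rfl⟩ := hx
    exact ⟨_, y, rfl⟩
  obtain ⟨_, y, rfl⟩ := hne
  -- Over a basic open subset of this image the torsor is smooth and surjective. It is thus a
  -- principal bundle, to which specialness applies.
  obtain ⟨f, hf1, hf2⟩ := exists_basicOpen_subset hV ⟨y, rfl⟩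
  obtain ⟨U, aU, bU, hU⟩ := exists_isPullback τ (basicSub.ι S f)
  obtain ⟨_, hU'⟩ := exists_modObj_of_isPullback h hU
  have hwU (u : U.sch) : sch τ (sch aU u) = sch (basicSub.ι S f) (sch bU u) :=
    congrArg (fun v => sch v u) hU.w
  have hmem (u : (basicSub S f).sch) :
      ∃ y, (sch a ≫ sch τ) y = sch (basicSub.ι S f) u :=
    hf2 (by rw [← basicSub.range_ι]; exact ⟨u, rfl⟩)
  have hUs : Smooth (sch bU) := by
    obtain ⟨v, hv⟩ := exists_lift_of_range_subset a aU (by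
      rintro _ ⟨u, rfl⟩
      obtain ⟨y, hy⟩ := hmem (sch bU u)
      have h1 : sch a y ∈ X.sch.basicOpen (Fn.comp τ b) := by
        have h2 : sch a y ∈ Set.range (sch a) := ⟨y, rfl⟩
        rwa [basicSub.range_ι] at h2
      have h2 : X.sch.basicOpen (Fn.comp τ b) = sch τ ⁻¹ᵁ S.sch.basicOpen b :=
        (Scheme.preimage_basicOpen_top (sch τ) b).symm
      rw [basicSub.range_ι, h2]
      rw [h2] at h1
      show sch τ (sch aU u) ∈ S.sch.basicOpen b
      rw [hwU, ← hy]
      exact h1)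
    have hvo : IsOpenImmersion (sch v) := by
      have h1 : IsOpenImmersion (sch v ≫ sch a) := by
        rw [← sch_comp, hv]
        exact isOpenImmersion_of_isPullback hU inferInstance
      exact IsOpenImmersion.of_comp _ (sch a)
    have h1 : Smooth (sch bU ≫ sch (basicSub.ι S f)) := by
      rw [← sch_comp, ← hU.w, ← hv, sch_comp, sch_comp, Category.assoc]
      infer_instance
    exact MorphismProperty.of_isPullback (P := @Smooth)
      (isPullback_sch (isPullback_id_of_comp_eq bU (bU ≫ basicSub.ι S f) _ rfl)) h1
  have hUsurj : Surjective (sch bU) := by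
    refine ⟨fun u => ?_⟩
    obtain ⟨y, hy⟩ := hmem u
    have h1 : sch a y ∈ Set.range (sch aU) := by
      rw [range_of_isPullback hU]
      exact ⟨u, hy.symm⟩
    obtain ⟨x, hx⟩ := h1
    refine ⟨x, (sch (basicSub.ι S f)).isOpenEmbedding.injective ?_⟩
    rw [← hwU, hx, ← hy]
    rfl
  obtain ⟨s, hs'⟩ : ∃ s, sch (basicSub.ι S f) s = (sch a ≫ sch τ) y := by
    have h1 := basicSub.range_ι f
    exact h1.symm.subset hf1
  obtain ⟨W, g, t, hg, ⟨w, hw⟩, ht⟩ := hs U (basicSub S f) bU ⟨hUs, hUsurj, hU'⟩ s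
  have hgo : IsOpenImmersion (sch (g ≫ basicSub.ι S f)) := by
    rw [sch_comp]; infer_instance
  -- The neighbourhood given by specialness is shrunk to a basic open subset of `S`, so that it is
  -- again the locus where one function is invertible.
  obtain ⟨f', hf1', hf2'⟩ := exists_basicOpen_subset
    (sch (g ≫ basicSub.ι S f)).isOpenEmbedding.isOpen_range ⟨w, rfl⟩
  obtain ⟨v, hv⟩ := exists_lift_of_range_subset (g ≫ basicSub.ι S f) (basicSub.ι S f')
    (by rw [basicSub.range_ι]; exact hf2')
  refine ⟨f', ne_zero_of_mem_basicOpen hf1', .inr ⟨v ≫ t ≫ aU, ?_⟩⟩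
  rw [Category.assoc, Category.assoc, hU.w, reassoc_of% ht, hv]


variable (R : MotivicTheory.{w}) (hG : IsLinearAlgebraic G)

/-- The classes of all torsors over `S` are multiples of the class of the group. -/
def MotivicTheory.TorsorDvd (S : SchC) : Prop :=
  ∀ (X : SchC) [IsAffine X.sch] [ModObj G X] (τ : X ⟶ S),
    IsPullback (act G X) (snd G X) τ τ → R.groupClass hG ∣ R.clsA X

variable {R hG}

lemma MotivicTheory.TorsorDvd.dvd_of_isPullback {S Z X XZ : SchC} {i : Z ⟶ S}
    (h : R.TorsorDvd hG Z) [IsAffine XZ.sch] [ModObj G X] {τ : X ⟶ S}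
    (hX : IsPullback (act G X) (snd G X) τ τ) {aZ : XZ ⟶ X} {bZ : XZ ⟶ Z}
    (hZ : IsPullback aZ bZ τ i) : R.groupClass hG ∣ R.clsA XZ := by
  obtain ⟨_, h1⟩ := exists_modObj_of_isPullback hX hZ
  exact h XZ bZ h1

/-- Inductive step of the noetherian induction. If `S` is integral, cut along an `f` over whose
nonvanishing locus the torsor is empty or trivial. If `ab = 0` with `a, b ≠ 0`, then `D(a)` lies in
`V(b)` with complement `V(a) ∩ V(b)`, so the class over `D(a)` is a difference of classes over two
proper closed subschemes. Nilpotent functions are covered by this second case. -/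
lemma MotivicTheory.TorsorDvd.of_closed (hs : IsSpecial G) {S : SchC} [IsAffine S.sch]
    (h : ∀ (Z : SchC) [IsAffine Z.sch] (i : Z ⟶ S), Function.Surjective (Fn.comp i) →
      (∃ f, f ≠ 0 ∧ Fn.comp i f = 0) → R.TorsorDvd hG Z) : R.TorsorDvd hG S := by
  intro X _ _ τ hτ
  by_cases hS : Subsingleton (Fn S)
  · have h1 : IsEmpty S.sch := isEmpty_of_subsingleton
    have h2 : IsEmpty X.sch := ⟨fun x => h1.elim (sch τ x)⟩
    show _ ∣ R.cls X _
    rw [R.cls_of_isEmpty h2]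
    exact dvd_zero _
  have hS' : Nontrivial (Fn S) := not_subsingleton_iff_nontrivial.1 hS
  -- Over `V(f)` the hypothesis applies, so only the part over `D(f)` has to be treated.
  have key (f : Fn S) (hf : f ≠ 0) {XU : SchC} [IsAffine XU.sch] {aU : XU ⟶ X}
      {bU : XU ⟶ basicSub S f} (hU : IsPullback aU bU τ (basicSub.ι S f))
      (hd : R.groupClass hG ∣ R.clsA XU) : R.groupClass hG ∣ R.clsA X := by
    obtain ⟨Z, i, _, hi, hi'⟩ := exists_closedSub (X := S) (Ideal.span {f})
    obtain ⟨XZ, aZ, bZ, hZ⟩ := exists_isPullback τ i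
    have := isAffine_of_isPullback hZ
    simp only [Ideal.mem_span_singleton] at hi'
    rw [R.clsA_eq_add_of_isPullback hi inferInstance f hi' (basicSub.range_ι f) hZ hU]
    exact dvd_add ((h Z i hi ⟨f, hf, (hi' f).2 dvd_rfl⟩).dvd_of_isPullback hτ hZ) hd
  by_cases hD : IsDomain (Fn S)
  · obtain ⟨f, hf, hf'⟩ := exists_section_or_comp_eq_zero hG hs hτ
    obtain ⟨XU, aU, bU, hU⟩ := exists_isPullback τ (basicSub.ι S f)
    have := isAffine_of_isPullback hU
    refine key f hf hU ?_
    rcases hf' with hf' | ⟨t, ht⟩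
    · have h1 : IsUnit (Fn.comp bU (Fn.comp (basicSub.ι S f) f)) := (basicSub.isUnit f).map _
      rw [Fn.comp_comp, ← hU.w, ← Fn.comp_comp, hf', map_zero, isUnit_zero_iff] at h1
      have h2 := subsingleton_of_zero_eq_one h1
      show _ ∣ R.cls XU _
      rw [R.cls_of_isEmpty isEmpty_of_subsingleton]
      exact dvd_zero _
    · obtain ⟨_, hU'⟩ := exists_modObj_of_isPullback hτ hU
      exact R.groupClass_dvd_of_section hG hU' (hU.lift t (𝟙 _) (by rw [ht, Category.id_comp]))
        (hU.lift_snd _ _ _)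
  · obtain ⟨a, b, hab, ha, hb⟩ : ∃ a b : Fn S, a * b = 0 ∧ a ≠ 0 ∧ b ≠ 0 := by
      by_contra hc
      push Not at hc
      have : NoZeroDivisors (Fn S) := ⟨fun {a b} hab => by
        by_cases ha : a = 0
        · exact .inl ha
        · exact .inr (hc a b hab ha)⟩
      exact hD (NoZeroDivisors.to_isDomain _)
    obtain ⟨XU, aU, bU, hU⟩ := exists_isPullback τ (basicSub.ι S a)
    have := isAffine_of_isPullback hU
    refine key a ha hU ?_
    obtain ⟨Z, i, _, hi, hi'⟩ := exists_closedSub (X := S) (Ideal.span {b})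
    simp only [Ideal.mem_span_singleton] at hi'
    have hib : Fn.comp i b = 0 := (hi' b).2 dvd_rfl
    obtain ⟨XZ, aZ, bZ, hZ⟩ := exists_isPullback τ i
    have := isAffine_of_isPullback hZ
    have h1 : R.groupClass hG ∣ R.clsA XZ :=
      (h Z i hi ⟨b, hb, hib⟩).dvd_of_isPullback hτ hZ
    -- Where `a` is invertible, `ab = 0` forces `b = 0`; hence `D(a)` factors through `V(b)`.
    obtain ⟨j, hj⟩ := exists_lift_of_surjective hi (basicSub.ι S a) (fun g hg => by
      obtain ⟨c, rfl⟩ := (hi' g).1 hg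
      have h2 : Fn.comp (basicSub.ι S a) b = 0 :=
        (basicSub.isUnit a).mul_right_eq_zero.1 (by rw [← map_mul, hab, map_zero])
      rw [map_mul, h2, zero_mul])
    have hmono := mono_of_surjective hi
    have hjp := isPullback_id_of_comp_eq j _ i hj
    have hjo := isOpenImmersion_of_isPullback hjp.flip inferInstance
    have hjr : Set.range (sch j) = Z.sch.basicOpen (Fn.comp i a) := by
      rw [range_of_isPullback hjp.flip, basicSub.range_ι]
      exact congrArg (fun U : Z.sch.Opens => (U : Set Z.sch))
        (Scheme.preimage_basicOpen_top (sch i) a)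
    obtain ⟨V, k, _, hk, hk'⟩ := exists_closedSub (X := Z) (Ideal.span {Fn.comp i a})
    simp only [Ideal.mem_span_singleton] at hk'
    obtain ⟨XV, aV, bV, hV⟩ := exists_isPullback bZ k
    have := isAffine_of_isPullback hV
    have h2 : R.groupClass hG ∣ R.clsA XV := by
      refine (h V (k ≫ i) ?_ ⟨b, hb, ?_⟩).dvd_of_isPullback hτ (hV.paste_horiz hZ)
      · intro g
        obtain ⟨g, rfl⟩ := hk g
        obtain ⟨g, rfl⟩ := hi g
        exact ⟨g, by rw [← Fn.comp_comp]⟩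
      · rw [← Fn.comp_comp, hib, map_zero]
    have hUZ : ∃ c : XU ⟶ XZ, IsPullback c bU bZ j := by
      refine ⟨hZ.lift aU (bU ≫ j) (by rw [Category.assoc, hj, hU.w]), ?_⟩
      refine IsPullback.of_right ?_ (hZ.lift_snd _ _ _) hZ
      rwa [hZ.lift_fst, hj]
    obtain ⟨c, hc⟩ := hUZ
    have h3 := R.clsA_eq_add_of_isPullback hk hjo (Fn.comp i a) hk' hjr hV hc
    rw [h3] at h1
    exact (dvd_add_right h2).1 h1

/-- The class of a torsor for a special group is a multiple of the class of the group. -/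
lemma MotivicTheory.torsorDvd (hs : IsSpecial G) (S : SchC) [IsAffine S.sch] :
    R.TorsorDvd hG S := by
  -- The closed subschemes of the fixed `S` are indexed by their ideals, so that a proper closed
  -- subscheme has a strictly larger ideal.
  suffices H : ∀ I : Ideal (Fn S), ∀ (Z : SchC) [IsAffine Z.sch] (k : Z ⟶ S),
      Function.Surjective (Fn.comp k) → RingHom.ker (Fn.comp k) = I → R.TorsorDvd hG Z from
    H _ S (𝟙 S) (fun f => ⟨f, Fn.comp_id f⟩) rfl
  have hno : IsNoetherianRing (Fn S) := Algebra.FiniteType.isNoetherianRing ℂ (Fn S)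
  intro I
  induction I using IsNoetherian.induction with
  | hgt I ih =>
    intro Z _ k hk hI
    refine .of_closed hs fun V _ i hi ⟨f, hf, hf'⟩ => ?_
    obtain ⟨g, rfl⟩ := hk f
    refine ih (RingHom.ker (Fn.comp (i ≫ k))) ?_ V (i ≫ k) ?_ rfl
    · rw [gt_iff_lt, ← hI]
      refine lt_of_le_of_ne (fun x hx => ?_) (fun he => hf ?_)
      · rw [RingHom.mem_ker] at hx ⊢
        rw [← Fn.comp_comp, hx, map_zero]
      · have h1 : g ∈ RingHom.ker (Fn.comp (i ≫ k)) := by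
          rw [RingHom.mem_ker, ← Fn.comp_comp, hf']
        rwa [← he] at h1
    · intro g
      obtain ⟨g, rfl⟩ := hi g
      obtain ⟨g, rfl⟩ := hk g
      exact ⟨g, by rw [← Fn.comp_comp]⟩

end TorsorClass

/-! ### Classes of functors of points. -/

section Representability

/-- The affine scheme `X` with the functions `x s` represents the tuples of functions
that satisfy the condition `C`. -/
structure IsRep {σ : Type} (C : ∀ (A : Type) [CommRing A], (σ → A) → Prop) (X : SchC)
    (x : σ → Fn X) : Prop where
  mem : ∀ {T : SchC} (u : T ⟶ X), C (Fn T) fun s => Fn.comp u (x s)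
  exists_hom : ∀ {T : SchC} (v : σ → Fn T), C (Fn T) v →
    ∃ u : T ⟶ X, ∀ s, Fn.comp u (x s) = v s
  hom_ext : ∀ {T : SchC} {u u' : T ⟶ X}, (∀ s, Fn.comp u (x s) = Fn.comp u' (x s)) → u = u'

lemma IsRep.mem_self {σ : Type} {C : ∀ (A : Type) [CommRing A], (σ → A) → Prop} {X : SchC}
    {x : σ → Fn X} (h : IsRep C X x) : C (Fn X) x := by
  have := h.mem (𝟙 X)
  simpa only [Fn.comp_id] using this

variable (R : MotivicTheory.{w})

/-- The tuples of functions that satisfy the condition `C` are represented by an affine scheme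
with class `c`. -/
def MotivicTheory.HasClass {σ : Type} (C : ∀ (A : Type) [CommRing A], (σ → A) → Prop)
    (c : R.obj (𝟙_ SchC)) : Prop :=
  ∃ (X : SchC) (_ : IsAffine X.sch) (x : σ → Fn X), IsRep C X x ∧ R.clsA X = c

variable {R} {σ τ : Type} {C C' : ∀ (A : Type) [CommRing A], (σ → A) → Prop}
  {D : ∀ (A : Type) [CommRing A], (τ → A) → Prop} {c d : R.obj (𝟙_ SchC)}

namespace MotivicTheory.HasClass

/-- Naturality of `φ` suffices, since `ψ` is its inverse on solutions. It is required only on tuples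
that satisfy `C`, because formulas with `Ring.inverse` commute with ring homomorphisms only where
the argument is a unit. -/
lemma congr (hc : R.HasClass C c) (φ : ∀ (A : Type) [CommRing A], (σ → A) → τ → A)
    (ψ : ∀ (A : Type) [CommRing A], (τ → A) → σ → A)
    (hφ : ∀ (A B : Type) [CommRing A] [CommRing B] (f : A →+* B) (v : σ → A), C A v →
      φ B (fun s => f (v s)) = fun t => f (φ A v t))
    (h1 : ∀ (A : Type) [CommRing A] (v : σ → A), C A v → D A (φ A v) ∧ ψ A (φ A v) = v)
    (h2 : ∀ (A : Type) [CommRing A] (v : τ → A), D A v → C A (ψ A v) ∧ φ A (ψ A v) = v) :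
    R.HasClass D c := by
  obtain ⟨X, _, x, hx, rfl⟩ := hc
  have hu {T : SchC} (u : T ⟶ X) :
      (fun t => Fn.comp u (φ (Fn X) x t)) = φ (Fn T) (fun s => Fn.comp u (x s)) :=
    (hφ _ _ (Fn.comp u) x hx.mem_self).symm
  refine ⟨X, inferInstance, φ (Fn X) x, ⟨fun u => ?_, fun v hv => ?_, fun {T u u'} h => ?_⟩, rfl⟩
  · rw [hu]
    exact (h1 _ _ (hx.mem u)).1
  · obtain ⟨u, hu'⟩ := hx.exists_hom _ (h2 _ v hv).1
    refine ⟨u, fun s => ?_⟩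
    refine (congrFun (hu u) s).trans ?_
    rw [funext hu', (h2 _ v hv).2]
  · refine hx.hom_ext fun s => ?_
    have h3 := (hu u).symm.trans ((funext h).trans (hu u'))
    have h4 := congrArg (ψ _) h3
    rw [(h1 _ _ (hx.mem u)).2, (h1 _ _ (hx.mem u')).2] at h4
    exact congrFun h4 s

lemma congr_iff (hc : R.HasClass C c)
    (h : ∀ (A : Type) [CommRing A] (v : σ → A), C A v ↔ C' A v) : R.HasClass C' c :=
  hc.congr (fun _ _ v => v) (fun _ _ v => v) (fun _ _ _ _ _ _ _ => rfl)
    (fun A _ v hv => ⟨(h A v).1 hv, rfl⟩) (fun A _ v hv => ⟨(h A v).2 hv, rfl⟩)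

lemma unique (hc : R.HasClass C c) (hd : R.HasClass C d) : c = d := by
  obtain ⟨X, _, x, hx, rfl⟩ := hc
  obtain ⟨Y, _, y, hy, rfl⟩ := hd
  obtain ⟨u, hu⟩ := hy.exists_hom x hx.mem_self
  obtain ⟨v, hv⟩ := hx.exists_hom y hy.mem_self
  have h : IsIso u := by
    refine ⟨v, hx.hom_ext fun s => ?_, hy.hom_ext fun s => ?_⟩
    · rw [← Fn.comp_comp, hv, hu, Fn.comp_id]
    · rw [← Fn.comp_comp, hu, hv, Fn.comp_id]
  exact R.cls_congr u _ _

lemma eq_zero (hc : R.HasClass C c)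
    (h : ∀ (A : Type) [CommRing A] (v : σ → A), C A v → Subsingleton A) : c = 0 := by
  obtain ⟨X, _, x, hx, rfl⟩ := hc
  have := h _ _ hx.mem_self
  exact R.cls_of_isEmpty isEmpty_of_subsingleton _

/-- The motivic relation in terms of functors of points. The open stratum is the locus where `F` is
a unit, not merely nonzero. -/
lemma split (hc : R.HasClass C c) (F : ∀ (A : Type) [CommRing A], (σ → A) → A)
    (hF : ∀ (A B : Type) [CommRing A] [CommRing B] (f : A →+* B) (v : σ → A),
      F B (fun s => f (v s)) = f (F A v)) :
    ∃ a b, R.HasClass (fun A _ v => C A v ∧ F A v = 0) a ∧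
      R.HasClass (fun A _ v => C A v ∧ IsUnit (F A v)) b ∧ c = a + b := by
  obtain ⟨X, _, x, hx, rfl⟩ := hc
  have hu {T : SchC} (u : T ⟶ X) : F (Fn T) (fun s => Fn.comp u (x s)) = Fn.comp u (F (Fn X) x) :=
    hF _ _ (Fn.comp u) x
  obtain ⟨Z, i, _, hi, hi'⟩ := exists_closedSub (X := X) (Ideal.span {F (Fn X) x})
  simp only [Ideal.mem_span_singleton] at hi'
  let j := basicSub.ι X (F (Fn X) x)
  refine ⟨_, _, ⟨Z, inferInstance, fun s => Fn.comp i (x s), ⟨fun u => ?_, fun v hv => ?_,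
    fun {T u u'} h => ?_⟩, rfl⟩, ⟨basicSub X (F (Fn X) x), inferInstance,
    fun s => Fn.comp j (x s), ⟨fun u => ?_, fun v hv => ?_, fun {T u u'} h => ?_⟩, rfl⟩,
    R.clsA_eq_add i j hi inferInstance _ hi' (basicSub.range_ι _)⟩
  · simp only [Fn.comp_comp]
    refine ⟨hx.mem _, ?_⟩
    rw [hu, ← Fn.comp_comp, (hi' _).2 dvd_rfl, map_zero]
  · obtain ⟨u, hu'⟩ := hx.exists_hom v hv.1
    obtain ⟨t, ht⟩ := exists_lift_of_surjective hi u (fun f hf => by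
      obtain ⟨g, rfl⟩ := (hi' f).1 hf
      rw [map_mul, ← hu, funext hu', hv.2, zero_mul])
    exact ⟨t, fun s => by rw [Fn.comp_comp, ht, hu']⟩
  · have := mono_of_surjective hi
    rw [← cancel_mono i]
    exact hx.hom_ext fun s => by rw [← Fn.comp_comp, h, Fn.comp_comp]
  · simp only [Fn.comp_comp]
    refine ⟨hx.mem _, ?_⟩
    rw [hu, ← Fn.comp_comp]
    exact (basicSub.isUnit _).map _
  · obtain ⟨u, hu'⟩ := hx.exists_hom v hv.1
    obtain ⟨t, ht⟩ := basicSub.exists_lift (F (Fn X) x) u (by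
      rw [← hu, funext hu']
      exact hv.2)
    exact ⟨t, fun s => by rw [Fn.comp_comp, ht, hu']⟩
  · rw [← cancel_mono j]
    exact hx.hom_ext fun s => by rw [← Fn.comp_comp, h, Fn.comp_comp]

lemma prod (hc : R.HasClass C c) (hd : R.HasClass D d) :
    R.HasClass (σ := σ ⊕ τ) (fun A _ v => C A (fun s => v (.inl s)) ∧ D A (fun t => v (.inr t)))
      (c * d) := by
  obtain ⟨X, _, x, hx, rfl⟩ := hc
  obtain ⟨Y, _, y, hy, rfl⟩ := hd
  refine ⟨X ⊗ Y, inferInstance, Sum.elim (fun s => Fn.comp (fst X Y) (x s))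
    (fun t => Fn.comp (snd X Y) (y t)), ⟨fun u => ?_, fun v hv => ?_, fun {T u u'} h => ?_⟩,
    R.cls_prod _ _ _⟩
  · simp only [Sum.elim_inl, Sum.elim_inr, Fn.comp_comp]
    exact ⟨hx.mem _, hy.mem _⟩
  · obtain ⟨u, hu⟩ := hx.exists_hom _ hv.1
    obtain ⟨u', hu'⟩ := hy.exists_hom _ hv.2
    refine ⟨lift u u', ?_⟩
    rintro (s | t)
    · rw [Sum.elim_inl, Fn.comp_comp, lift_fst, hu]
    · rw [Sum.elim_inr, Fn.comp_comp, lift_snd, hu']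
  · apply CartesianMonoidalCategory.hom_ext
    · refine hx.hom_ext fun s => ?_
      have := h (.inl s)
      rwa [Sum.elim_inl, Fn.comp_comp, Fn.comp_comp] at this
    · refine hy.hom_ext fun s => ?_
      have := h (.inr s)
      rwa [Sum.elim_inr, Fn.comp_comp, Fn.comp_comp] at this

variable (R) in
lemma point (σ : Type) : R.HasClass (σ := σ) (fun _ _ v => v = 0) 1 := by
  have : IsAffine (𝟙_ SchC).sch := inferInstanceAs (IsAffine (Spec _))
  refine ⟨𝟙_ SchC, inferInstance, 0, ⟨fun u => ?_, fun v hv => ⟨toUnit _, fun s => ?_⟩,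
    fun {T u u'} h => toUnit_unique _ _⟩, ?_⟩
  · funext s
    exact map_zero _
  · rw [hv, Pi.zero_apply, Pi.zero_apply, map_zero]
  · show R.push _ _ (R.pull _ R.one) = R.one
    have : IsIso (toUnit (𝟙_ SchC)) := by
      rw [toUnit_unique (toUnit _) (𝟙 _)]; infer_instance
    rw [R.push_pull_of_isIso]

variable (R) in
lemma line : R.HasClass (σ := Unit) (fun _ _ _ => True) R.lefschetz := by
  have e : Polynomial ℂ ≃ₐ[ℂ] Fn affineLine := (fnSpc (Polynomial ℂ)).symm
  refine ⟨affineLine, inferInstance, fun _ => e Polynomial.X, ⟨fun u => trivial, fun v _ => ?_,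
    fun {T u u'} h => hom_ext_of_isAffine fun f => ?_⟩, rfl⟩
  · obtain ⟨u, hu⟩ := exists_hom_of_algHom (X := _) (Y := affineLine)
      ((Polynomial.aeval (v ())).comp e.symm.toAlgHom)
    refine ⟨u, fun _ => ?_⟩
    rw [← Fn.compₐ_apply, hu]
    simp
  · obtain ⟨f, rfl⟩ := e.surjective f
    have h1 : (Fn.compₐ u).comp e.toAlgHom = (Fn.compₐ u').comp e.toAlgHom :=
      Polynomial.algHom_ext (h ())
    exact congrArg (fun g => g f) h1

end MotivicTheory.HasClass

end Representability

/-! ### The class of the general linear group. -/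

section GeneralLinear

lemma map_ringInverse_of_isUnit {A B : Type} [CommRing A] [CommRing B] (f : A →+* B) {a : A}
    (ha : IsUnit a) : f (Ring.inverse a) = Ring.inverse (f a) := by
  obtain ⟨u, rfl⟩ := ha
  rw [Ring.inverse_unit]
  exact (Ring.inverse_unit (Units.map (f : A →* B) u)).symm

/-- The condition that the entries form an invertible matrix. -/
def glCond (n : ℕ) (A : Type) [CommRing A] (v : Fin n × Fin n → A) : Prop :=
  IsUnit (Matrix.of (Function.curry v)).det

variable {R : MotivicTheory.{w}}

namespace MotivicTheory.HasClass

variable (R) in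
-- A flag of coordinate subspaces with one fixed index type `Fin n`, so that `pivot` can take
-- differences of consecutive members.
lemma vanish_from (n k : ℕ) (hk : k ≤ n) :
    R.HasClass (σ := Fin n) (fun _ _ v => ∀ i : Fin n, k ≤ i.1 → v i = 0) (R.lefschetz ^ k) := by
  induction k with
  | zero =>
    rw [pow_zero]
    exact (point R (Fin n)).congr_iff fun A _ v =>
      ⟨fun h i _ => congrFun h i, fun h => funext fun i => h i (Nat.zero_le _)⟩
  | succ k ih =>
    rw [pow_succ]
    let k' : Fin n := ⟨k, hk⟩
    refine ((ih (Nat.le_of_succ_le hk)).prod (line R)).congr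
      (fun A _ v => Function.update (fun i => v (.inl i)) k' (v (.inr ())))
      (fun A _ v => Sum.elim (Function.update v k' 0) (fun _ => v k')) ?_ ?_ ?_
    · intro A B _ _ f v _
      funext i
      by_cases hi : i = k'
      · subst hi; simp
      · simp [hi]
    · intro A _ v hv
      have h1 : v (.inl k') = 0 := hv.1 k' le_rfl
      refine ⟨fun i hi => ?_, ?_⟩
      · have : i ≠ k' := by rintro rfl; exact absurd hi (by simp [k'])
        rw [Function.update_of_ne this]
        exact hv.1 i (Nat.le_of_succ_le hi)
      · funext s
        rcases s with i | _
        · by_cases hi : i = k'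
          · subst hi; simp [h1]
          · simp [hi]
        · simp
    · intro A _ v hv
      refine ⟨⟨fun i hi => ?_, trivial⟩, ?_⟩
      · show Function.update v k' 0 i = 0
        by_cases hi' : i = k'
        · subst hi'; simp
        · rw [Function.update_of_ne hi']
          exact hv i (lt_of_le_of_ne hi fun h => hi' (Fin.ext h.symm))
      · simp

variable (R) in
lemma affineSpace (n : ℕ) : R.HasClass (σ := Fin n) (fun _ _ _ => True) (R.lefschetz ^ n) :=
  (vanish_from R n n le_rfl).congr_iff fun _ _ _ =>
    ⟨fun _ => trivial, fun _ i hi => absurd i.2 (not_lt.2 hi)⟩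

/-- Reindexing of coordinates. -/
lemma reindex {σ τ : Type} {C : ∀ (A : Type) [CommRing A], (σ → A) → Prop}
    {c : R.obj (𝟙_ SchC)} (h : R.HasClass C c) (e : τ ≃ σ) :
    R.HasClass (fun A _ v => C A (v ∘ e.symm)) c :=
  h.congr (fun _ _ v => v ∘ e) (fun _ _ v => v ∘ e.symm) (fun _ _ _ _ _ _ _ => rfl)
    (fun A _ v hv => by
      have : (v ∘ e) ∘ e.symm = v := by funext s; simp
      rw [this]; exact ⟨hv, rfl⟩)
    (fun A _ v hv => ⟨hv, by funext s; simp⟩)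

variable (R) in
lemma exists_gl (n : ℕ) : ∃ c, R.HasClass (glCond n) c := by
  obtain ⟨_, b, _, hb, _⟩ := ((affineSpace R (n * n)).reindex (finProdFinEquiv (m := n))).split
    (fun A _ v => (Matrix.of (Function.curry v)).det)
    (fun A B _ _ f v => by
      rw [RingHom.map_det]; rfl)
  exact ⟨b, hb.congr_iff fun A _ v => and_iff_right trivial⟩

variable (R) in
lemma pivot (n k : ℕ) (hk : k < n) :
    R.HasClass (σ := Fin n) (fun _ _ v => (∀ i : Fin n, k < i.1 → v i = 0) ∧ IsUnit (v ⟨k, hk⟩))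
      (R.lefschetz ^ (k + 1) - R.lefschetz ^ k) := by
  obtain ⟨a, b, ha, hb, hab⟩ := (vanish_from R n (k + 1) hk).split (fun A _ v => v ⟨k, hk⟩)
    (fun A B _ _ f v => rfl)
  have ha' : a = R.lefschetz ^ k := (ha.congr_iff fun A _ v => by
    refine ⟨fun h i hi => ?_, fun h => ⟨fun i hi => h i (Nat.le_of_succ_le hi), h _ le_rfl⟩⟩
    rcases hi.eq_or_lt with hi | hi
    · have : i = ⟨k, hk⟩ := Fin.ext hi.symm
      rw [this]; exact h.2
    · exact h.1 i hi).unique (vanish_from R n k hk.le)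
  rw [hab, ha', add_sub_cancel_left]
  exact hb

end MotivicTheory.HasClass

/-! ### Elimination of the first column. -/

section Schur

variable {A : Type} [CommRing A] {n : ℕ}

/-- The matrix after elimination of the first column with the pivot in row `k`. -/
def schur (k : Fin (n + 1)) (M : Matrix (Fin (n + 1)) (Fin (n + 1)) A) : Matrix (Fin n) (Fin n) A :=
  .of fun i j => M (k.succAbove i) j.succ -
    M (k.succAbove i) 0 * Ring.inverse (M k 0) * M k j.succ

/-- Subtracting multiples of row `k` clears the other entries of the first column without changing
the determinant. Expansion along that column leaves one term, with the sign of position `(k, 0)`. -/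
lemma det_eq_schur (k : Fin (n + 1)) (M : Matrix (Fin (n + 1)) (Fin (n + 1)) A)
    (hk : IsUnit (M k 0)) : M.det = (-1) ^ (k : ℕ) * M k 0 * (schur k M).det := by
  let c : Fin (n + 1) → A := fun i => if i = k then 0 else M i 0 * Ring.inverse (M k 0)
  let B : Matrix (Fin (n + 1)) (Fin (n + 1)) A := .of fun i j => M i j - c i * M k j
  have hck : c k = 0 := if_pos rfl
  have hBk (j : Fin (n + 1)) : B k j = M k j := by simp [B, hck]
  have h1 : M.det = B.det := Matrix.det_eq_of_forall_row_eq_smul_add_const c k hck fun i j => by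
    rw [hBk]; simp [B]
  have h2 (i : Fin (n + 1)) (hi : i ≠ k) : B i 0 = 0 := by
    simp only [B, Matrix.of_apply, c, if_neg hi]
    rw [mul_assoc, Ring.inverse_mul_cancel _ hk, mul_one, sub_self]
  rw [h1, Matrix.det_succ_column_zero, Finset.sum_eq_single k, hBk]
  · congr 2
    ext i j
    simp [schur, B, c, Fin.succAbove_ne]
  · intro i _ hi
    rw [h2 i hi]; simp
  · simp

/-- The coordinates of a matrix with pivot in row `k`: the first column, the row `k`, and the
matrix after elimination. -/
def schurCoord (k : Fin (n + 1)) (v : Fin (n + 1) × Fin (n + 1) → A) :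
    Fin (n + 1) ⊕ Fin n ⊕ Fin n × Fin n → A :=
  Sum.elim (fun i => v (i, 0)) (Sum.elim (fun j => v (k, j.succ))
    (fun p => schur k (Matrix.of (Function.curry v)) p.1 p.2))

/-- The matrix with given coordinates. -/
def ofSchurCoord (k : Fin (n + 1)) (v : Fin (n + 1) ⊕ Fin n ⊕ Fin n × Fin n → A)
    (p : Fin (n + 1) × Fin (n + 1)) : A :=
  k.insertNth (α := fun _ => Fin (n + 1) → A)
    (Fin.cons (v (.inl k)) fun j => v (.inr (.inl j)))
    (fun i => Fin.cons (v (.inl (k.succAbove i))) fun j => v (.inr (.inr (i, j))) +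
      v (.inl (k.succAbove i)) * Ring.inverse (v (.inl k)) * v (.inr (.inl j))) p.1 p.2

variable (k : Fin (n + 1)) (v : Fin (n + 1) ⊕ Fin n ⊕ Fin n × Fin n → A)

@[simp] lemma ofSchurCoord_zero (i : Fin (n + 1)) : ofSchurCoord k v (i, 0) = v (.inl i) := by
  induction i using k.succAboveCases <;> simp [ofSchurCoord]

@[simp] lemma ofSchurCoord_pivot_succ (j : Fin n) :
    ofSchurCoord k v (k, j.succ) = v (.inr (.inl j)) := by
  simp [ofSchurCoord]

@[simp] lemma ofSchurCoord_succAbove_succ (i j : Fin n) :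
    ofSchurCoord k v (k.succAbove i, j.succ) = v (.inr (.inr (i, j))) +
      v (.inl (k.succAbove i)) * Ring.inverse (v (.inl k)) * v (.inr (.inl j)) := by
  simp [ofSchurCoord]

lemma schurCoord_ofSchurCoord : schurCoord k (ofSchurCoord k v) = v := by
  funext s
  rcases s with i | j | ⟨i, j⟩ <;> simp [schurCoord, schur]

lemma ofSchurCoord_schurCoord (v : Fin (n + 1) × Fin (n + 1) → A) :
    ofSchurCoord k (schurCoord k v) = v := by
  funext ⟨i, j⟩
  induction j using Fin.cases with
  | zero => simp [schurCoord]
  | succ j => induction i using k.succAboveCases <;> simp [schurCoord, schur]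

end Schur

/-- Invertible matrices with vanishing first column from row `k` on. -/
def glColCond (n k : ℕ) (A : Type) [CommRing A] (v : Fin (n + 1) × Fin (n + 1) → A) : Prop :=
  glCond (n + 1) A v ∧ ∀ i : Fin (n + 1), k ≤ i.1 → v (i, 0) = 0

namespace MotivicTheory.HasClass

/-- Invertible matrices whose first column has its last non-zero entry, a unit, in row `k`. -/
lemma gl_pivot {n : ℕ} {g : R.obj (𝟙_ SchC)} (hg : R.HasClass (glCond n) g) (k : Fin (n + 1)) :
    R.HasClass (fun A _ v => glColCond n (k + 1) A v ∧ IsUnit (v (k, 0)))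
      ((R.lefschetz ^ ((k : ℕ) + 1) - R.lefschetz ^ (k : ℕ)) * (R.lefschetz ^ n * g)) := by
  have hdet (A : Type) [CommRing A] (v : Fin (n + 1) × Fin (n + 1) → A) (hv : IsUnit (v (k, 0))) :
      glCond (n + 1) A v ↔ IsUnit (schur k (Matrix.of (Function.curry v))).det := by
    have h1 := det_eq_schur k (Matrix.of (Function.curry v)) hv
    have h2 : IsUnit ((-1) ^ (k : ℕ) * Matrix.of (Function.curry v) k 0) :=
      ((isUnit_one.neg).pow _).mul hv
    rw [glCond, h1, IsUnit.mul_iff]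
    exact and_iff_right h2
  -- The three factors parametrize the first column, the rest of the pivot row, and the Schur
  -- complement, which is invertible exactly when the whole matrix is.
  refine ((pivot R (n + 1) k k.2).prod ((affineSpace R n).prod hg)).congr
    (fun A _ v => ofSchurCoord k v) (fun A _ v => schurCoord k v) ?_ ?_ ?_
  · intro A B _ _ f v hv
    funext ⟨i, j⟩
    induction j using Fin.cases with
    | zero => simp
    | succ j =>
      induction i using k.succAboveCases with
      | x => simp
      | p i =>
        simp only [ofSchurCoord_succAbove_succ, map_add, map_mul]
        rw [map_ringInverse_of_isUnit f hv.1.2]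
  · intro A _ v hv
    have h1 : IsUnit (ofSchurCoord k v (k, 0)) := by simpa using hv.1.2
    refine ⟨⟨⟨(hdet A _ h1).2 ?_, fun i hi => ?_⟩, h1⟩, schurCoord_ofSchurCoord k v⟩
    · have h2 : schur k (Matrix.of (Function.curry (ofSchurCoord k v))) =
          Matrix.of (Function.curry fun p => v (.inr (.inr p))) := by
        ext i j
        exact congrFun (schurCoord_ofSchurCoord k v) (.inr (.inr (i, j)))
      rw [h2]
      exact hv.2.2
    · rw [ofSchurCoord_zero]
      exact hv.1.1 i hi
  · intro A _ v hv
    exact ⟨⟨⟨fun i hi => hv.1.2 i hi, hv.2⟩, trivial, (hdet A v hv.2).1 hv.1.1⟩,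
      ofSchurCoord_schurCoord k v⟩

/-- Stratify by the row `k` of the last nonzero entry of the first column. The strata contribute
`(𝕃^(k+1) - 𝕃^k) 𝕃^n g`, and the sum over `k` telescopes. -/
lemma gl_succ {n : ℕ} {g : R.obj (𝟙_ SchC)} (hg : R.HasClass (glCond n) g) :
    R.HasClass (glCond (n + 1)) ((R.lefschetz ^ (n + 1) - 1) * (R.lefschetz ^ n * g)) := by
  obtain ⟨c, hc⟩ := exists_gl R (n + 1)
  -- After `k` cuts from the bottom, the remaining locus has its last `k` entries of the first
  -- column equal to zero, and the removed strata have already telescoped.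
  have h (k : ℕ) (hk : k ≤ n + 1) : ∃ d, R.HasClass (glColCond n (n + 1 - k)) d ∧
      c = d + (R.lefschetz ^ (n + 1) - R.lefschetz ^ (n + 1 - k)) * (R.lefschetz ^ n * g) := by
    induction k with
    | zero =>
      refine ⟨c, hc.congr_iff fun A _ v => ⟨fun h => ⟨h, fun i hi => ?_⟩, fun h => h.1⟩, by simp⟩
      exact absurd i.2 (not_lt.2 hi)
    | succ k ih =>
      obtain ⟨d, hd, hcd⟩ := ih (Nat.le_of_succ_le hk)
      obtain ⟨l, hl⟩ : ∃ l, n + 1 - k = l + 1 := ⟨n - k, by omega⟩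
      have hl' : n + 1 - (k + 1) = l := by omega
      rw [hl] at hd hcd
      let l' : Fin (n + 1) := ⟨l, by omega⟩
      obtain ⟨a, b, ha, hb, hab⟩ := hd.split (fun A _ v => v (l', 0)) (fun A B _ _ f v => rfl)
      rw [hl']
      refine ⟨a, ha.congr_iff fun A _ v => ⟨fun h => ⟨h.1.1, fun i hi => ?_⟩,
        fun h => ⟨⟨h.1, fun i hi => h.2 i (Nat.le_of_succ_le hi)⟩, h.2 _ le_rfl⟩⟩, ?_⟩
      · rcases hi.eq_or_lt with hi | hi
        · have : i = l' := Fin.ext hi.symm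
          rw [this]; exact h.2
        · exact h.1.2 i hi
      · rw [hcd, hab, hb.unique (gl_pivot hg l')]
        ring
  obtain ⟨d, hd, hcd⟩ := h (n + 1) le_rfl
  -- When the whole first column vanishes, the determinant is both zero and a unit, so nothing
  -- remains.
  have hd0 : d = 0 := hd.eq_zero fun A _ v hv => by
    have h1 : (Matrix.of (Function.curry v)).det = 0 :=
      Matrix.det_eq_zero_of_column_eq_zero 0 fun i => hv.2 i (by simp)
    have h2 : IsUnit (0 : A) := h1 ▸ hv.1
    exact subsingleton_of_zero_eq_one (isUnit_zero_iff.1 h2)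
  rw [hd0, zero_add, Nat.sub_self, pow_zero] at hcd
  rwa [hcd] at hc

/-- The class of `GL_n` is invertible. -/
lemma exists_gl_isUnit (hL : IsUnit R.lefschetz)
    (hLn : ∀ n : ℕ, 0 < n → IsUnit (R.lefschetz ^ n - 1)) (n : ℕ) :
    ∃ c, R.HasClass (glCond n) c ∧ IsUnit c := by
  induction n with
  | zero =>
    refine ⟨1, (point R _).congr_iff fun A _ v => ⟨fun _ => ?_, fun _ => ?_⟩, isUnit_one⟩
    · rw [glCond, Matrix.det_fin_zero]; exact isUnit_one
    · exact funext fun s => s.1.elim0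
  | succ n ih =>
    obtain ⟨g, hg, hg'⟩ := ih
    exact ⟨_, gl_succ hg, (hLn _ n.succ_pos).mul ((hL.pow n).mul hg')⟩

end MotivicTheory.HasClass

end GeneralLinear

/-! ### Linear forms applied to one variable. -/

section Slices

open scoped TensorProduct

variable {X Y Z : SchC} [IsAffine X.sch] [IsAffine Y.sch] [IsAffine Z.sch]

/-- The functions on a product of affine schemes. -/
def Fn.prodEquiv (X Y : SchC) [IsAffine X.sch] [IsAffine Y.sch] :
    (Fn X ⊗[ℂ] Fn Y) ≃ₐ[ℂ] Fn (X ⊗ Y) :=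
  AlgEquiv.ofBijective (Fn.prodHom X Y) (Fn.prodHom_bijective X Y)

lemma Fn.prod_induction {p : Fn (X ⊗ Y) → Prop} (f : Fn (X ⊗ Y)) (h0 : p 0)
    (hm : ∀ a b, p (Fn.comp (fst X Y) a * Fn.comp (snd X Y) b))
    (ha : ∀ f g, p f → p g → p (f + g)) : p f := by
  obtain ⟨t, rfl⟩ := (Fn.prodEquiv X Y).surjective f
  induction t with
  | zero => rwa [map_zero]
  | tmul a b =>
    have := hm a b
    rwa [← Fn.prodHom_tmul] at this
  | add s t hs ht => rw [map_add]; exact ha _ _ hs ht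

/-- The application of a linear form to the second variable of a function on a product. -/
def Fn.slice (l : Fn Y →ₗ[ℂ] ℂ) : Fn (X ⊗ Y) →ₗ[ℂ] Fn X :=
  (TensorProduct.rid ℂ (Fn X)).toLinearMap ∘ₗ l.lTensor (Fn X) ∘ₗ
    (Fn.prodEquiv X Y).symm.toLinearMap

lemma Fn.slice_mul (l : Fn Y →ₗ[ℂ] ℂ) (a : Fn X) (b : Fn Y) :
    Fn.slice l (Fn.comp (fst X Y) a * Fn.comp (snd X Y) b) = l b • a := by
  rw [← Fn.prodHom_tmul]
  have h : (Fn.prodEquiv X Y).symm (Fn.prodHom X Y (a ⊗ₜ b)) = a ⊗ₜ b :=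
    (Fn.prodEquiv X Y).symm_apply_apply (a ⊗ₜ b)
  show (TensorProduct.rid ℂ (Fn X)) (l.lTensor (Fn X) ((Fn.prodEquiv X Y).symm _)) = _
  rw [h]
  simp

lemma Fn.slice_snd (l : Fn Y →ₗ[ℂ] ℂ) (b : Fn Y) :
    Fn.slice l (Fn.comp (snd X Y) b) = l b • (1 : Fn X) := by
  rw [← Fn.slice_mul, map_one, one_mul]

lemma Fn.slice_fst_mul (l : Fn Y →ₗ[ℂ] ℂ) (a : Fn X) (f : Fn (X ⊗ Y)) :
    Fn.slice l (Fn.comp (fst X Y) a * f) = a * Fn.slice l f := by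
  induction f using Fn.prod_induction with
  | h0 => simp
  | hm b c => rw [← mul_assoc, ← map_mul, Fn.slice_mul, Fn.slice_mul, mul_smul_comm]
  | ha f g hf hg => rw [mul_add, map_add, map_add, hf, hg, mul_add]

lemma Fn.comp_slice (l : Fn Y →ₗ[ℂ] ℂ) (u : Z ⟶ X) (f : Fn (X ⊗ Y)) :
    Fn.comp u (Fn.slice l f) = Fn.slice l (Fn.comp (u ▷ Y) f) := by
  induction f using Fn.prod_induction with
  | h0 => simp
  | hm b c =>
    rw [map_mul (Fn.comp (u ▷ Y)), Fn.comp_comp, Fn.comp_comp, whiskerRight_fst, whiskerRight_snd, ← Fn.comp_comp,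
      Fn.slice_mul, Fn.slice_mul]
    exact map_smul (Fn.compₐ u) _ _
  | ha f g hf hg => simp only [map_add, hf, hg]

/-- Comparison of coefficients: the dual forms `l i`, applied in the second variable, extract the
coefficients. -/
lemma Fn.eq_of_sum_eq {J : Type} [Fintype J] [DecidableEq J] (b : J → Fn Y) (l : J → Fn Y →ₗ[ℂ] ℂ)
    (hl : ∀ i j, l i (b j) = if i = j then 1 else 0) {s s' : J → Fn X}
    (h : ∑ j, Fn.comp (fst X Y) (s j) * Fn.comp (snd X Y) (b j) =
      ∑ j, Fn.comp (fst X Y) (s' j) * Fn.comp (snd X Y) (b j)) : s = s' := by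
  funext i
  have h1 := congrArg (Fn.slice (l i)) h
  simpa [map_sum, Fn.slice_mul, hl] using h1

/-- The expansion is given for all larger index sets so that finitely many functions can be expanded
over a common one. -/
lemma Fn.exists_expansion {K : Type} (e : Module.Basis K ℂ (Fn Y)) (f : Fn (X ⊗ Y)) :
    ∃ s : Finset K, ∀ s', s ⊆ s' → f = ∑ k ∈ s', Fn.comp (fst X Y) (Fn.slice (e.coord k) f) *
      Fn.comp (snd X Y) (e k) := by
  classical
  induction f using Fn.prod_induction with
  | h0 => exact ⟨∅, fun s' _ => by simp⟩
  | hm a b =>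
    refine ⟨(e.repr b).support, fun s' hs' => ?_⟩
    have h1 : b = ∑ k ∈ s', e.repr b k • e k := by
      conv_lhs => rw [← e.linearCombination_repr b]
      rw [Finsupp.linearCombination_apply, Finsupp.sum]
      refine Finset.sum_subset hs' fun k _ hk => ?_
      rw [Finsupp.notMem_support_iff.1 hk, zero_smul]
    conv_lhs => rw [h1]
    rw [map_sum, Finset.mul_sum]
    refine Finset.sum_congr rfl fun k _ => ?_
    rw [Fn.slice_mul]
    have h2 : Fn.comp (snd X Y) (e.repr b k • e k) = e.repr b k • Fn.comp (snd X Y) (e k) :=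
      map_smul (Fn.compₐ (snd X Y)) _ _
    have h3 : Fn.comp (fst X Y) (e.coord k b • a) = e.repr b k • Fn.comp (fst X Y) a :=
      map_smul (Fn.compₐ (fst X Y)) _ _
    rw [h2, h3, smul_mul_assoc, mul_smul_comm]
  | ha f g hf hg =>
    obtain ⟨s, hs⟩ := hf
    obtain ⟨t, ht⟩ := hg
    refine ⟨s ∪ t, fun s' hs' => ?_⟩
    conv_lhs => rw [hs s' (Finset.union_subset_left hs'), ht s' (Finset.union_subset_right hs')]
    rw [← Finset.sum_add_distrib]
    exact Finset.sum_congr rfl fun k _ => by rw [map_add, map_add, add_mul]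

end Slices

/-! ### Translation-stable spaces of functions that define a subgroup. -/

section StableSubspace

lemma eq_sum_repr_smul {k M J : Type} [Field k] [AddCommGroup M] [Module k M] [Fintype J]
    {V : Submodule k M} (b : Module.Basis J k V) {v : M} (hv : v ∈ V) :
    v = ∑ j, b.repr ⟨v, hv⟩ j • (b j : M) := by
  have h := congrArg V.subtype (b.sum_repr ⟨v, hv⟩)
  rw [map_sum] at h
  exact h.symm

lemma Fn.exists_eq_algebraMap (f : Fn (𝟙_ SchC)) : ∃ c : ℂ, f = algebraMap ℂ _ c := by
  let e := (Scheme.ΓSpecIso (CommRingCat.of ℂ)).symm.commRingCatIsoToRingEquiv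
  obtain ⟨c, hc⟩ := e.surjective f
  refine ⟨c, ?_⟩
  have h : toUnit (𝟙_ SchC) = 𝟙 _ := toUnit_unique _ _
  show f = Fn.comp (toUnit (𝟙_ SchC)) (e c)
  rw [h, Fn.comp_id, hc]

lemma Fn.exists_comp_one_eq {G T : SchC} [GrpObj G] (f : Fn G) :
    ∃ c : ℂ, Fn.comp (1 : T ⟶ G) f = algebraMap ℂ _ c := by
  obtain ⟨c, hc⟩ := Fn.exists_eq_algebraMap (Fn.comp (1 : 𝟙_ SchC ⟶ G) f)
  refine ⟨c, ?_⟩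
  rw [← MonObj.comp_one (toUnit T), ← Fn.comp_comp, hc, Fn.comp_const]

/-- The functions on `X × Y` in the span of the products of functions on `X` and elements
of `V`. -/
def Fn.boxSpan (X : SchC) {Y : SchC} (V : Submodule ℂ (Fn Y)) : Submodule ℂ (Fn (X ⊗ Y)) :=
  Submodule.span ℂ {f | ∃ a, ∃ b ∈ V, f = Fn.comp (fst X Y) a * Fn.comp (snd X Y) b}

lemma Fn.boxSpan_mono (X : SchC) {Y : SchC} {V W : Submodule ℂ (Fn Y)} (h : V ≤ W) :
    Fn.boxSpan X V ≤ Fn.boxSpan X W :=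
  Submodule.span_mono fun _ ⟨a, b, hb, hf⟩ => ⟨a, b, h hb, hf⟩

lemma Fn.exists_eq_sum_of_mem_boxSpan {X Y : SchC} {V : Submodule ℂ (Fn Y)} {J : Type} [Fintype J]
    (b : Module.Basis J ℂ V) {f : Fn (X ⊗ Y)} (hf : f ∈ Fn.boxSpan X V) :
    ∃ s : J → Fn X, f = ∑ j, Fn.comp (fst X Y) (s j) * Fn.comp (snd X Y) (b j : Fn Y) := by
  induction hf using Submodule.span_induction with
  | mem f hf =>
    obtain ⟨a, v, hv, rfl⟩ := hf
    refine ⟨fun j => b.repr ⟨v, hv⟩ j • a, ?_⟩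
    have h1 := eq_sum_repr_smul b hv
    conv_lhs => rw [h1]
    rw [map_sum, Finset.mul_sum]
    refine Finset.sum_congr rfl fun j _ => ?_
    have h2 : Fn.comp (snd X Y) (b.repr ⟨v, hv⟩ j • (b j : Fn Y)) =
        b.repr ⟨v, hv⟩ j • Fn.comp (snd X Y) (b j : Fn Y) := map_smul (Fn.compₐ (snd X Y)) _ _
    have h3 : Fn.comp (fst X Y) (b.repr ⟨v, hv⟩ j • a) =
        b.repr ⟨v, hv⟩ j • Fn.comp (fst X Y) a := map_smul (Fn.compₐ (fst X Y)) _ _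
    rw [h2, h3, smul_mul_assoc, mul_smul_comm]
  | zero => exact ⟨0, by simp⟩
  | add f g _ _ hf hg =>
    obtain ⟨s, rfl⟩ := hf
    obtain ⟨t, rfl⟩ := hg
    exact ⟨s + t, by simp [add_mul, Finset.sum_add_distrib]⟩
  | smul c f _ hf =>
    obtain ⟨s, rfl⟩ := hf
    refine ⟨c • s, ?_⟩
    rw [Finset.smul_sum]
    refine Finset.sum_congr rfl fun j _ => ?_
    have h3 : Fn.comp (fst X Y) (c • s j) = c • Fn.comp (fst X Y) (s j) :=
      map_smul (Fn.compₐ (fst X Y)) _ _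
    rw [Pi.smul_apply, h3, smul_mul_assoc]

variable {G H : SchC} [GrpObj H]

/-- The left translation `(g, x) ↦ m(g) x`. -/
abbrev leftTrans (m : G ⟶ H) : G ⊗ H ⟶ H := (fst G H ≫ m) * snd G H

lemma lift_leftTrans (m : G ⟶ H) {T : SchC} (g : T ⟶ G) (h : T ⟶ H) :
    lift g h ≫ leftTrans m = (g ≫ m) * h := by
  rw [MonObj.comp_mul, lift_fst_assoc, lift_snd]

variable [GrpObj G] [IsAffine G.sch] [IsAffine H.sch] {m : G ⟶ H} (hm : ∀ {T : SchC} (u v : T ⟶ G), (u * v) ≫ m = (u ≫ m) * (v ≫ m))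

include hm in
/-- A function that vanishes on a subgroup lies in a finite dimensional space of such functions
that is stable under left translations. -/
lemma exists_stable_of_comp_eq_zero (f : Fn H) (hf : Fn.comp m f = 0) :
    ∃ V : Submodule ℂ (Fn H), FiniteDimensional ℂ V ∧ f ∈ V ∧ (∀ v ∈ V, Fn.comp m v = 0) ∧
      ∀ v ∈ V, Fn.comp (leftTrans m) v ∈ Fn.boxSpan G V := by
  -- This is `(h, g) ↦ m(g) h`, with the variables ordered so that slices in `g` are functions of
  -- `h`. In `f(m(g) h) = ∑ b_k(h) e_k(g)` the `b_k` span the required space: `g = 1` recovers `f`,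
  -- and for `h` in the image of `m` the left side is zero, hence so are all `b_k` there.
  let rc : H ⊗ G ⟶ H := (snd H G ≫ m) * fst H G
  let e := Module.Basis.ofVectorSpace ℂ (Fn G)
  obtain ⟨s, hs⟩ := Fn.exists_expansion e (Fn.comp rc f)
  have hs := hs s subset_rfl
  let b (k) : Fn H := Fn.slice (e.coord k) (Fn.comp rc f)
  have hb (k) : b k = Fn.slice (e.coord k) (Fn.comp rc f) := rfl
  have hbV (k) (hk : k ∈ s) : b k ∈ Submodule.span ℂ (b '' (s : Set _)) :=
    Submodule.subset_span ⟨k, hk, rfl⟩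
  refine ⟨Submodule.span ℂ (b '' (s : Set _)), FiniteDimensional.span_of_finite ℂ
    (s.finite_toSet.image b), ?_, fun v hv => ?_, fun v hv => ?_⟩
  · have h1 : lift (𝟙 H) (1 : H ⟶ G) ≫ rc = 𝟙 H := by
      have h2 : (1 : H ⟶ G) ≫ m = 1 := by
        have := hm (1 : H ⟶ G) 1
        rwa [one_mul, left_eq_mul] at this
      rw [MonObj.comp_mul, lift_snd_assoc, lift_fst, h2, one_mul]
    have h2 := congrArg (Fn.comp (lift (𝟙 H) (1 : H ⟶ G))) hs
    rw [Fn.comp_comp, h1, Fn.comp_id, map_sum] at h2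
    rw [h2]
    refine Submodule.sum_mem _ fun k hk => ?_
    rw [map_mul, Fn.comp_comp, Fn.comp_comp, lift_fst, lift_snd, Fn.comp_id]
    obtain ⟨z, hz⟩ := Fn.exists_comp_one_eq (G := G) (T := H) (e k)
    rw [hz, mul_comm, ← Algebra.smul_def]
    exact Submodule.smul_mem _ _ (hbV k hk)
  · induction hv using Submodule.span_induction with
    | mem v hv =>
      obtain ⟨k, hk, rfl⟩ := hv
      have h1 : m ▷ G ≫ rc = (snd G G * fst G G) ≫ m := by
        rw [hm, MonObj.comp_mul, whiskerRight_snd_assoc, whiskerRight_fst]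
      rw [hb, Fn.comp_slice, Fn.comp_comp, h1, ← Fn.comp_comp, hf, map_zero, map_zero]
    | zero => exact map_zero _
    | add v w _ _ hv hw => rw [map_add, hv, hw, add_zero]
    | smul c v _ hv =>
      have : Fn.comp m (c • v) = c • Fn.comp m v := map_smul (Fn.compₐ m) _ _
      rw [this, hv, smul_zero]
  · induction hv using Submodule.span_induction with
    | mem v hv =>
      obtain ⟨k, hk, rfl⟩ := hv
      -- `((g, h), g') ↦ (h, g' g)`. Associativity rewrites `f(m(g') m(g) h)` as `f(m(g' g) h)`, so
      -- `b_k(m(g) h)` is a combination of the `b_l(h)` with coefficients in `g`.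
      let w : (G ⊗ H) ⊗ G ⟶ H ⊗ G :=
        lift (fst _ _ ≫ snd G H) (snd (G ⊗ H) G * (fst (G ⊗ H) G ≫ fst G H))
      have h1 : leftTrans m ▷ G ≫ rc = w ≫ rc := by
        simp only [rc, w, MonObj.comp_mul, whiskerRight_snd_assoc, whiskerRight_fst,
          lift_fst, lift_snd_assoc, hm, Category.assoc, mul_assoc]
      have h2 : w ≫ fst H G = fst _ _ ≫ snd G H := lift_fst _ _
      have h3 : w ≫ snd H G = (fst G H ▷ G) ≫ (snd G G * fst G G) := by
        rw [lift_snd, MonObj.comp_mul, whiskerRight_snd, whiskerRight_fst]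
      rw [hb, Fn.comp_slice, Fn.comp_comp, h1, ← Fn.comp_comp, hs, map_sum, map_sum]
      refine Submodule.sum_mem _ fun l hl => Submodule.subset_span
        ⟨Fn.slice (e.coord k) (Fn.comp (snd G G * fst G G) (e l)), b l, hbV l hl, ?_⟩
      rw [map_mul, Fn.comp_comp, Fn.comp_comp, h2, h3, ← Fn.comp_comp (fst (G ⊗ H) G),
        Fn.slice_fst_mul, ← Fn.comp_comp, ← Fn.comp_slice, mul_comm]
    | zero => rw [map_zero]; exact Submodule.zero_mem _
    | add v w _ _ hv hw => rw [map_add]; exact Submodule.add_mem _ hv hw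
    | smul c v _ hv =>
      have : Fn.comp (leftTrans m) (c • v) = c • Fn.comp (leftTrans m) v :=
        map_smul (Fn.compₐ _) _ _
      rw [this]; exact Submodule.smul_mem _ _ hv

include hm in
/-- The ideal of a subgroup is generated by a finite dimensional space that is stable under left
translations. -/
lemma exists_stable_span :
    ∃ (d : ℕ) (F : Fin d → Fn H) (l : Fin d → Fn H →ₗ[ℂ] ℂ) (D : Matrix (Fin d) (Fin d) (Fn G)),
      (∀ i j, l i (F j) = if i = j then 1 else 0) ∧ (∀ i, Fn.comp m (F i) = 0) ∧
      (∀ f, Fn.comp m f = 0 → f ∈ Ideal.span (Set.range F)) ∧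
      ∀ i, Fn.comp (leftTrans m) (F i) =
        ∑ j, Fn.comp (fst G H) (D i j) * Fn.comp (snd G H) (F j) := by
  have hno : IsNoetherianRing (Fn H) := Algebra.FiniteType.isNoetherianRing ℂ (Fn H)
  obtain ⟨t, ht⟩ := (isNoetherianRing_iff_ideal_fg _).1 hno (RingHom.ker (Fn.comp m))
  have ht' (f : t) : Fn.comp m f.1 = 0 := by
    have : f.1 ∈ RingHom.ker (Fn.comp m) := ht ▸ Ideal.subset_span f.2
    exact this
  choose V hV1 hV2 hV3 hV4 using fun f : t => exists_stable_of_comp_eq_zero hm f.1 (ht' f)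
  let W : Submodule ℂ (Fn H) := ⨆ f, V f
  have hW1 : FiniteDimensional ℂ W := Submodule.finite_iSup V
  have hW3 (v) (hv : v ∈ W) : Fn.comp m v = 0 := by
    induction hv using Submodule.iSup_induction' with
    | mem f v hv => exact hV3 f v hv
    | zero => exact map_zero _
    | add v w _ _ hv hw => rw [map_add, hv, hw, add_zero]
  have hW4 (v) (hv : v ∈ W) : Fn.comp (leftTrans m) v ∈ Fn.boxSpan G W := by
    induction hv using Submodule.iSup_induction' with
    | mem f v hv => exact Fn.boxSpan_mono G (le_iSup V f) (hV4 f v hv)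
    | zero => rw [map_zero]; exact Submodule.zero_mem _
    | add v w _ _ hv hw => rw [map_add]; exact Submodule.add_mem _ hv hw
  -- A basis of the space, and not just generators, so that dual linear forms on all functions exist
  -- and the coefficients `D` of the translations are unique.
  let b := Module.finBasis ℂ W
  choose D hD using fun i => Fn.exists_eq_sum_of_mem_boxSpan b (hW4 (b i) (b i).2)
  choose l hl using fun i => LinearMap.exists_extend (b.coord i)
  refine ⟨_, fun i => b i, l, D, fun i j => ?_, fun i => hW3 _ (b i).2, fun f hf => ?_, hD⟩
  · have h1 : l i (b j) = b.coord i (b j) := congrArg (fun u => u (b j)) (hl i)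
    rw [h1, Module.Basis.coord_apply, Module.Basis.repr_self, Finsupp.single_apply]
    exact if_congr eq_comm rfl rfl
  · have h1 : f ∈ Ideal.span (t : Set (Fn H)) := ht ▸ hf
    refine (Ideal.span_le (I := Ideal.span (Set.range fun i => (b i : Fn H)))).2 ?_ h1
    intro g hg
    have h2 : g ∈ W := (le_iSup V ⟨g, hg⟩) (hV2 ⟨g, hg⟩)
    rw [SetLike.mem_coe, eq_sum_repr_smul b h2]
    refine Submodule.sum_mem _ fun j _ => ?_
    rw [Algebra.smul_def]
    exact Ideal.mul_mem_left _ _ (Ideal.subset_span ⟨j, rfl⟩)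

end StableSubspace

/-! ### A closed subgroup as a stabilizer. -/

section Linearization

variable {G H : SchC} [GrpObj G] [GrpObj H]

/-- Data that describe a closed subgroup `m : G ⟶ H` as a stabilizer: functions `F i` on `H` that
define the subgroup, the matrix `D` of the left translations of the `F i`, and the expansion
`F i (x y) = ∑ k, c i k (x) e k (y)` of their right translations. -/
structure Linearization (m : G ⟶ H) where
  d : ℕ
  n : ℕ
  F : Fin d → Fn H
  D : Matrix (Fin d) (Fin d) (Fn G)
  c : Matrix (Fin d) (Fin n) (Fn H)
  r : Matrix (Fin n) (Fin d) (Fn H)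
  e : Fin n → Fn H
  D_mul : ∀ {T : SchC} (g g' : T ⟶ G),
    D.map (Fn.comp (g * g')) = D.map (Fn.comp g) * D.map (Fn.comp g')
  D_one : ∀ T : SchC, D.map (Fn.comp (1 : T ⟶ G)) = 1
  c_mul : ∀ {T : SchC} (g : T ⟶ G) (h : T ⟶ H),
    c.map (Fn.comp ((g ≫ m) * h)) = D.map (Fn.comp g) * c.map (Fn.comp h)
  c_mul_r : c * r = 1
  F_mul : ∀ {T : SchC} (h h' : T ⟶ H) (i : Fin d),
    Fn.comp (h * h') (F i) = ∑ k, Fn.comp h (c i k) * Fn.comp h' (e k)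
  F_one : ∀ (T : SchC) (i : Fin d), Fn.comp (1 : T ⟶ H) (F i) = 0
  exists_lift : ∀ {T : SchC} (h : T ⟶ H), (∀ i, Fn.comp h (F i) = 0) → ∃ g : T ⟶ G, g ≫ m = h

variable [IsAffine G.sch] [IsAffine H.sch] {m : G ⟶ H}

/-- All identities for `D` and `c` come from evaluating an `F i` at a product in two ways and
comparing coefficients, which is possible because the `F i` and the `e k` have dual linear forms.
The lifting property holds because the `F i` generate the ideal of the subgroup. -/
lemma exists_linearization (hm : ∀ {T : SchC} (u v : T ⟶ G), (u * v) ≫ m = (u ≫ m) * (v ≫ m))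
    (hs : Function.Surjective (Fn.comp m)) : Nonempty (Linearization m) := by
  classical
  have hm1 (T : SchC) : (1 : T ⟶ G) ≫ m = 1 := by
    have := hm (1 : T ⟶ G) 1
    rwa [one_mul, left_eq_mul] at this
  obtain ⟨d, F, l, D, hl, hF0, hF, hD⟩ := exists_stable_span hm
  have hD' {T : SchC} (g : T ⟶ G) (h : T ⟶ H) (i : Fin d) :
      Fn.comp ((g ≫ m) * h) (F i) = ∑ j, Fn.comp g (D i j) * Fn.comp h (F j) := by
    have h1 := congrArg (Fn.comp (lift g h)) (hD i)
    rw [Fn.comp_comp, lift_leftTrans, map_sum] at h1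
    simpa only [map_mul, Fn.comp_comp, lift_fst, lift_snd] using h1
  let e := Module.Basis.ofVectorSpace ℂ (Fn H)
  have hexp (i : Fin d) := Fn.exists_expansion e (Fn.comp (fst H H * snd H H) (F i))
  choose s hs' using hexp
  -- One finite set of basis elements that serves the expansions of all `F i` simultaneously.
  let S := Finset.univ.biUnion s
  let q := S.equivFin
  let c : Matrix (Fin d) (Fin S.card) (Fn H) := .of fun i k =>
    Fn.slice (e.coord (q.symm k)) (Fn.comp (fst H H * snd H H) (F i))
  let e' : Fin S.card → Fn H := fun k => e (q.symm k)
  have he' (i j : Fin S.card) : e.coord (q.symm i) (e' j) = if i = j then 1 else 0 := by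
    rw [Module.Basis.coord_apply, Module.Basis.repr_self, Finsupp.single_apply]
    exact if_congr (by rw [Subtype.coe_inj, q.symm.injective.eq_iff, eq_comm]) rfl rfl
  have hc {T : SchC} (h h' : T ⟶ H) (i : Fin d) :
      Fn.comp (h * h') (F i) = ∑ k, Fn.comp h (c i k) * Fn.comp h' (e' k) := by
    have h1 := hs' i S (Finset.subset_biUnion_of_mem s (Finset.mem_univ i))
    have h2 := congrArg (Fn.comp (lift h h')) h1
    rw [Fn.comp_comp, MonObj.comp_mul, lift_fst, lift_snd, map_sum] at h2
    simp only [map_mul, Fn.comp_comp, lift_fst, lift_snd] at h2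
    rw [h2, ← Finset.sum_coe_sort]
    exact (Equiv.sum_comp q.symm _).symm
  -- Write `F_i(h') = F_i(h · h⁻¹ h') = ∑ c_ik(h) e_k(h⁻¹ h')` and apply the dual form `l_j` in
  -- `h'`. The left side becomes `δ_ij`, so the slices of `e_k(h⁻¹ h')` form a right inverse of `c`.
  let r : Matrix (Fin S.card) (Fin d) (Fn H) := .of fun k j =>
    Fn.slice (l j) (Fn.comp ((fst H H)⁻¹ * snd H H) (e' k))
  refine ⟨⟨d, S.card, F, D, c, r, e', fun {T} g g' => ?_, fun T => ?_, fun {T} g h => ?_, ?_, hc,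
    fun T i => ?_, fun {T} h hh => ?_⟩⟩
  · have key : D.map (Fn.comp (fst G G * snd G G)) =
        D.map (Fn.comp (fst G G)) * D.map (Fn.comp (snd G G)) := by
      funext i
      refine Fn.eq_of_sum_eq (X := G ⊗ G) F l hl ?_
      have h1 := hD' (fst (G ⊗ G) H ≫ (fst G G * snd G G)) (snd (G ⊗ G) H) i
      rw [MonObj.comp_mul, hm, mul_assoc, hD'] at h1
      simp only [Matrix.map_apply, Fn.comp_comp, MonObj.comp_mul, Matrix.mul_apply, map_sum,
        map_mul]
      rw [← h1]
      simp only [hD', Finset.mul_sum, Finset.sum_mul, mul_assoc]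
      exact Finset.sum_comm
    have h1 := congrArg (fun M => M.map (Fn.comp (lift g g'))) key
    simp only [Matrix.map_mul, Matrix.map_map] at h1
    simpa only [Function.comp_def, Fn.comp_comp, MonObj.comp_mul, lift_fst, lift_snd] using h1
  · have : IsAffine (𝟙_ SchC).sch := inferInstanceAs (IsAffine (Spec _))
    have key : D.map (Fn.comp (1 : 𝟙_ SchC ⟶ G)) = 1 := by
      funext i
      refine Fn.eq_of_sum_eq (X := 𝟙_ SchC) F l hl ?_
      have h1 := hD' (fst (𝟙_ SchC) H ≫ (1 : 𝟙_ SchC ⟶ G)) (snd (𝟙_ SchC) H) i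
      rw [Category.assoc, hm1, MonObj.comp_one, one_mul] at h1
      simp only [Matrix.map_apply, Fn.comp_comp, Matrix.one_apply, apply_ite (Fn.comp _), map_one,
        map_zero, ite_mul, one_mul, zero_mul, Finset.sum_ite_eq, Finset.mem_univ, if_true]
      exact h1.symm
    have h1 := congrArg (fun M => M.map (Fn.comp (toUnit T))) key
    simp only [Matrix.map_map] at h1
    rw [Matrix.map_one _ (map_zero _) (map_one _)] at h1
    simpa only [Function.comp_def, Fn.comp_comp, MonObj.comp_one] using h1
  · have key : c.map (Fn.comp (leftTrans m)) =
        D.map (Fn.comp (fst G H)) * c.map (Fn.comp (snd G H)) := by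
      funext i
      refine Fn.eq_of_sum_eq (X := G ⊗ H) e' (fun k => e.coord (q.symm k)) he' ?_
      have h1 := hD' (fst (G ⊗ H) H ≫ fst G H) ((fst (G ⊗ H) H ≫ snd G H) * snd (G ⊗ H) H) i
      rw [← mul_assoc, Category.assoc, ← MonObj.comp_mul, hc] at h1
      simp only [Matrix.map_apply, Fn.comp_comp, Matrix.mul_apply, map_sum, map_mul]
      rw [h1]
      simp only [hc, Finset.mul_sum, Finset.sum_mul, mul_assoc]
      exact Finset.sum_comm
    have h1 := congrArg (fun M => M.map (Fn.comp (lift g h))) key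
    simp only [Matrix.map_mul, Matrix.map_map] at h1
    simpa only [Function.comp_def, Fn.comp_comp, lift_leftTrans, lift_fst, lift_snd] using h1
  · ext i j
    have h1 := hc (fst H H) ((fst H H)⁻¹ * snd H H) i
    rw [mul_inv_cancel_left] at h1
    have h2 := congrArg (Fn.slice (l j)) h1
    rw [Fn.slice_snd, map_sum, hl] at h2
    simp only [Fn.slice_fst_mul] at h2
    rw [Matrix.mul_apply, Matrix.one_apply]
    refine Eq.trans h2.symm ?_
    rw [ite_smul, one_smul, zero_smul]
    exact if_congr eq_comm rfl rfl
  · rw [← hm1, ← Fn.comp_comp, hF0, map_zero]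
  · obtain ⟨g, hg⟩ := exists_lift_of_surjective hs h (fun f hf => by
      have h1 : Ideal.span (Set.range F) ≤ RingHom.ker (Fn.comp h) := by
        rw [Ideal.span_le]
        rintro _ ⟨i, rfl⟩
        exact hh i
      exact h1 (hF f hf))
    exact ⟨g, hg⟩

end Linearization

/-! ### The general linear group as a group scheme. -/

section GLGroup

/-- The functor of invertible matrices of functions. -/
def glFunctor (n : ℕ) : SchCᵒᵖ ⥤ GrpCat.{0} where
  obj T := GrpCat.of (Matrix.GeneralLinearGroup (Fin n) (Fn T.unop))
  map u := GrpCat.ofHom (Matrix.GeneralLinearGroup.map (Fn.comp u.unop))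
  map_id T := by
    ext g : 2
    refine Matrix.GeneralLinearGroup.ext fun i j => ?_
    exact Fn.comp_id _
  map_comp u v := by
    ext g : 2
    refine Matrix.GeneralLinearGroup.ext fun i j => ?_
    exact (Fn.comp_comp _ _ _).symm

lemma glMap_glMap {n : ℕ} {X Y Z : SchC} (u : X ⟶ Y) (v : Y ⟶ Z)
    (M : Matrix.GeneralLinearGroup (Fin n) (Fn Z)) :
    Matrix.GeneralLinearGroup.map (Fn.comp u) (Matrix.GeneralLinearGroup.map (Fn.comp v) M) =
      Matrix.GeneralLinearGroup.map (Fn.comp (u ≫ v)) M :=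
  Matrix.GeneralLinearGroup.ext fun _ _ => Fn.comp_comp u v _

variable {R : MotivicTheory.{w}}

/-- The group structure comes from representability. The natural isomorphism `φ` allows later
calculations to be done with matrices of functions on a test scheme. -/
lemma MotivicTheory.HasClass.exists_glGroup {n : ℕ} {c : R.obj (𝟙_ SchC)}
    (h : R.HasClass (glCond n) c) :
    ∃ (X : SchC) (_ : IsAffine X.sch) (_ : GrpObj X)
      (φ : ∀ T : SchC, (T ⟶ X) ≃* Matrix.GeneralLinearGroup (Fin n) (Fn T)),
      (∀ {T T' : SchC} (u : T' ⟶ T) (v : T ⟶ X),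
        φ T' (u ≫ v) = Matrix.GeneralLinearGroup.map (Fn.comp u) (φ T v)) ∧ R.clsA X = c := by
  obtain ⟨X, hXa, x, hx, hc⟩ := h
  let f {T : SchC} (u : T ⟶ X) : Matrix.GeneralLinearGroup (Fin n) (Fn T) :=
    .mk'' (.of fun i j => Fn.comp u (x (i, j))) (hx.mem u)
  have hf {T : SchC} (u : T ⟶ X) (i j : Fin n) : f u i j = Fn.comp u (x (i, j)) := rfl
  have hbij (T : SchC) : Function.Bijective (f : (T ⟶ X) → _) := by
    refine ⟨fun u u' huu' => hx.hom_ext fun ⟨i, j⟩ => ?_, fun M => ?_⟩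
    · rw [← hf, huu', hf]
    · obtain ⟨u, hu⟩ := hx.exists_hom (fun p => M p.1 p.2)
        ((Matrix.isUnit_iff_isUnit_det _).1 M.isUnit)
      exact ⟨u, Matrix.GeneralLinearGroup.ext fun i j => hu (i, j)⟩
  have hcomp {T T' : SchC} (u : T' ⟶ T) (v : T ⟶ X) :
      f (u ≫ v) = Matrix.GeneralLinearGroup.map (Fn.comp u) (f v) :=
    Matrix.GeneralLinearGroup.ext fun i j => (Fn.comp_comp u v _).symm
  let α : (glFunctor n ⋙ forget _).RepresentableBy X :=
    { homEquiv := fun {T} => Equiv.ofBijective f (hbij T)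
      homEquiv_comp := hcomp }
  let grp : GrpObj X := GrpObj.ofRepresentableBy X (glFunctor n) α
  have hmul {T : SchC} (u v : T ⟶ X) : f (u * v) = f u * f v := by
    have h1 : f (MonObj.mul (X := X)) = f (fst X X) * f (snd X X) :=
      α.homEquiv.apply_symm_apply _
    rw [Hom.mul_def, hcomp, h1, map_mul, ← hcomp, ← hcomp, lift_fst, lift_snd]
  exact ⟨X, hXa, grp, fun T => MulEquiv.mk (Equiv.ofBijective f (hbij T)) hmul, hcomp, hc⟩

end GLGroup

/-! ### Invertibility of the class of a special group. -/

section GroupClass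

variable {G : SchC} [GrpObj G]

/-- The action of `G` on a group by left translations along a homomorphism. -/
@[reducible]
def leftTransAction {Z : SchC} [GrpObj Z] (δ : G ⟶ Z)
    (hδ : ∀ {T : SchC} (u v : T ⟶ G), (u * v) ≫ δ = (u ≫ δ) * (v ≫ δ)) : ModObj G Z :=
  modObjOfPoints (leftTrans δ)
    (by
      have h1 : (1 : Z ⟶ G) ≫ δ = 1 := by
        have := hδ (1 : Z ⟶ G) 1
        rwa [one_mul, left_eq_mul] at this
      rw [lift_leftTrans, h1, one_mul])
    (fun T g h x => by simp only [lift_leftTrans, hδ, mul_assoc])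

lemma leftTransAction_smul {Z : SchC} [GrpObj Z] (δ : G ⟶ Z)
    (hδ : ∀ {T : SchC} (u v : T ⟶ G), (u * v) ≫ δ = (u ≫ δ) * (v ≫ δ)) {T : SchC} (g : T ⟶ G)
    (z : T ⟶ Z) :
    letI := leftTransAction δ hδ
    g • z = (g ≫ δ) * z :=
  lift_leftTrans δ g z

/-- A linear algebraic group is a closed subgroup of a general linear group. -/
lemma IsLinearAlgebraic.exists_hom (hG : IsLinearAlgebraic G) :
    ∃ n : ℕ, ∀ {H : SchC} [GrpObj H]
      (φ : ∀ T : SchC, (T ⟶ H) ≃* Matrix.GeneralLinearGroup (Fin n) (Fn T)),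
      (∀ {T T' : SchC} (u : T' ⟶ T) (v : T ⟶ H),
        φ T' (u ≫ v) = Matrix.GeneralLinearGroup.map (Fn.comp u) (φ T v)) →
      ∃ m : G ⟶ H, (∀ {T : SchC} (u v : T ⟶ G), (u * v) ≫ m = (u ≫ m) * (v ≫ m)) ∧
        Function.Surjective (Fn.comp m) := by
  obtain ⟨n, M, hM, hgen⟩ := hG.closed_embedding
  refine ⟨n, fun {H} _ φ hφ => ⟨(φ G).symm M, fun {T} u v => ?_, ?_⟩⟩
  · have h := congrArg (Matrix.GeneralLinearGroup.map (Fn.comp (lift u v))) hM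
    rw [map_mul, glMap_glMap, glMap_glMap, glMap_glMap, lift_fst, lift_snd] at h
    apply (φ T).injective
    rw [map_mul, hφ, hφ, hφ, MulEquiv.apply_symm_apply, Hom.mul_def]
    exact h
  · let m := (φ G).symm M
    have h : M = Matrix.GeneralLinearGroup.map (Fn.comp m) (φ H (𝟙 H)) := by
      rw [← hφ, Category.comp_id, MulEquiv.apply_symm_apply]
    have h' : M⁻¹ = Matrix.GeneralLinearGroup.map (Fn.comp m) (φ H (𝟙 H))⁻¹ := by
      rw [map_inv, ← h]
    rw [← RingHom.range_eq_top, eq_top_iff, ← hgen, Subring.closure_le]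
    rintro f ((⟨z, rfl⟩ | ⟨k, rfl⟩) | ⟨k, rfl⟩)
    · exact ⟨Fn.comp (toUnit H) z, by rw [Fn.comp_comp, toUnit_unique (_ ≫ _) (toUnit G)]⟩
    · exact ⟨φ H (𝟙 H) k.1 k.2, congrArg (fun N => N k.1 k.2) h.symm⟩
    · exact ⟨(φ H (𝟙 H))⁻¹ k.1 k.2, congrArg (fun N => N k.1 k.2) h'.symm⟩

variable {R : MotivicTheory.{w}}

/-- Geometrically, `h ↦` the row space of `c(h)` sends `H / G` to a Grassmannian. The extra factor
`L = GL_d` passes to frames of these row spaces, which are matrices and so lie in an affine space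
`S`. This makes `H × L` a torsor, possibly with empty fibres, over an affine base. Then `[G]`
divides `[H] [L]`, a unit. -/
lemma MotivicTheory.isUnit_groupClass (hL : IsUnit R.lefschetz)
    (hLn : ∀ n : ℕ, 0 < n → IsUnit (R.lefschetz ^ n - 1)) (hG : IsLinearAlgebraic G)
    (hs : IsSpecial G) : IsUnit (R.groupClass hG) := by
  have := hG.affine
  obtain ⟨n, hn⟩ := hG.exists_hom
  obtain ⟨a, ha, ha'⟩ := HasClass.exists_gl_isUnit hL hLn n
  obtain ⟨H, _, _, φ, hφ, rfl⟩ := ha.exists_glGroup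
  obtain ⟨m, hm, hms⟩ := hn φ hφ
  obtain ⟨W⟩ := exists_linearization hm hms
  obtain ⟨b, hb, hb'⟩ := HasClass.exists_gl_isUnit hL hLn W.d
  obtain ⟨L, _, _, χ, hχ, rfl⟩ := hb.exists_glGroup
  let Dg {T : SchC} (g : T ⟶ G) : Matrix.GeneralLinearGroup (Fin W.d) (Fn T) :=
    ⟨W.D.map (Fn.comp g), W.D.map (Fn.comp g⁻¹), by rw [← W.D_mul, mul_inv_cancel, W.D_one],
      by rw [← W.D_mul, inv_mul_cancel, W.D_one]⟩
  have hDg {T : SchC} (g : T ⟶ G) : (Dg g).val = W.D.map (Fn.comp g) := rfl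
  let ε : G ⟶ L := (χ G).symm (Dg (𝟙 G))
  have hε {T : SchC} (g : T ⟶ G) : χ T (g ≫ ε) = Dg g := by
    rw [hχ, MulEquiv.apply_symm_apply]
    refine Units.ext (Matrix.ext fun i j => ?_)
    show Fn.comp g (Fn.comp (𝟙 G) (W.D i j)) = Fn.comp g (W.D i j)
    rw [Fn.comp_id]
  have hδ {T : SchC} (u v : T ⟶ G) :
      (u * v) ≫ lift m ε = (u ≫ lift m ε) * (v ≫ lift m ε) := by
    apply CartesianMonoidalCategory.hom_ext
    · rw [MonObj.mul_comp _ _ (fst H L), Category.assoc, Category.assoc, Category.assoc,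
        lift_fst, hm]
    · rw [MonObj.mul_comp _ _ (snd H L), Category.assoc, Category.assoc, Category.assoc, lift_snd]
      apply (χ T).injective
      rw [map_mul, hε, hε, hε]
      exact Units.ext (W.D_mul u v)
  let act : ModObj G (H ⊗ L) := leftTransAction (lift m ε) hδ
  obtain ⟨S, _, y, hy, -⟩ := (HasClass.affineSpace R (W.d * W.n)).reindex
    (finProdFinEquiv (m := W.d) (n := W.n))
  -- `P(h, t) = t⁻¹ c(h)`. It is invariant under `(h, t) ↦ (m(g) h, D(g) t)` because `c(m(g) h) =
  -- D(g) c(h)`.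
  let P {T : SchC} (z : T ⟶ H ⊗ L) : Matrix (Fin W.d) (Fin W.n) (Fn T) :=
    ((χ T (z ≫ snd H L))⁻¹).val * W.c.map (Fn.comp (z ≫ fst H L))
  obtain ⟨p, hp⟩ := hy.exists_hom (fun s => P (𝟙 (H ⊗ L)) s.1 s.2) trivial
  have hp' {T : SchC} (z : T ⟶ H ⊗ L) (i k) : Fn.comp (z ≫ p) (y (i, k)) = P z i k := by
    have h1 : P z = (P (𝟙 (H ⊗ L))).map (Fn.comp z) := by
      have h2 := hχ z (snd H L)
      have h3 : ((χ T (z ≫ snd H L))⁻¹).val =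
          ((χ _ (snd H L))⁻¹).val.map (Fn.comp z) := by
        rw [h2, ← map_inv]; rfl
      simp only [P]
      rw [Matrix.map_mul, Matrix.map_map, Category.id_comp, Category.id_comp, h3]
      congr 1
    rw [← Fn.comp_comp, hp, h1]
    rfl
  have hpp {T : SchC} (z z' : T ⟶ H ⊗ L) : z ≫ p = z' ≫ p ↔ P z = P z' := by
    refine ⟨fun h => Matrix.ext fun i k => by rw [← hp', ← hp', h],
      fun h => hy.hom_ext fun ⟨i, k⟩ => by rw [hp', hp', h]⟩
  have hsmul {T : SchC} (g : T ⟶ G) (z : T ⟶ H ⊗ L) : g • z = (g ≫ lift m ε) * z :=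
    leftTransAction_smul _ _ g z
  have hfst {T : SchC} (g : T ⟶ G) (z : T ⟶ H ⊗ L) :
      (g • z) ≫ fst H L = (g ≫ m) * (z ≫ fst H L) := by
    rw [hsmul, MonObj.mul_comp, Category.assoc, lift_fst]
  have hsnd {T : SchC} (g : T ⟶ G) (z : T ⟶ H ⊗ L) :
      (g • z) ≫ snd H L = (g ≫ ε) * (z ≫ snd H L) := by
    rw [hsmul, MonObj.mul_comp, Category.assoc, lift_snd]
  have hPs {T : SchC} (g : T ⟶ G) (z : T ⟶ H ⊗ L) : P (g • z) = P z := by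
    simp only [P]
    have h1 : ((Dg g)⁻¹).val * (Dg g).val = 1 := (Dg g).inv_mul
    rw [hfst, hsnd, W.c_mul, map_mul, hε, mul_inv_rev, Units.val_mul, ← hDg, Matrix.mul_assoc,
      ← Matrix.mul_assoc _ (Dg g).val, h1, Matrix.one_mul]
  have htors : IsPullback (MotivicVC.act G (H ⊗ L)) (snd G (H ⊗ L)) p p := by
    refine isPullback_of_points p ?_ (fun T z z' hz => ?_) (fun T g g' z hz => ?_)
    · rw [act_eq_smul, hpp, hPs]
    · rw [hpp] at hz
      let t := χ T (z ≫ snd H L)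
      let t' := χ T (z' ≫ snd H L)
      let h := z ≫ fst H L
      let h' := z' ≫ fst H L
      have h1 : W.c.map (Fn.comp h) = (t * t'⁻¹).val * W.c.map (Fn.comp h') := by
        have h2 := congrArg (t.val * ·) hz
        simp only [P, ← Matrix.mul_assoc] at h2
        rw [Units.mul_inv, Matrix.one_mul] at h2
        rw [h2, Units.val_mul]
      -- From `c(h) = t t'⁻¹ c(h')` it follows that `F_i(h h'⁻¹)` is a combination of the values
      -- `F_j(h' h'⁻¹) = F_j(1) = 0`, so `h h'⁻¹` lies in `G`.
      obtain ⟨g, hg⟩ := W.exists_lift (h * h'⁻¹) (fun i => by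
        have h2 (k) : Fn.comp h (W.c i k) =
            ∑ j, (t * t'⁻¹).val i j * Fn.comp h' (W.c j k) :=
          congrArg (fun N => N i k) h1
        have h3 (j) := W.F_mul h' h'⁻¹ j
        simp only [mul_inv_cancel, W.F_one] at h3
        rw [W.F_mul]
        simp only [h2, Finset.sum_mul, mul_assoc]
        rw [Finset.sum_comm]
        simp only [← Finset.mul_sum, ← h3, mul_zero, Finset.sum_const_zero])
      have h2 : W.c.map (Fn.comp h) = (Dg g).val * W.c.map (Fn.comp h') := by
        rw [hDg, ← W.c_mul, hg, inv_mul_cancel_right]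
      have h3 : W.c.map (Fn.comp h') * W.r.map (Fn.comp h') = 1 := by
        rw [← Matrix.map_mul, W.c_mul_r, Matrix.map_one _ (map_zero _) (map_one _)]
      -- Both matrices have the same product with `c(h')`, which has a right inverse.
      have h4 : Dg g = t * t'⁻¹ := by
        have h5 := congrArg (· * W.r.map (Fn.comp h')) (h2.symm.trans h1)
        simp only [Matrix.mul_assoc, h3, Matrix.mul_one] at h5
        exact Units.ext h5
      refine ⟨g, CartesianMonoidalCategory.hom_ext _ _ ?_ ?_⟩
      · rw [hfst, hg, inv_mul_cancel_right]
      · rw [hsnd]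
        apply (χ T).injective
        rw [map_mul, hε, h4, inv_mul_cancel_right]
    -- The action is free already on the factor `H`, since `m` is a monomorphism.
    · have h1 := congrArg (· ≫ fst H L) hz
      simp only [hfst, mul_left_inj] at h1
      have := mono_of_surjective hms
      rwa [cancel_mono] at h1
  have h1 := torsorDvd (R := R) (hG := hG) hs S (H ⊗ L) p htors
  have h2 : R.clsA (H ⊗ L) = R.clsA H * R.clsA L := R.cls_prod _ _ _
  rw [h2] at h1
  exact isUnit_of_dvd_unit h1 (ha'.mul hb')

end GroupClass

end MotivicVC

end

theorem mainTheorem4 (R : MotivicVC.MotivicTheory) (hL : IsUnit R.lefschetz)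
    (hLn : ∀ n : ℕ, 0 < n → IsUnit (R.lefschetz ^ n - 1)) :
    Set.BijOn (MotivicVC.restrictToSchemes R)
      {φ | MotivicVC.IsStackyVanishingCycle R φ} {ψ | MotivicVC.IsVanishingCycle R ψ} ∧
    ∀ φ : MotivicVC.SVCFamily R, MotivicVC.IsStackyVanishingCycle R φ →
      ∀ (Γ : MotivicVC.GroupFamily) (hΓ : Γ.Admissible) (X : MotivicVC.GSpace Γ)
        (hX : X.IsSmooth) (f : MotivicVC.InvFn X) (i : Γ.I),
        IsUnit (R.groupClass (hΓ.linear i)) ∧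
        (φ Γ hΓ X hX f i : R.obj (X.X i)) =
          R.smul (Ring.inverse (R.groupClass (hΓ.linear i)))
            (R.pushQuotient (hΓ.linear i)
              (MotivicVC.restrictToSchemes R φ (X.X i) (hX i) (f.f i))) := by
  refine ⟨MotivicVC.bijOn_restrictToSchemes, fun φ hφ Γ hΓ X hX f i => ?_⟩
  have h1 := MotivicVC.MotivicTheory.isUnit_groupClass hL hLn (hΓ.linear i) (hΓ.special i)
  refine ⟨h1, ?_⟩
  -- The value on the atlas is the invariant element `φ_𝔣` itself, so `ρ_!` multiplies it by `[G]`,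
  -- which the inverse cancels.
  rw [← hφ.apply_eq hΓ hX f i, R.pushQuotient_of_mem_invariants _ _ (φ Γ hΓ X hX f i).2,
    R.smul_inverse_smul h1]
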